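/- Let $\mathbb{H}^2$ be the hyperbolic plane, identified with the hyperboloid $\{x_1=0,\ x_0>0,\ -x_0^2+x_2^2+x_3^2=-1\}$ in $\mathbb{R}^4$. For $x\in\mathbb{H}^2$ and $t\in[0,\pi/2)$ put $\tilde\Psi(x,t)=\cos(t)\,x+\sin(t)\,(0,-1,0,0)$, let $\Psi(x,t)\in\mathbb{R}^3$ be its image under the affine chart $[x_0,x_1,x_2,x_3]\mapsto(x_1/x_0,x_2/x_0,x_3/x_0)$, with first coordinate regarded as vertical, and let $\bar x$ be the point of the open unit disc $\mathbb{D}$ corresponding to $\Psi(x,0)$. A function $u:\mathbb{H}^2\to\mathbb{R}$ is *C-convex* if there is $R<\pi/2$ with $0\le u\le R$ and the function $\bar u:\mathbb{D}\to\mathbb{R}$ whose graph is $\{\Psi(x,u(x)) : x\in\mathbb{H}^2\}$ (that is, $\bar u(\bar x)=-\tan(u(x))\sqrt{1-\|\bar x\|^2}$) is convex. For such $u$ and a Lipschitz curve $c:[0,1]\to\mathbb{H}^2$ let $$\mathcal{L}_u(c)=\int_0^1\sqrt{\cos^2(u(c(t)))\,\|c'(t)\|_{\mathbb{H}^2}^2-\big((u\circ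 c)'(t)\big)^2}\,dt,$$ and let $d_u(x,y)$ be the infimum of $\mathcal{L}_u(c)$ over the Lipschitz curves $c$ from $x$ to $y$. A *Fuchsian group* is a discrete group of orientation preserving isometries of $\mathbb{H}^2$ acting freely and cocompactly. A *Fuchsian C-convex function* is a pair $(u,\Gamma)$ where $u$ is C-convex, $\Gamma$ is a Fuchsian group, and $u\circ\sigma=u$ for all $\sigma\in\Gamma$. For such a pair, $\bar d_u$ denotes the distance induced by $d_u$ on $\mathbb{H}^2/\Gamma$: $\bar d_u(p,q)$ is the infimum of $d_u(x,y)$ over the representatives $x$ of $p$ and $y$ of $q$. A sequence $(u_n,\Gamma_n)$ of Fuchsian C-convex functions *converges to a pair* $(u,\Gamma)$ if $u$ is C-convex, $\Gamma$ is a Fuchsian group, $u_n\to u$ pointwise, and there are group isomorphisms $\tau_n:\Gamma\to\Gamma_n$ with $\tau_n(\sigma)\to\sigma$ for every $\sigma\in\Gamma$. Metric spaces $(S_n,d_n)$ *converge uniformly* to a metric space $(S,d)$ if there are homeomorphisms $f_n:S\to S_n$ with $\sup_{x,y\in S}|d_n(f_n(x),f_n(y))-d(x,y)|\to0$. **Proposition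 3.9.** Let $(u_n,\Gamma_n)_{n\in\mathbb{N}}$ be Fuchsian C-convex functions converging to a pair $(u,\Gamma)$. Then, after passing to a subsequence, the spaces $(\mathbb{H}^2/\Gamma_n,\bar d_{u_n})$ and $(\mathbb{H}^2/\Gamma,\bar d_u)$ are metric spaces, whose distances induce the quotient topologies, and $(\mathbb{H}^2/\Gamma_n,\bar d_{u_n})_n$ converges uniformly to $(\mathbb{H}^2/\Gamma,\bar d_u)$. -/

import Mathlib

namespace AdSFuchsian

open UpperHalfPlane Filter Topology

noncomputable section

/-! ### The hyperbolic plane and the AdS cylinder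

The hyperbolic plane is Mathlib's upper half-plane `ℍ` with its hyperbolic distance. -/

/-- The identification of the hyperbolic plane with the totally geodesic plane
`H₀ = {x₁ = 0, x₀ > 0, -x₀² + x₂² + x₃² = -1}` of anti-de Sitter space
`{-x₀² - x₁² + x₂² + x₃² = -1} ⊆ ℝ⁴`. -/
def hyperboloid (z : ℍ) : Fin 4 → ℝ :=
  ![(z.re ^ 2 + z.im ^ 2 + 1) / (2 * z.im), 0,
    (z.re ^ 2 + z.im ^ 2 - 1) / (2 * z.im), z.re / z.im]

/-- The bilinear form of signature `(2,2)` on `ℝ⁴`. -/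
def form (x y : Fin 4 → ℝ) : ℝ := -(x 0 * y 0) - x 1 * y 1 + x 2 * y 2 + x 3 * y 3

/-- The identification is isometric: on the hyperboloid the hyperbolic distance is
characterized by `cosh d(X, Y) = -⟨X, Y⟩`. -/
theorem cosh_dist_eq_neg_form (z w : ℍ) :
    Real.cosh (dist z w) = -form (hyperboloid z) (hyperboloid w) := by
  have hz := z.im_pos.ne'
  have hw := w.im_pos.ne'
  rw [UpperHalfPlane.cosh_dist, Complex.dist_eq, ← Complex.normSq_eq_norm_sq,
    Complex.normSq_apply]
  simp only [form, hyperboloid, Complex.sub_re, Complex.sub_im, UpperHalfPlane.coe_re,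
    UpperHalfPlane.coe_im, Matrix.cons_val]
  field_simp
  ring

/-- The unit vector orthogonal to `H₀`. -/
def normalVec : Fin 4 → ℝ := ![0, -1, 0, 0]

/-- `Ψ̃ (x, t) = exp_x (t V) = cos t • x + sin t • V`. -/
def cylMap (z : ℍ) (t : ℝ) : Fin 4 → ℝ := Real.cos t • hyperboloid z + Real.sin t • normalVec

/-- The affine chart `[x₀, x₁, x₂, x₃] ↦ (x₁/x₀, (x₂/x₀, x₃/x₀))`; the first coordinate is the
vertical one, the two last ones are the horizontal ones. -/
def affineChart (x : Fin 4 → ℝ) : ℝ × (ℝ × ℝ) := (x 1 / x 0, (x 2 / x 0, x 3 / x 0))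

/-- `Ψ`, the parametrization of the affine AdS cylinder. -/
def affineCyl (z : ℍ) (t : ℝ) : ℝ × (ℝ × ℝ) := affineChart (cylMap z t)

/-- The point `x̄` of the disc which corresponds to a point `x` of the hyperbolic plane. -/
def toDisc (z : ℍ) : ℝ × ℝ := (affineCyl z 0).2

/-- The open unit disc. -/
def disc : Set (ℝ × ℝ) := {p | p.1 ^ 2 + p.2 ^ 2 < 1}

/-- `x ↦ x̄` maps the hyperbolic plane onto the whole disc. -/
theorem range_toDisc : Set.range toDisc = disc := by
  have key : ∀ z : ℍ, toDisc z = ((z.re ^ 2 + z.im ^ 2 - 1) / (z.re ^ 2 + z.im ^ 2 + 1),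
      2 * z.re / (z.re ^ 2 + z.im ^ 2 + 1)) := by
    intro z
    have hz := z.im_pos.ne'
    simp only [toDisc, affineCyl, affineChart, cylMap, hyperboloid, normalVec, Real.cos_zero,
      Real.sin_zero, one_smul, zero_smul, add_zero, Matrix.cons_val]
    ext
    · simp only; field_simp
    · simp only; field_simp
  ext ⟨a, b⟩
  constructor
  · rintro ⟨z, hz⟩
    rw [key] at hz
    have hp := z.im_pos
    have hq : 0 < z.re ^ 2 + z.im ^ 2 + 1 := by positivity
    obtain ⟨rfl, rfl⟩ := Prod.mk.inj hz
    change _ ^ 2 + _ ^ 2 < (1 : ℝ)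
    rw [div_pow, div_pow, ← add_div, div_lt_one (by positivity)]
    nlinarith [sq_pos_of_pos hp]
  · intro h
    change a ^ 2 + b ^ 2 < 1 at h
    have ha : 0 < 1 - a := by nlinarith [sq_nonneg b, sq_nonneg (a - 1)]
    have hs : 0 < √(1 - a ^ 2 - b ^ 2) := Real.sqrt_pos.2 (by linarith)
    have hs2 : √(1 - a ^ 2 - b ^ 2) ^ 2 = 1 - a ^ 2 - b ^ 2 := Real.sq_sqrt (by linarith)
    refine ⟨UpperHalfPlane.mk ⟨b / (1 - a), √(1 - a ^ 2 - b ^ 2) / (1 - a)⟩ (by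
      change 0 < _ / _; positivity), ?_⟩
    rw [key]
    have e : (b / (1 - a)) ^ 2 + (√(1 - a ^ 2 - b ^ 2) / (1 - a)) ^ 2 = (1 + a) / (1 - a) := by
      rw [div_pow, div_pow, hs2]
      field_simp
      ring
    change ((((b / (1 - a)) ^ 2 + (√(1 - a ^ 2 - b ^ 2) / (1 - a)) ^ 2 - 1) /
      ((b / (1 - a)) ^ 2 + (√(1 - a ^ 2 - b ^ 2) / (1 - a)) ^ 2 + 1) : ℝ),
      (2 * (b / (1 - a)) / ((b / (1 - a)) ^ 2 + (√(1 - a ^ 2 - b ^ 2) / (1 - a)) ^ 2 + 1) : ℝ)) =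
      (a, b)
    rw [e]
    have h1 : (1 + a) / (1 - a) + 1 = 2 / (1 - a) := by field_simp; ring
    have h2 : (1 + a) / (1 - a) - 1 = 2 * a / (1 - a) := by field_simp; ring
    rw [h1, h2]
    ext
    · simp only; field_simp
    · simp only; field_simp

/-! ### C-convex functions and their induced distance -/

/-- `u` is C-convex: `0 ≤ u ≤ R < π/2`, and the image of the graph of `u` in the affine AdS
cylinder is the graph of a convex function `ū` over the disc. -/
def IsCConvex (u : ℍ → ℝ) : Prop :=
  (∀ z, 0 ≤ u z) ∧ (∃ R < Real.pi / 2, ∀ z, u z ≤ R) ∧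
    ∃ ubar : ℝ × ℝ → ℝ, ConvexOn ℝ disc ubar ∧
      ∀ z, affineCyl z (u z) = (ubar (toDisc z), toDisc z)

/-- The hyperbolic norm `‖c'(t)‖` of the velocity of a curve. -/
def hypSpeed (c : ℝ → ℍ) (t : ℝ) : ℝ := ‖deriv (fun s => (c s : ℂ)) t‖ / (c t).im

/-- The length of the curve `(c, u ∘ c)`, `t ∈ [0, 1]`, for the anti-de Sitter metric
`cos² t • g_ℍ - dt²` of the AdS cylinder. -/
def length (u : ℍ → ℝ) (c : ℝ → ℍ) : ℝ :=
  ∫ t in (0 : ℝ)..1,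
    √(Real.cos (u (c t)) ^ 2 * hypSpeed c t ^ 2 - deriv (fun s => u (c s)) t ^ 2)

/-- `c`, restricted to `[0, 1]`, is a Lipschitz curve from `x` to `y`. -/
def IsLipschitzCurve (c : ℝ → ℍ) (x y : ℍ) : Prop :=
  (∃ K, LipschitzOnWith K c (Set.Icc 0 1)) ∧ c 0 = x ∧ c 1 = y

/-- The (pseudo-)distance `d_u`. -/
def inducedDist (u : ℍ → ℝ) (x y : ℍ) : ℝ :=
  sInf {l | ∃ c, IsLipschitzCurve c x y ∧ l = length u c}

/-! ### Fuchsian groups -/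

/-- The isometries of the hyperbolic plane act on it by evaluation. -/
instance : MulAction (ℍ ≃ᵢ ℍ) ℍ where
  smul σ z := σ z
  one_smul _ := rfl
  mul_smul _ _ _ := rfl

/-- The topology of the isometry group: pointwise convergence (which, for isometries, is the same
as uniform convergence on compact sets). -/
instance : TopologicalSpace (ℍ ≃ᵢ ℍ) :=
  TopologicalSpace.induced (fun σ z => σ z) Pi.topologicalSpace

/-- The quotient `ℍ / Γ`; it carries the quotient topology. -/
abbrev Quo (Γ : Subgroup (ℍ ≃ᵢ ℍ)) : Type := Quotient (MulAction.orbitRel Γ ℍ)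

/-- Fuchsian groups: discrete groups of orientation preserving isometries which act freely and
cocompactly. The orientation preserving isometries are the real Möbius transformations. -/
structure IsFuchsian (Γ : Subgroup (ℍ ≃ᵢ ℍ)) : Prop where
  orientation : ∀ σ ∈ Γ, ∃ g : Matrix.SpecialLinearGroup (Fin 2) ℝ, ∀ z : ℍ, σ z = g • z
  discrete : DiscreteTopology Γ
  free : ∀ σ ∈ Γ, ∀ z : ℍ, σ z = z → σ = 1
  cocompact : CompactSpace (Quo Γ)

/-- Fuchsian C-convex functions `(u, Γ)`. -/
structure IsFuchsianCConvex (u : ℍ → ℝ) (Γ : Subgroup (ℍ ≃ᵢ ℍ)) : Prop where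
  cconvex : IsCConvex u
  fuchsian : IsFuchsian Γ
  invariant : ∀ σ ∈ Γ, ∀ z, u (σ z) = u z

/-- Convergence of groups: there are isomorphisms `τₙ : Γ → Γₙ` with `τₙ σ → σ` for all `σ`. -/
def GroupsConverge (Γn : ℕ → Subgroup (ℍ ≃ᵢ ℍ)) (Γ : Subgroup (ℍ ≃ᵢ ℍ)) : Prop :=
  ∃ τ : ∀ n, Γ ≃* Γn n, ∀ σ : Γ,
    Tendsto (fun n => (τ n σ : ℍ ≃ᵢ ℍ)) atTop (𝓝 (σ : ℍ ≃ᵢ ℍ))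

/-- Convergence of `(uₙ, Γₙ)` to a pair `(u, Γ)`, where `u` is C-convex and `Γ` is Fuchsian. -/
structure PairsConverge (un : ℕ → ℍ → ℝ) (Γn : ℕ → Subgroup (ℍ ≃ᵢ ℍ))
    (u : ℍ → ℝ) (Γ : Subgroup (ℍ ≃ᵢ ℍ)) : Prop where
  cconvex : IsCConvex u
  fuchsian : IsFuchsian Γ
  functions : ∀ z, Tendsto (fun n => un n z) atTop (𝓝 (u z))
  groups : GroupsConverge Γn Γ

/-- The distance `d̄_u` on `ℍ / Γ`: the infimum of `d_u` over representatives. -/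
def quoDist (u : ℍ → ℝ) (Γ : Subgroup (ℍ ≃ᵢ ℍ)) (p q : Quo Γ) : ℝ :=
  sInf {r | ∃ x y : ℍ, Quotient.mk (MulAction.orbitRel Γ ℍ) x = p ∧
    Quotient.mk (MulAction.orbitRel Γ ℍ) y = q ∧ r = inducedDist u x y}

/-! ### Uniform convergence of metric spaces -/

/-- `d` is a distance on `X`, and it induces the topology of `X`. -/
structure IsMetricOn {X : Type*} [TopologicalSpace X] (d : X → X → ℝ) : Prop where
  eq_zero_iff : ∀ x y, d x y = 0 ↔ x = y
  symm : ∀ x y, d x y = d y x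
  triangle : ∀ x y z, d x z ≤ d x y + d y z
  isOpen_iff : ∀ s : Set X, IsOpen s ↔ ∀ x ∈ s, ∃ ε > 0, ∀ y, d x y < ε → y ∈ s

/-- The metric spaces `(Sₙ, dₙ)` converge uniformly to the metric space `(S, d)`: there are
homeomorphisms `fₙ : S → Sₙ` such that `sup |dₙ (fₙ x, fₙ y) - d (x, y)| → 0`. -/
def MetricsConvergeUniformly {X : ℕ → Type*} [∀ n, TopologicalSpace (X n)]
    (dn : ∀ n, X n → X n → ℝ) {S : Type*} [TopologicalSpace S] (d : S → S → ℝ) : Prop :=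
  (∀ n, IsMetricOn (dn n)) ∧ IsMetricOn d ∧
    ∃ f : ∀ n, S ≃ₜ X n, ∀ ε > 0, ∃ N, ∀ n ≥ N, ∀ x y : S,
      |dn n (f n x) (f n y) - d x y| ≤ ε

end

end AdSFuchsian

/-!
# Uniform convergence of the surfaces defined by Fuchsian C-convex functions

The proof has two independent halves.

**Convergence of the distances on the hyperbolic plane.** In the affine chart, an affine function
which supports the convex function `ū` becomes, in terms of `tan ∘ u`, the restriction to the
hyperboloid of a linear form on Minkowski space which is nonnegative on the future cone. So
`tan ∘ u` has a support of this kind at every point (`IsCConvex.admissible`). Such forms satisfy a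
Harnack inequality, their gradient is at most their value, and they form a compact set once they
are bounded at one point. Hence the functions `tan ∘ u` are Lipschitz, the graphs are uniformly
spacelike (`hypSpeed_le_mul_speed`), supports of `uₙ` accumulate at supports of `u`, and
the derivatives of `uₙ` along a fixed curve converge almost everywhere. This gives
`limsup d_{uₙ} ≤ d_u`. For `d_u ≤ liminf d_{uₙ}`, almost minimizing curves, parametrized
proportionally to length, have a Lipschitz limit curve, and its speed has to be bounded. Speeds are
not semicontinuous for obvious reasons, since velocities converge only weakly; but at almost every
time the velocity of the limit curve lies in all the planes tangent to the limit graph, so the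
product with this velocity calibrates the nearby graphs: by the Cauchy–Schwarz inequality in a
spacelike plane and by compactness it is almost bounded by the norm on all the nearby tangent
planes (`eventually_calibration`), and the integrated inequality passes to the limit
(`speed_le_of_limit`).

**Equivariant homeomorphisms close to the identity.** Points of the plane are rays of positive
definite quadratic forms, and Möbius transformations act linearly on these forms. The weighted mean
of the points `τₙ(σ) σ⁻¹ z`, `σ ∈ Γ`, with weights given by bumps around the points `σ i`, is an
equivariant map `Fₙ` which tends to the identity in the `C¹` sense, uniformly on compact sets. By
cocompactness `Fₙ` is uniformly close to an isometry on all balls of a given large radius, and it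
is uniformly injective and open at a small scale. Since the plane is Gromov hyperbolic, local
quasi-geodesics are global quasi-geodesics; so `Fₙ` is a quasi-isometric embedding
(`half_dist_le_of_almost_isometry`), hence injective and proper, hence a homeomorphism
(`eventually_exists_homeomorph`). The maps `Fₙ` induce the homeomorphisms of the quotients.

In the end both halves are combined on a compact set of pairs of representatives: as `d_{uₙ}`
dominates a fixed multiple of the hyperbolic distance and `Fₙ` is uniformly proper,
representatives which almost realize a quotient distance stay in a compact set
(`eventually_abs_quoDist_sub_le`). A uniform bound of `tan ∘ uₙ` comes from the Harnack inequality
and cocompactness; like the homeomorphisms, it is available for all but finitely many indices, and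
passing to a subsequence means to drop the others.
-/

namespace AdSFuchsian

open UpperHalfPlane Filter Topology

noncomputable section

/-! ### Lipschitz curves in the hyperbolic plane -/

section Curves

open MeasureTheory Set

variable {c : ℝ → ℍ} {K : NNReal}

theorem lipschitzOnWith_coe_curve (hc : LipschitzWith K c) (a b : ℝ) :
    ∃ K' : NNReal, LipschitzOnWith K' (fun t => (c t : ℂ)) (Icc a b) := by
  obtain ⟨M, hM⟩ : ∃ M, ∀ t ∈ Icc a b, (c t).im ≤ M := by
    have : ContinuousOn (fun t => (c t).im) (Icc a b) :=
      (UpperHalfPlane.continuous_im.comp hc.continuous).continuousOn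
    obtain ⟨M, hM⟩ := isCompact_Icc.bddAbove_image this
    exact ⟨M, fun t ht => hM ⟨t, ht, rfl⟩⟩
  set D : ℝ := K * |b - a| with hD
  refine ⟨(|M| * (Real.exp D * K)).toNNReal, LipschitzOnWith.of_dist_le_mul ?_⟩
  intro s hs t ht
  rw [Real.coe_toNNReal _ (by positivity)]
  have h1 := dist_coe_le (c s) (c t)
  have h2 : dist (c s) (c t) ≤ K * dist s t := hc.dist_le_mul s t
  have h3 : dist s t ≤ |b - a| := by
    rw [Real.dist_eq]
    exact abs_sub_le_of_le_of_le hs.1 hs.2 ht.1 ht.2 |>.trans (le_abs_self _)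
  have h4 : dist (c s) (c t) ≤ D := h2.trans (mul_le_mul_of_nonneg_left h3 K.2)
  have h5 : Real.exp (dist (c s) (c t)) - 1 ≤ Real.exp D * dist (c s) (c t) := by
    set d := dist (c s) (c t)
    have hd : 0 ≤ d := dist_nonneg
    have e1 : 1 - d ≤ Real.exp (-d) := by linarith [Real.add_one_le_exp (-d)]
    have e2 : Real.exp d * Real.exp (-d) = 1 := by rw [← Real.exp_add]; simp
    have e3 : Real.exp d ≤ Real.exp D := Real.exp_le_exp.2 h4
    have e4 := Real.exp_pos d
    nlinarith [mul_le_mul_of_nonneg_left e1 e4.le, mul_le_mul_of_nonneg_right e3 hd]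
  calc dist (c s : ℂ) (c t) ≤ (c t).im * (Real.exp (dist (c s) (c t)) - 1) := h1
    _ ≤ |M| * (Real.exp D * dist (c s) (c t)) := by
        apply mul_le_mul ((hM t ht).trans (le_abs_self M)) h5 _ (abs_nonneg _)
        linarith [Real.one_le_exp (dist_nonneg (x := c s) (y := c t))]
    _ ≤ |M| * (Real.exp D * (K * dist s t)) := by gcongr
    _ = _ := by ring

theorem ae_differentiableAt_coe_curve (hc : LipschitzWith K c) :
    ∀ᵐ t : ℝ, DifferentiableAt ℝ (fun s => (c s : ℂ)) t := by
  have : ∀ m : ℕ, ∀ᵐ t : ℝ, t ∈ Icc (-(m : ℝ)) m →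
      DifferentiableWithinAt ℝ (fun s => (c s : ℂ)) (Icc (-(m : ℝ)) m) t := by
    intro m
    obtain ⟨K', hK'⟩ := lipschitzOnWith_coe_curve hc (-(m : ℝ)) m
    exact hK'.ae_differentiableWithinAt_of_mem
  filter_upwards [ae_all_iff.2 this] with t ht
  obtain ⟨m, hm⟩ := exists_nat_gt |t|
  have hm' := abs_lt.1 hm
  exact (ht m ⟨hm'.1.le, hm'.2.le⟩).differentiableAt (Icc_mem_nhds hm'.1 hm'.2)

/-- The hyperbolic speed is the metric derivative of the curve. -/
theorem tendsto_dist_div_hypSpeed {t : ℝ} (h : DifferentiableAt ℝ (fun s => (c s : ℂ)) t) :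
    Tendsto (fun s => dist (c t) (c s) / |s - t|) (𝓝[≠] t) (𝓝 (hypSpeed c t)) := by
  have hcont : ContinuousAt c t :=
    (isEmbedding_coe.continuousAt_iff).2 h.continuousAt
  have him : Tendsto (fun s => 2 * √((c t).im * (c s).im)) (𝓝[≠] t) (𝓝 (2 * (c t).im)) := by
    have : ContinuousAt (fun s => 2 * √((c t).im * (c s).im)) t := by
      have := UpperHalfPlane.continuous_im.continuousAt.comp hcont
      exact continuousAt_const.mul
        (Real.continuous_sqrt.continuousAt.comp (continuousAt_const.mul this))
    have h2 := this.tendsto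
    rw [← pow_two, Real.sqrt_sq (c t).im_pos.le] at h2
    exact h2.mono_left nhdsWithin_le_nhds
  have hq : Tendsto (fun s => dist (c t : ℂ) (c s) / |s - t|) (𝓝[≠] t)
      (𝓝 ‖deriv (fun s => (c s : ℂ)) t‖) := by
    have := (hasDerivAt_iff_tendsto_slope.1 h.hasDerivAt).norm
    refine this.congr fun s => ?_
    rw [slope_def_module, norm_smul, norm_inv, Real.norm_eq_abs, dist_comm, dist_eq_norm,
      div_eq_inv_mul]
  have hx0 : Tendsto (fun s => dist (c t : ℂ) (c s) / (2 * √((c t).im * (c s).im))) (𝓝[≠] t)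
      (𝓝 0) := by
    have h1 : Tendsto (fun s => dist (c t : ℂ) (c s)) (𝓝[≠] t) (𝓝 0) := by
      have : ContinuousAt (fun s => dist (c t : ℂ) (c s)) t := continuousAt_const.dist h.continuousAt
      have h2 := this.tendsto
      rw [dist_self] at h2
      exact h2.mono_left nhdsWithin_le_nhds
    have := h1.div him (by have := (c t).im_pos; positivity)
    rwa [zero_div] at this
  have hg : Tendsto (fun s => dslope Real.arsinh 0
      (dist (c t : ℂ) (c s) / (2 * √((c t).im * (c s).im)))) (𝓝[≠] t) (𝓝 1) := by
    have h1 : ContinuousAt (dslope Real.arsinh 0) 0 :=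
      continuousAt_dslope_same.2 Real.differentiable_arsinh.differentiableAt
    have h2 : dslope Real.arsinh 0 0 = 1 := by
      rw [dslope_same, (Real.hasDerivAt_arsinh 0).deriv]; simp
    have := h1.tendsto.comp hx0
    rwa [h2] at this
  have := ((hq.div him (by have := (c t).im_pos; positivity)).const_mul 2).mul hg
  have e : 2 * (‖deriv (fun s => (c s : ℂ)) t‖ / (2 * (c t).im)) * 1 = hypSpeed c t := by
    rw [hypSpeed]
    have := (c t).im_pos.ne'
    field_simp
  rw [e] at this
  refine this.congr fun s => ?_
  rw [dist_eq]
  have h3 := sub_smul_dslope Real.arsinh 0 (dist (c t : ℂ) (c s) / (2 * √((c t).im * (c s).im)))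
  simp only [sub_zero, Real.arsinh_zero, smul_eq_mul] at h3
  rw [← h3]
  simp only [Pi.div_apply]
  ring

theorem hypSpeed_nonneg (c : ℝ → ℍ) (t : ℝ) : 0 ≤ hypSpeed c t :=
  div_nonneg (norm_nonneg _) (c t).im_pos.le

theorem hypSpeed_le (hc : LipschitzWith K c) {t : ℝ}
    (h : DifferentiableAt ℝ (fun s => (c s : ℂ)) t) : hypSpeed c t ≤ K := by
  refine le_of_tendsto (tendsto_dist_div_hypSpeed h) ?_
  filter_upwards [self_mem_nhdsWithin] with s hs
  rw [div_le_iff₀ (abs_pos.2 (sub_ne_zero.2 hs)), ← Real.dist_eq, dist_comm s t]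
  exact hc.dist_le_mul t s

/-- A function of time whose increments are controlled by those of the curve `c` has a derivative
controlled by the hyperbolic speed. -/
theorem abs_deriv_le_hypSpeed {f : ℝ → ℝ} {L t : ℝ}
    (hf : ∀ s, |f s - f t| ≤ L * dist (c t) (c s)) (hd : DifferentiableAt ℝ f t)
    (h : DifferentiableAt ℝ (fun s => (c s : ℂ)) t) : |deriv f t| ≤ L * hypSpeed c t := by
  have h1 := (hasDerivAt_iff_tendsto_slope.1 hd.hasDerivAt).norm
  refine le_of_tendsto_of_tendsto h1 ((tendsto_dist_div_hypSpeed h).const_mul L) ?_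
  filter_upwards [self_mem_nhdsWithin] with s hs
  have hp := abs_pos.2 (sub_ne_zero.2 hs)
  rw [slope_def_field, norm_div, Real.norm_eq_abs, Real.norm_eq_abs, ← mul_div_assoc]
  gcongr
  exact hf s

theorem measurable_hypSpeed (hc : LipschitzWith K c) : Measurable (hypSpeed c) :=
  (measurable_deriv _).norm.div (UpperHalfPlane.continuous_im.comp hc.continuous).measurable

theorem ae_hypSpeed_le (hc : LipschitzWith K c) : ∀ᵐ t : ℝ, hypSpeed c t ≤ K := by
  filter_upwards [ae_differentiableAt_coe_curve hc] with t ht using hypSpeed_le hc ht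

theorem intervalIntegrable_of_ae_bound {f : ℝ → ℝ} (hf : Measurable f) {C : ℝ}
    (h : ∀ᵐ t : ℝ, |f t| ≤ C) (a b : ℝ) : IntervalIntegrable f volume a b := by
  refine (intervalIntegrable_const (c := C)).mono_fun hf.aestronglyMeasurable ?_
  refine ae_restrict_of_ae (h.mono fun t ht => ?_)
  exact ht.trans (le_abs_self C)

theorem intervalIntegrable_hypSpeed (hc : LipschitzWith K c) (a b : ℝ) :
    IntervalIntegrable (hypSpeed c) volume a b := by
  refine intervalIntegrable_of_ae_bound (measurable_hypSpeed hc) (C := K) ?_ a b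
  filter_upwards [ae_hypSpeed_le hc] with t ht
  rwa [abs_of_nonneg (hypSpeed_nonneg c t)]

theorem integral_deriv_of_lipschitz {f : ℝ → ℝ} {L : NNReal} (hf : LipschitzWith L f) (a b : ℝ) :
    ∫ t in a..b, deriv f t = f b - f a :=
  (hf.lipschitzOnWith (s := uIcc a b)).absolutelyContinuousOnInterval.integral_deriv_eq_sub

/-- The hyperbolic distance is at most the hyperbolic length. -/
theorem dist_le_integral_hypSpeed (hc : LipschitzWith K c) {a b : ℝ} (hab : a ≤ b) :
    dist (c a) (c b) ≤ ∫ t in a..b, hypSpeed c t := by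
  set f : ℝ → ℝ := fun t => dist (c a) (c t) with hf
  have hfl : LipschitzWith K f := by
    refine LipschitzWith.of_dist_le_mul fun s t => ?_
    rw [Real.dist_eq]
    refine le_trans ?_ (hc.dist_le_mul s t)
    simp only [hf, dist_comm (c a)]
    exact abs_dist_sub_le _ _ _
  have h1 := integral_deriv_of_lipschitz hfl a b
  simp only [hf, dist_self, sub_zero] at h1
  rw [← h1]
  have hae : ∀ᵐ t : ℝ, deriv f t ≤ hypSpeed c t := by
    filter_upwards [ae_differentiableAt_coe_curve hc, hfl.ae_differentiableAt_real] with t h1 h2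
    have := abs_deriv_le_hypSpeed (c := c) (f := f) (L := 1) (fun s => by
      rw [one_mul]
      rw [hf, dist_comm (c t)]
      simp only [dist_comm (c a)]
      exact abs_dist_sub_le _ _ _) h2 h1
    rw [one_mul] at this
    exact (le_abs_self _).trans this
  refine intervalIntegral.integral_mono_ae hab ?_ (intervalIntegrable_hypSpeed hc a b) hae
  refine intervalIntegrable_of_ae_bound (measurable_deriv _) (C := K) ?_ a b
  exact ae_of_all _ fun t => norm_deriv_le_of_lipschitz hfl

/-- The chord of a curve, tested against a fixed vector. -/
theorem integral_inner_deriv (hc : LipschitzWith K c) (a b : ℝ) (w : ℂ) :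
    IntervalIntegrable (fun t => inner ℝ (deriv (fun s => (c s : ℂ)) t) w) volume a b ∧
    ∫ t in a..b, inner ℝ (deriv (fun s => (c s : ℂ)) t) w
      = inner ℝ ((c b : ℂ) - c a) w := by
  obtain ⟨K', hK'⟩ := lipschitzOnWith_coe_curve hc (min a b) (max a b)
  set g : ℝ → ℝ := fun t => inner ℝ (c t : ℂ) w with hg
  have hgl : LipschitzOnWith (K' * ‖w‖₊) g (uIcc a b) := by
    refine LipschitzOnWith.of_dist_le_mul fun s hs t ht => ?_
    rw [Real.dist_eq, hg]
    simp only
    rw [← inner_sub_left]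
    refine (abs_real_inner_le_norm _ _).trans ?_
    have := hK'.dist_le_mul s hs t ht
    rw [dist_eq_norm] at this
    calc _ ≤ (K' * dist s t) * ‖w‖ := by gcongr
      _ = _ := by push_cast; ring
  have hac := hgl.absolutelyContinuousOnInterval
  have hae : ∀ᵐ t : ℝ, deriv g t = inner ℝ (deriv (fun s => (c s : ℂ)) t) w := by
    filter_upwards [ae_differentiableAt_coe_curve hc] with t ht
    have := ht.hasDerivAt.inner ℝ (hasDerivAt_const t w)
    simpa [hg] using this.deriv
  constructor
  · exact hac.intervalIntegrable_deriv.congr_ae (ae_restrict_of_ae hae)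
  · rw [← intervalIntegral.integral_congr_ae (hae.mono fun t ht _ => ht),
      hac.integral_deriv_eq_sub, hg]
    simp only
    rw [← inner_sub_left]

end Curves

/-! ### Support functions -/

/-- The restriction to the hyperbolic plane of a linear form on Minkowski space `ℝ³`. In the
half-plane coordinates, `1 / y`, `x / y` and `(x² + y²) / y` are linear coordinates of the
hyperboloid; `k` lists the coefficients. -/
def linForm (k : ℝ × ℝ × ℝ) (z : ℍ) : ℝ :=
  (k.1 + k.2.1 * z.re + k.2.2 * (z.re ^ 2 + z.im ^ 2)) / z.im

/-- The differential of `linForm k` at `z`, evaluated at the tangent vector `v`. -/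
def linFormDeriv (k : ℝ × ℝ × ℝ) (z : ℍ) (v : ℂ) : ℝ :=
  (k.2.1 * v.re + k.2.2 * (2 * z.re * v.re + 2 * z.im * v.im)) / z.im -
    (k.1 + k.2.1 * z.re + k.2.2 * (z.re ^ 2 + z.im ^ 2)) * v.im / z.im ^ 2

/-- The linear form is nonnegative on the future cone, in terms of its coefficients. -/
structure IsCausal (k : ℝ × ℝ × ℝ) : Prop where
  fst : 0 ≤ k.1
  trd : 0 ≤ k.2.2
  disc : k.2.1 ^ 2 ≤ 4 * k.1 * k.2.2

/-- `linForm k` is a causal linear form which touches `U` at `z` from above. -/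
structure IsSupport (U : ℍ → ℝ) (z : ℍ) (k : ℝ × ℝ × ℝ) : Prop where
  causal : IsCausal k
  eq : U z = linForm k z
  le : ∀ w, U w ≤ linForm k w

/-- Functions `u` with values in `[0, arctan T]` such that `tan ∘ u` is touched from above, at
every point, by a causal linear form. This is what the proof uses of C-convexity. -/
structure Admissible (T : ℝ) (u : ℍ → ℝ) : Prop where
  nonneg : ∀ z, 0 ≤ u z
  lt_pi_div_two : ∀ z, u z < Real.pi / 2
  tan_le : ∀ z, Real.tan (u z) ≤ T
  support : ∀ z, ∃ k, IsSupport (fun w => Real.tan (u w)) z k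

theorem inv_im_le (z w : ℍ) : 1 / w.im ≤ Real.exp (dist z w) * (1 / z.im) := by
  have h := im_le_im_mul_exp_dist z w
  have hz := z.im_pos
  have hw := w.im_pos
  rw [mul_one_div, div_le_div_iff₀ hw hz]
  linarith

theorem normSq_div_im_le (b : ℝ) (z w : ℍ) :
    ((w.re + b) ^ 2 + w.im ^ 2) / w.im ≤
      Real.exp (dist z w) * (((z.re + b) ^ 2 + z.im ^ 2) / z.im) := by
  have key : ∀ z : ℍ, 1 / (ModularGroup.S • (b +ᵥ z)).im =
      ((z.re + b) ^ 2 + z.im ^ 2) / z.im := by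
    intro z
    have hz := z.im_pos.ne'
    rw [modular_S_smul]
    simp only [mk_im, inv_neg, Complex.neg_im, Complex.inv_im, coe_im, coe_vadd, Complex.add_im,
      Complex.ofReal_im, zero_add, Complex.normSq_apply, Complex.add_re, Complex.ofReal_re, coe_re]
    have : (b + z.re) * (b + z.re) + z.im * z.im ≠ 0 := by
      nlinarith [mul_self_nonneg (b + z.re), mul_pos z.im_pos z.im_pos]
    field_simp
    ring
  have h := inv_im_le (ModularGroup.S • (b +ᵥ z)) (ModularGroup.S • (b +ᵥ w))
  have e1 : dist (ModularGroup.S • (b +ᵥ z)) (ModularGroup.S • (b +ᵥ w)) =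
      dist (b +ᵥ z) (b +ᵥ w) := by
    have := (isometry_smul ℍ ((ModularGroup.S : Matrix.SpecialLinearGroup (Fin 2) ℤ).map
      (Int.castRingHom ℝ))).dist_eq (b +ᵥ z) (b +ᵥ w)
    exact this
  rw [key, key, e1, (isometry_real_vadd b).dist_eq] at h
  exact h

/-- Harnack inequality for causal linear forms. -/
theorem linForm_le_exp_mul {k : ℝ × ℝ × ℝ} (hk : IsCausal k) (z w : ℍ) :
    linForm k w ≤ Real.exp (dist z w) * linForm k z := by
  obtain ⟨A, B, C⟩ := k
  obtain ⟨hA, hC, hd⟩ := hk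
  simp only at hA hC hd
  rcases hC.eq_or_lt with rfl | hC
  · have : B = 0 := by nlinarith
    subst this
    have := mul_le_mul_of_nonneg_left (inv_im_le z w) hA
    simp only [linForm, zero_mul, add_zero]
    calc A / w.im = A * (1 / w.im) := by ring
      _ ≤ _ := this
      _ = _ := by ring
  · have e : ∀ z : ℍ, linForm (A, B, C) z =
        C * (((z.re + B / (2 * C)) ^ 2 + z.im ^ 2) / z.im) + (A - B ^ 2 / (4 * C)) * (1 / z.im) := by
      intro z
      have hz := z.im_pos.ne'
      simp only [linForm]
      field_simp
      ring
    have h0 : 0 ≤ A - B ^ 2 / (4 * C) := by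
      rw [sub_nonneg, div_le_iff₀ (by positivity)]; linarith
    rw [e, e]
    have h1 := mul_le_mul_of_nonneg_left (normSq_div_im_le (B / (2 * C)) z w) hC.le
    have h2 := mul_le_mul_of_nonneg_left (inv_im_le z w) h0
    calc _ ≤ _ := add_le_add h1 h2
      _ = _ := by ring

/-- The gradient of a causal linear form is at most the form itself. -/
theorem linFormDeriv_sq_le {k : ℝ × ℝ × ℝ} (hk : IsCausal k) (z : ℍ) (v : ℂ) :
    linFormDeriv k z v ^ 2 ≤ linForm k z ^ 2 * (‖v‖ ^ 2 / z.im ^ 2) := by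
  obtain ⟨A, B, C⟩ := k
  obtain ⟨hA, hC, hd⟩ := hk
  simp only at hA hC hd
  have hy := z.im_pos
  rw [← Complex.normSq_eq_norm_sq, Complex.normSq_apply]
  simp only [linForm, linFormDeriv]
  set x := z.re
  set y := z.im
  set p := v.re
  set r := v.im
  set g1 := B + 2 * C * x
  set g2 := C * y - (A + B * x + C * x ^ 2) / y
  set l := (A + B * x + C * (x ^ 2 + y ^ 2)) / y
  have e1 : (B * p + C * (2 * x * p + 2 * y * r)) / y -
      (A + B * x + C * (x ^ 2 + y ^ 2)) * r / y ^ 2 = (g1 * p + g2 * r) / y := by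
    simp only [g1, g2]; field_simp; ring
  have e2 : g1 ^ 2 + g2 ^ 2 = B ^ 2 - 4 * A * C + l ^ 2 := by
    simp only [g1, g2, l]; field_simp; ring
  rw [e1, div_pow, ← mul_div_assoc]
  gcongr
  nlinarith [sq_nonneg (g1 * r - g2 * p), mul_nonneg (sub_nonneg.2 hd)
    (add_nonneg (sq_nonneg p) (sq_nonneg r))]

theorem hasDerivAt_linForm {c : ℝ → ℍ} {t : ℝ} (k : ℝ × ℝ × ℝ)
    (h : DifferentiableAt ℝ (fun s => (c s : ℂ)) t) :
    HasDerivAt (fun s => linForm k (c s))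
      (linFormDeriv k (c t) (deriv (fun s => (c s : ℂ)) t)) t := by
  set v := deriv (fun s => (c s : ℂ)) t
  have hre : HasDerivAt (fun s => (c s).re) v.re t :=
    Complex.reCLM.hasFDerivAt.comp_hasDerivAt t h.hasDerivAt
  have him : HasDerivAt (fun s => (c s).im) v.im t :=
    Complex.imCLM.hasFDerivAt.comp_hasDerivAt t h.hasDerivAt
  have hy := (c t).im_pos.ne'
  have h1 := (((hre.const_mul k.2.1).const_add k.1).add
    (((hre.pow 2).add (him.pow 2)).const_mul k.2.2)).div him hy
  refine (h1.congr_deriv ?_)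
  simp only [linFormDeriv, Pi.add_apply, Pi.pow_apply]
  field_simp
  ring

/-- Along a curve, the derivative of `U` can be read off every support function. -/
theorem IsSupport.deriv_eq {U : ℍ → ℝ} {c : ℝ → ℍ} {t : ℝ} {k : ℝ × ℝ × ℝ}
    (hk : IsSupport U (c t) k) (h : DifferentiableAt ℝ (fun s => (c s : ℂ)) t)
    (hU : DifferentiableAt ℝ (fun s => U (c s)) t) :
    deriv (fun s => U (c s)) t = linFormDeriv k (c t) (deriv (fun s => (c s : ℂ)) t) := by
  have h1 := (hasDerivAt_linForm k h).sub hU.hasDerivAt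
  have hmin : IsLocalMin ((fun s => linForm k (c s)) - fun s => U (c s)) t := by
    refine Eventually.of_forall fun s => ?_
    have h1 := hk.eq
    have h2 := hk.le (c s)
    simp only [Pi.sub_apply]
    linarith
  have := hmin.hasDerivAt_eq_zero h1
  linarith

/-! ### C-convex functions have support functions -/

theorem tan_eq_of_affineCyl {u : ℍ → ℝ} {ubar : ℝ × ℝ → ℝ} {z : ℍ} (hc : Real.cos (u z) ≠ 0)
    (h : affineCyl z (u z) = (ubar (toDisc z), toDisc z)) :
    Real.tan (u z) = -ubar (toDisc z) * ((z.re ^ 2 + z.im ^ 2 + 1) / (2 * z.im)) := by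
  have h1 := congrArg Prod.fst h
  simp only [affineCyl, affineChart, cylMap, hyperboloid, normalVec] at h1
  simp at h1
  have hp : 0 < z.re ^ 2 + z.im ^ 2 + 1 := by positivity
  have hz := z.im_pos
  rw [← h1, Real.tan_eq_sin_div_cos]
  field_simp

theorem toDisc_eq (z : ℍ) :
    toDisc z = ((z.re ^ 2 + z.im ^ 2 - 1) / (z.re ^ 2 + z.im ^ 2 + 1),
      2 * z.re / (z.re ^ 2 + z.im ^ 2 + 1)) := by
  have hz := z.im_pos.ne'
  have hp : 0 < z.re ^ 2 + z.im ^ 2 + 1 := by positivity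
  simp only [toDisc, affineCyl, affineChart, cylMap, hyperboloid, normalVec, Real.cos_zero,
    Real.sin_zero, one_smul, zero_smul, add_zero, Matrix.cons_val]
  ext
  · simp only; field_simp
  · simp only; field_simp

theorem isOpen_disc : IsOpen disc :=
  isOpen_lt (by fun_prop) continuous_const

/-- A convex function on the disc has an affine support at every point. -/
theorem exists_affine_support {f : ℝ × ℝ → ℝ} (hf : ConvexOn ℝ disc f) {p : ℝ × ℝ}
    (hp : p ∈ disc) :
    ∃ a b d : ℝ, f p = a + b * p.1 + d * p.2 ∧ ∀ q ∈ disc, a + b * q.1 + d * q.2 ≤ f q := by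
  have hcont := hf.continuousOn isOpen_disc
  have hopen : IsOpen {q : (ℝ × ℝ) × ℝ | q.1 ∈ disc ∧ f q.1 < q.2} := by
    have h1 : IsOpen (disc ×ˢ (Set.univ : Set ℝ)) := isOpen_disc.prod isOpen_univ
    have h2 : ContinuousOn (fun q : (ℝ × ℝ) × ℝ => q.2 - f q.1) (disc ×ˢ (Set.univ : Set ℝ)) :=
      continuousOn_snd.sub (hcont.comp continuousOn_fst fun q hq => hq.1)
    have := h2.isOpen_inter_preimage h1 (isOpen_Ioi (a := 0))
    convert this using 1
    ext q
    simp [sub_pos]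
  obtain ⟨g, hg⟩ := geometric_hahn_banach_open_point hf.convex_strict_epigraph hopen
    (x := (p, f p)) (by simp)
  have hdec : ∀ (q : ℝ × ℝ) (t : ℝ), g (q, t) = q.1 * g ((1, 0), 0) + q.2 * g ((0, 1), 0)
      + t * g (0, 1) := by
    intro q t
    have : ((q, t) : (ℝ × ℝ) × ℝ) = q.1 • ((1, 0), 0) + q.2 • ((0, 1), 0) + t • (0, 1) := by
      ext <;> simp
    rw [this, map_add, map_add, map_smul, map_smul, map_smul]
    rfl
  set g1 := g ((1, 0), 0)
  set g2 := g ((0, 1), 0)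
  set g3 := g (0, 1)
  have hneg : g3 < 0 := by
    have := hg (p, f p + 1) ⟨hp, by simp⟩
    rw [hdec, hdec] at this
    linarith
  refine ⟨f p + g1 / g3 * p.1 + g2 / g3 * p.2, -(g1 / g3), -(g2 / g3), by ring, fun q hq => ?_⟩
  refine le_of_forall_pos_le_add fun ε hε => ?_
  have := hg (q, f q + ε) ⟨hq, by simpa using hε⟩
  rw [hdec, hdec] at this
  have h2 : f p + (g1 * p.1 + g2 * p.2 - g1 * q.1 - g2 * q.2) / g3 < f q + ε := by
    rw [← sub_pos]
    have e : f q + ε - (f p + (g1 * p.1 + g2 * p.2 - g1 * q.1 - g2 * q.2) / g3) =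
      ((f q + ε - f p) * g3 - (g1 * p.1 + g2 * p.2 - g1 * q.1 - g2 * q.2)) / g3 := by
      have := hneg.ne
      field_simp
      ring
    rw [e]
    exact div_pos_of_neg_of_neg (by linarith) hneg
  calc _ = f p + (g1 * p.1 + g2 * p.2 - g1 * q.1 - g2 * q.2) / g3 := by field_simp; ring
    _ ≤ _ := h2.le

theorem isCausal_of_linForm_nonneg {k : ℝ × ℝ × ℝ} (h : ∀ z, 0 ≤ linForm k z) : IsCausal k := by
  obtain ⟨A, B, C⟩ := k
  have h1 : ∀ x y : ℝ, 0 < y → 0 ≤ A + B * x + C * (x ^ 2 + y ^ 2) := by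
    intro x y hy
    have := h ⟨⟨x, y⟩, hy⟩
    have h2 := mul_nonneg this hy.le
    simp only [linForm] at h2
    change 0 ≤ (A + B * x + C * (x ^ 2 + y ^ 2)) / y * y at h2
    rwa [div_mul_cancel₀ _ hy.ne'] at h2
  have h2 : ∀ x : ℝ, 0 ≤ C * (x * x) + B * x + A := by
    intro x
    have ht : Tendsto (fun y : ℝ => A + B * x + C * (x ^ 2 + y ^ 2)) (𝓝[>] 0)
        (𝓝 (A + B * x + C * (x ^ 2 + 0 ^ 2))) := by
      apply Tendsto.mono_left _ nhdsWithin_le_nhds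
      exact (Continuous.tendsto (by fun_prop) 0)
    have := ge_of_tendsto ht (by
      filter_upwards [self_mem_nhdsWithin] with y hy using h1 x y hy)
    linarith
  have h3 := discrim_le_zero h2
  simp only [discrim] at h3
  have hA : 0 ≤ A := by simpa using h2 0
  refine ⟨hA, ?_, by simp only; linarith⟩
  simp only
  by_contra hC
  push Not at hC
  have hB : B = 0 := by nlinarith [sq_nonneg B]
  subst hB
  have := h1 0 (√(A / (-C)) + 1) (by positivity)
  have hs : √(A / (-C)) ^ 2 = A / (-C) := Real.sq_sqrt (div_nonneg hA (by linarith))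
  have hs0 := Real.sqrt_nonneg (A / (-C))
  have e : C * (A / (-C)) = -A := by
    rw [div_neg, mul_neg, mul_div_cancel₀ _ hC.ne]
  nlinarith

/-- The affine functions which support `ū` from below are, up to sign and the normalization of the
chart, linear forms which support `tan ∘ u` from above; they are causal because `0 ≤ u`. -/
theorem IsCConvex.admissible {u : ℍ → ℝ} (hu : IsCConvex u) : ∃ T, Admissible T u := by
  obtain ⟨h0, ⟨R, hR, hle⟩, ubar, hconv, hbar⟩ := hu
  have hlt : ∀ z, u z < Real.pi / 2 := fun z => (hle z).trans_lt hR
  have hcos : ∀ z, 0 < Real.cos (u z) := fun z =>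
    Real.cos_pos_of_mem_Ioo ⟨by linarith [h0 z, Real.pi_pos], hlt z⟩
  have htan := fun z => tan_eq_of_affineCyl (hcos z).ne' (hbar z)
  refine ⟨Real.tan R, h0, hlt, fun z => ?_, fun z => ?_⟩
  · exact Real.strictMonoOn_tan.monotoneOn
      ⟨by linarith [h0 z, Real.pi_pos], hlt z⟩ ⟨by linarith [h0 z, hle z, Real.pi_pos], hR⟩ (hle z)
  · have hmem : ∀ w, toDisc w ∈ disc := fun w => range_toDisc ▸ Set.mem_range_self w
    obtain ⟨a, b, d, he, hs⟩ := exists_affine_support hconv (hmem z)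
    have hk : ∀ w : ℍ, linForm ((b - a) / 2, -d, (-a - b) / 2) w =
        -(a + b * (toDisc w).1 + d * (toDisc w).2) * ((w.re ^ 2 + w.im ^ 2 + 1) / (2 * w.im)) := by
      intro w
      have hw := w.im_pos.ne'
      have hp : 0 < w.re ^ 2 + w.im ^ 2 + 1 := by positivity
      rw [toDisc_eq]
      simp only [linForm]
      field_simp
      ring
    have hle' : ∀ w, Real.tan (u w) ≤ linForm ((b - a) / 2, -d, (-a - b) / 2) w := by
      intro w
      rw [hk, htan]
      have hw := w.im_pos
      gcongr
      exact hs _ (hmem w)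
    refine ⟨((b - a) / 2, -d, (-a - b) / 2), isCausal_of_linForm_nonneg fun w => ?_, ?_, hle'⟩
    · exact (Real.tan_nonneg_of_nonneg_of_le_pi_div_two (h0 w) (hlt w).le).trans (hle' w)
    · rw [hk, htan, he]

/-! ### The length structure of a C-convex function -/

section Length

open MeasureTheory Set

variable {c : ℝ → ℍ} {K : NNReal} {u : ℍ → ℝ} {T : ℝ}

/-- The speed of the curve `(c, u ∘ c)` for the anti-de Sitter metric. -/
def speed (u : ℍ → ℝ) (c : ℝ → ℍ) (t : ℝ) : ℝ :=
  √(Real.cos (u (c t)) ^ 2 * hypSpeed c t ^ 2 - deriv (fun s => u (c s)) t ^ 2)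

theorem length_eq_integral_speed (u : ℍ → ℝ) (c : ℝ → ℍ) :
    length u c = ∫ t in (0 : ℝ)..1, speed u c t := rfl

theorem speed_nonneg (u : ℍ → ℝ) (c : ℝ → ℍ) (t : ℝ) : 0 ≤ speed u c t := Real.sqrt_nonneg _

theorem length_nonneg (u : ℍ → ℝ) (c : ℝ → ℍ) : 0 ≤ length u c :=
  intervalIntegral.integral_nonneg zero_le_one fun t _ => speed_nonneg u c t

theorem speed_le_hypSpeed (u : ℍ → ℝ) (c : ℝ → ℍ) (t : ℝ) : speed u c t ≤ hypSpeed c t := by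
  refine Real.sqrt_le_iff.2 ⟨hypSpeed_nonneg c t, ?_⟩
  have h1 := Real.cos_sq_le_one (u (c t))
  nlinarith [sq_nonneg (deriv (fun s => u (c s)) t), sq_nonneg (hypSpeed c t)]

theorem ae_speed_le (u : ℍ → ℝ) (hc : LipschitzWith K c) : ∀ᵐ t : ℝ, |speed u c t| ≤ K := by
  filter_upwards [ae_hypSpeed_le hc] with t ht
  rw [abs_of_nonneg (speed_nonneg u c t)]
  exact (speed_le_hypSpeed u c t).trans ht

theorem speed_congr {c c' : ℝ → ℍ} {t : ℝ} (u : ℍ → ℝ) (he : c =ᶠ[𝓝 t] c') :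
    speed u c t = speed u c' t := by
  have e1 := (he.fun_comp (fun z : ℍ => (z : ℂ))).deriv_eq
  have e2 := (he.fun_comp u).deriv_eq
  have e3 := he.eq_of_nhds
  simp only [Function.comp_def] at e1 e2
  simp only [speed, hypSpeed, e1, e2, e3]

theorem lipschitzWith_isometry_comp (σ : ℍ ≃ᵢ ℍ) (hc : LipschitzWith K c) :
    LipschitzWith K fun t => σ (c t) :=
  LipschitzWith.of_dist_le_mul fun s t => by
    rw [σ.isometry.dist_eq]; exact hc.dist_le_mul s t

namespace Admissible

variable (hu : Admissible T u)
include hu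

theorem tan_nonneg (z : ℍ) : 0 ≤ Real.tan (u z) :=
  Real.tan_nonneg_of_nonneg_of_le_pi_div_two (hu.nonneg z) (hu.lt_pi_div_two z).le

theorem bound_nonneg : 0 ≤ T := (hu.tan_nonneg I).trans (hu.tan_le I)

theorem cos_pos (z : ℍ) : 0 < Real.cos (u z) :=
  Real.cos_pos_of_mem_Ioo ⟨by linarith [hu.nonneg z, Real.pi_pos], hu.lt_pi_div_two z⟩

theorem arctan_tan (z : ℍ) : Real.arctan (Real.tan (u z)) = u z :=
  Real.arctan_tan (by linarith [hu.nonneg z, Real.pi_pos]) (hu.lt_pi_div_two z)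

/-- Harnack inequality for `tan ∘ u`. -/
theorem tan_le_exp_mul (z w : ℍ) : Real.tan (u w) ≤ Real.exp (dist z w) * Real.tan (u z) := by
  obtain ⟨k, hk⟩ := hu.support z
  calc Real.tan (u w) ≤ linForm k w := hk.le w
    _ ≤ _ := linForm_le_exp_mul hk.causal z w
    _ = _ := by rw [← hk.eq]

theorem tan_sub_le (z w : ℍ) : Real.tan (u w) - Real.tan (u z) ≤ 2 * T * dist z w := by
  have h1 := hu.tan_le_exp_mul z w
  have h2 := hu.tan_nonneg z
  have h3 := hu.tan_le z
  have h4 := hu.tan_le w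
  have hT := hu.bound_nonneg
  set d := dist z w
  have hd : 0 ≤ d := dist_nonneg
  rcases le_total d 1 with h | h
  · have h5 := Real.abs_exp_sub_one_le (x := d) (by rwa [abs_of_nonneg hd])
    rw [abs_of_nonneg hd] at h5
    have h6 := (le_abs_self _).trans h5
    nlinarith [mul_nonneg hd h2, mul_le_mul_of_nonneg_left h3 hd]
  · nlinarith

theorem lipschitzWith_tan : LipschitzWith (2 * T).toNNReal fun z => Real.tan (u z) := by
  refine LipschitzWith.of_dist_le_mul fun z w => ?_
  rw [Real.coe_toNNReal _ (by linarith [hu.bound_nonneg]), Real.dist_eq, abs_le]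
  have h1 := hu.tan_sub_le z w
  have h2 := hu.tan_sub_le w z
  rw [dist_comm w z] at h2
  constructor <;> linarith

theorem continuous : Continuous u := by
  have := Real.continuous_arctan.comp hu.lipschitzWith_tan.continuous
  exact this.congr fun z => hu.arctan_tan z

theorem ae_differentiableAt (hc : LipschitzWith K c) :
    ∀ᵐ t : ℝ, DifferentiableAt ℝ (fun s => Real.tan (u (c s))) t :=
  (hu.lipschitzWith_tan.comp hc).ae_differentiableAt_real

theorem deriv_curve_eq {t : ℝ} (h : DifferentiableAt ℝ (fun s => Real.tan (u (c s))) t) :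
    deriv (fun s => u (c s)) t =
      deriv (fun s => Real.tan (u (c s))) t / (1 + Real.tan (u (c t)) ^ 2) := by
  have h1 := h.hasDerivAt.arctan
  have h2 : (fun s => Real.arctan (Real.tan (u (c s)))) = fun s => u (c s) :=
    funext fun s => hu.arctan_tan _
  rw [h2] at h1
  rw [h1.deriv]
  ring

theorem cos_sq_eq (z : ℍ) : Real.cos (u z) ^ 2 = 1 / (1 + Real.tan (u z) ^ 2) := by
  rw [← Real.inv_one_add_tan_sq (hu.cos_pos z).ne', one_div]

theorem speed_eq {t : ℝ} (h : DifferentiableAt ℝ (fun s => Real.tan (u (c s))) t) :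
    speed u c t = √(hypSpeed c t ^ 2 / (1 + Real.tan (u (c t)) ^ 2) -
      (deriv (fun s => Real.tan (u (c s))) t / (1 + Real.tan (u (c t)) ^ 2)) ^ 2) := by
  rw [speed, hu.deriv_curve_eq h, hu.cos_sq_eq]
  congr 2
  ring

/-- The graph of a C-convex function is uniformly spacelike. -/
theorem hypSpeed_le_mul_speed {t : ℝ} (hc : DifferentiableAt ℝ (fun s => (c s : ℂ)) t)
    (h : DifferentiableAt ℝ (fun s => Real.tan (u (c s))) t) :
    hypSpeed c t ≤ (1 + T ^ 2) * speed u c t := by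
  obtain ⟨k, hk⟩ := hu.support (c t)
  have h1 := linFormDeriv_sq_le hk.causal (c t) (deriv (fun s => (c s : ℂ)) t)
  rw [← hk.deriv_eq hc h, ← hk.eq] at h1
  rw [← div_pow] at h1
  change _ ≤ _ * hypSpeed c t ^ 2 at h1
  rw [hu.speed_eq h]
  have h2 := hu.tan_nonneg (c t)
  have h3 := hu.tan_le (c t)
  set U := Real.tan (u (c t))
  set p := deriv (fun s => Real.tan (u (c s))) t
  have h4 := hypSpeed_nonneg c t
  set s := hypSpeed c t
  have h5 : s ≤ (1 + U ^ 2) * √(s ^ 2 / (1 + U ^ 2) - (p / (1 + U ^ 2)) ^ 2) := by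
    have hp : 0 < 1 + U ^ 2 := by positivity
    rw [← div_le_iff₀' hp]
    refine Real.le_sqrt_of_sq_le ?_
    rw [div_pow, div_pow, le_sub_iff_add_le, ← add_div, div_le_div_iff₀ (by positivity) hp]
    nlinarith [mul_nonneg hp.le (sub_nonneg.2 h1)]
  refine h5.trans ?_
  gcongr

theorem measurable_speed (hc : LipschitzWith K c) : Measurable (speed u c) := by
  have h1 : Measurable fun t => Real.cos (u (c t)) :=
    (Real.continuous_cos.comp (hu.continuous.comp hc.continuous)).measurable
  have h2 := measurable_hypSpeed hc
  have h3 : Measurable (deriv fun s => u (c s)) := measurable_deriv _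
  exact (((h1.pow_const 2).mul (h2.pow_const 2)).sub (h3.pow_const 2)).sqrt

theorem intervalIntegrable_speed (hc : LipschitzWith K c) (a b : ℝ) :
    IntervalIntegrable (speed u c) volume a b :=
  intervalIntegrable_of_ae_bound (hu.measurable_speed hc) (ae_speed_le u hc) a b

theorem length_le (hc : LipschitzWith K c) : length u c ≤ K := by
  have := intervalIntegral.integral_mono_ae zero_le_one (hu.intervalIntegrable_speed hc 0 1)
    (intervalIntegrable_const (c := (K : ℝ))) ((ae_speed_le u hc).mono fun t ht =>
      (le_abs_self _).trans ht)
  simpa [length_eq_integral_speed] using this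

/-- Curves of small length stay close to their starting point. -/
theorem dist_le_mul_length (hc : LipschitzWith K c) {s : ℝ} (hs : s ∈ Icc (0 : ℝ) 1) :
    dist (c 0) (c s) ≤ (1 + T ^ 2) * length u c := by
  calc dist (c 0) (c s) ≤ ∫ t in (0 : ℝ)..s, hypSpeed c t := dist_le_integral_hypSpeed hc hs.1
    _ ≤ ∫ t in (0 : ℝ)..1, hypSpeed c t := by
        refine intervalIntegral.integral_mono_interval le_rfl hs.1 hs.2
          (ae_of_all _ (hypSpeed_nonneg c)) (intervalIntegrable_hypSpeed hc 0 1)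
    _ ≤ ∫ t in (0 : ℝ)..1, (1 + T ^ 2) * speed u c t := by
        refine intervalIntegral.integral_mono_ae zero_le_one (intervalIntegrable_hypSpeed hc 0 1)
          ((hu.intervalIntegrable_speed hc 0 1).const_mul _) ?_
        filter_upwards [ae_differentiableAt_coe_curve hc, hu.ae_differentiableAt hc] with t h1 h2
          using hu.hypSpeed_le_mul_speed h1 h2
    _ = _ := by rw [intervalIntegral.integral_const_mul, length_eq_integral_speed]

end Admissible

/-! ### The induced distance -/

theorem inducedDist_nonneg (u : ℍ → ℝ) (x y : ℍ) : 0 ≤ inducedDist u x y := by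
  refine Real.sInf_nonneg ?_
  rintro _ ⟨c, _, rfl⟩
  exact length_nonneg u c

theorem inducedDist_le_length (u : ℍ → ℝ) (hc : LipschitzWith K c) :
    inducedDist u (c 0) (c 1) ≤ length u c := by
  refine csInf_le ⟨0, ?_⟩ ⟨c, ⟨⟨K, hc.lipschitzOnWith⟩, rfl, rfl⟩, rfl⟩
  rintro _ ⟨c, _, rfl⟩
  exact length_nonneg u c

/-- The Euclidean segment between two points of the half-plane. -/
theorem exists_segment (x y : ℍ) : ∃ c : ℝ → ℍ, c 0 = x ∧ c 1 = y ∧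
    LipschitzWith (dist (x : ℂ) y / min x.im y.im).toNNReal c := by
  have hm : 0 < min x.im y.im := lt_min x.im_pos y.im_pos
  have him : ∀ t : unitInterval, min x.im y.im ≤ ((1 - (t : ℝ)) • (x : ℂ) + (t : ℝ) • (y : ℂ)).im := by
    intro t
    have h1 := t.2.1
    have h2 := t.2.2
    simp only [Complex.add_im, Complex.smul_im, smul_eq_mul, coe_im]
    have h3 := min_le_left x.im y.im
    have h4 := min_le_right x.im y.im
    nlinarith [mul_le_mul_of_nonneg_left h3 (sub_nonneg.2 h2), mul_le_mul_of_nonneg_left h4 h1]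
  let g : unitInterval → ℍ := fun t =>
    UpperHalfPlane.mk ((1 - (t : ℝ)) • (x : ℂ) + (t : ℝ) • (y : ℂ)) (hm.trans_le (him t))
  have hg : LipschitzWith (dist (x : ℂ) y / min x.im y.im).toNNReal g := by
    refine LipschitzWith.of_dist_le_mul fun s t => ?_
    rw [Real.coe_toNNReal _ (by positivity)]
    refine (dist_le_dist_coe_div_sqrt _ _).trans ?_
    have h1 : dist (g s : ℂ) (g t) = dist (x : ℂ) y * dist s t := by
      simp only [g, dist_eq_norm, Subtype.dist_eq]
      have : (1 - (s : ℝ)) • (x : ℂ) + (s : ℝ) • (y : ℂ) -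
          ((1 - (t : ℝ)) • (x : ℂ) + (t : ℝ) • (y : ℂ)) = (-((s : ℝ) - t)) • ((x : ℂ) - y) := by
        simp only [Complex.real_smul]; push_cast; ring
      change ‖(1 - (s : ℝ)) • (x : ℂ) + (s : ℝ) • (y : ℂ) -
          ((1 - (t : ℝ)) • (x : ℂ) + (t : ℝ) • (y : ℂ))‖ = _
      rw [this, norm_smul, norm_neg, mul_comm]
    rw [h1, div_mul_eq_mul_div]
    gcongr
    refine Real.le_sqrt_of_sq_le ?_
    rw [pow_two]
    exact mul_le_mul (him s) (him t) hm.le (hm.le.trans (him s))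
  refine ⟨fun t => g (projIcc 0 1 zero_le_one t), ?_, ?_, ?_⟩
  · simp only [projIcc_left]
    ext
    simp [g]
  · simp only [projIcc_right]
    ext
    simp [g]
  · have := hg.comp (LipschitzWith.projIcc (zero_le_one (α := ℝ)))
    rwa [mul_one] at this

/-- A Lipschitz curve on `[0, 1]` can be extended to the line. -/
theorem IsLipschitzCurve.exists_extension {x y : ℍ} (h : IsLipschitzCurve c x y) (u : ℍ → ℝ) :
    ∃ (K : NNReal) (c' : ℝ → ℍ), LipschitzWith K c' ∧ c' 0 = x ∧ c' 1 = y ∧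
      length u c' = length u c := by
  obtain ⟨⟨K, hK⟩, h0, h1⟩ := h
  have hK' := (lipschitzOnWith_iff_restrict.1 hK)
  refine ⟨K, fun t => c (projIcc 0 1 zero_le_one t), ?_, by simp [h0], by simp [h1], ?_⟩
  · have := hK'.comp (LipschitzWith.projIcc (zero_le_one (α := ℝ)))
    rwa [mul_one] at this
  · rw [length_eq_integral_speed, length_eq_integral_speed]
    refine intervalIntegral.integral_congr_ae ?_
    have hne : ∀ᵐ t : ℝ, t ≠ 1 := by simp [ae_iff]
    filter_upwards [hne] with t ht1 ht
    rw [uIoc_of_le zero_le_one] at ht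
    have hI : Icc (0 : ℝ) 1 ∈ 𝓝 t := Icc_mem_nhds ht.1 (lt_of_le_of_ne ht.2 ht1)
    have he : (fun t => c (projIcc 0 1 zero_le_one t)) =ᶠ[𝓝 t] c := by
      filter_upwards [hI] with s hs
      rw [projIcc_of_mem zero_le_one hs]
    exact speed_congr u he

theorem exists_curve_of_inducedDist_lt {x y : ℍ} {r : ℝ} (h : inducedDist u x y < r) :
    ∃ (K : NNReal) (c : ℝ → ℍ), LipschitzWith K c ∧ c 0 = x ∧ c 1 = y ∧ length u c < r := by
  have hne : {l | ∃ c, IsLipschitzCurve c x y ∧ l = length u c}.Nonempty := by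
    obtain ⟨c, h0, h1, hc⟩ := exists_segment x y
    exact ⟨_, c, ⟨⟨_, hc.lipschitzOnWith⟩, h0, h1⟩, rfl⟩
  obtain ⟨_, ⟨c, hc, rfl⟩, hlt⟩ := exists_lt_of_csInf_lt hne h
  obtain ⟨K, c', hc', h0, h1, hl⟩ := hc.exists_extension u
  exact ⟨K, c', hc', h0, h1, hl ▸ hlt⟩

theorem speed_affine (u : ℍ → ℝ) (c : ℝ → ℍ) (a k t : ℝ) :
    speed u (fun s => c (a + k * s)) t = |k| * speed u c (a + k * t) := by
  have h1 : deriv (fun s => (c (a + k * s) : ℂ)) t =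
      k • deriv (fun s => (c s : ℂ)) (a + k * t) := by
    rw [deriv_comp_mul_left k (fun s => (c (a + s) : ℂ)) t, deriv_comp_const_add (fun s => (c s : ℂ))]
  have h2 : deriv (fun s => u (c (a + k * s))) t = k • deriv (fun s => u (c s)) (a + k * t) := by
    rw [deriv_comp_mul_left k (fun s => u (c (a + s))) t, deriv_comp_const_add (fun s => u (c s))]
  rw [speed, speed, ← Real.sqrt_sq_eq_abs, ← Real.sqrt_mul (sq_nonneg k)]
  congr 1
  rw [h2, hypSpeed, hypSpeed, h1, norm_smul, smul_eq_mul, Real.norm_eq_abs]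
  simp only [mul_pow, div_pow, sq_abs]
  ring

/-- The induced distance is at most the length of any piece of a Lipschitz curve, whatever its
parametrization. -/
theorem inducedDist_le_abs_integral (u : ℍ → ℝ) (hc : LipschitzWith K c) (a b : ℝ) :
    inducedDist u (c a) (c b) ≤ |∫ t in a..b, speed u c t| := by
  have hl : LipschitzWith (K * ‖b - a‖₊) (fun s => c (a + (b - a) * s)) := by
    refine LipschitzWith.of_dist_le_mul fun s t => (hc.dist_le_mul _ _).trans_eq ?_
    rw [dist_add_left, Real.dist_eq, ← mul_sub, abs_mul, Real.dist_eq]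
    push_cast
    rw [Real.norm_eq_abs]
    ring
  have h1 := inducedDist_le_length u hl
  simp only [mul_zero, add_zero, mul_one, add_sub_cancel] at h1
  refine h1.trans_eq ?_
  rw [length_eq_integral_speed]
  simp only [speed_affine]
  have h2 := intervalIntegral.smul_integral_comp_add_mul (a := 0) (b := 1) (speed u c) (b - a) a
  rw [mul_zero, add_zero, mul_one, add_sub_cancel, smul_eq_mul] at h2
  rw [intervalIntegral.integral_const_mul, ← h2, abs_mul, abs_of_nonneg (a := ∫ x in (0 : ℝ)..1, _)]
  exact intervalIntegral.integral_nonneg zero_le_one fun t _ => speed_nonneg u c _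

theorem inducedDist_comm (u : ℍ → ℝ) (x y : ℍ) : inducedDist u x y = inducedDist u y x := by
  have key : ∀ x y, inducedDist u x y ≤ inducedDist u y x := by
    intro x y
    refine le_of_forall_gt fun r hr => ?_
    obtain ⟨K, c, hc, rfl, rfl, hl⟩ := exists_curve_of_inducedDist_lt hr
    refine (inducedDist_le_abs_integral u hc 1 0).trans_lt ?_
    rwa [intervalIntegral.integral_symm, abs_neg, ← length_eq_integral_speed,
      abs_of_nonneg (length_nonneg u c)]
  exact le_antisymm (key x y) (key y x)

theorem inducedDist_self (u : ℍ → ℝ) (x : ℍ) : inducedDist u x x = 0 := by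
  refine le_antisymm ?_ (inducedDist_nonneg u x x)
  have := inducedDist_le_abs_integral u (LipschitzWith.const x) 0 0
  simpa using this

/-- Gluing two Lipschitz curves. -/
theorem lipschitzWith_glue {c₁ c₂ : ℝ → ℍ} {K₁ K₂ : NNReal} (h₁ : LipschitzWith K₁ c₁)
    (h₂ : LipschitzWith K₂ c₂) (h : c₁ 1 = c₂ 0) :
    LipschitzWith (max K₁ K₂) fun t => if t ≤ 1 then c₁ t else c₂ (t - 1) := by
  have key : ∀ s t : ℝ, s ≤ t → dist (if s ≤ 1 then c₁ s else c₂ (s - 1))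
      (if t ≤ 1 then c₁ t else c₂ (t - 1)) ≤ max K₁ K₂ * dist s t := by
    intro s t hst
    have hK₁ : (K₁ : ℝ) ≤ max (K₁ : ℝ) K₂ := le_max_left _ _
    have hK₂ : (K₂ : ℝ) ≤ max (K₁ : ℝ) K₂ := le_max_right _ _
    split_ifs with h3 h4 h4
    · exact (h₁.dist_le_mul s t).trans (mul_le_mul_of_nonneg_right hK₁ dist_nonneg)
    · push Not at h4
      refine (dist_triangle _ (c₁ 1) _).trans ?_
      have e1 := h₁.dist_le_mul s 1
      have e2 := h₂.dist_le_mul 0 (t - 1)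
      rw [← h] at e2
      rw [Real.dist_eq, abs_of_nonpos (by linarith)] at e1 e2 ⊢
      have e3 := mul_le_mul_of_nonneg_right hK₁ (sub_nonneg.2 h3)
      have e4 := mul_le_mul_of_nonneg_right hK₂ (sub_nonneg.2 h4.le)
      rw [← NNReal.coe_max] at e3 e4
      linarith
    · exact absurd (hst.trans h4) h3
    · have := (h₂.dist_le_mul (s - 1) (t - 1)).trans (mul_le_mul_of_nonneg_right hK₂ dist_nonneg)
      rwa [dist_sub_right] at this
  refine LipschitzWith.of_dist_le_mul fun s t => ?_
  push_cast
  rcases le_total s t with hst | hst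
  · exact key s t hst
  · rw [dist_comm, dist_comm s t]
    exact key t s hst

namespace Admissible

variable (hu : Admissible T u)
include hu

theorem inducedDist_triangle (x y z : ℍ) :
    inducedDist u x z ≤ inducedDist u x y + inducedDist u y z := by
  refine le_of_forall_pos_lt_add fun ε hε => ?_
  obtain ⟨K₁, c₁, hc₁, h10, h11, hl₁⟩ :=
    exists_curve_of_inducedDist_lt (lt_add_of_pos_right (inducedDist u x y) (half_pos hε))
  obtain ⟨K₂, c₂, hc₂, h20, h21, hl₂⟩ :=
    exists_curve_of_inducedDist_lt (lt_add_of_pos_right (inducedDist u y z) (half_pos hε))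
  have hg := lipschitzWith_glue hc₁ hc₂ (h11.trans h20.symm)
  set c : ℝ → ℍ := fun t => if t ≤ 1 then c₁ t else c₂ (t - 1) with hcdef
  have h1 := inducedDist_le_abs_integral u hg 0 2
  have e0 : c 0 = x := by simp [hcdef, h10]
  have e2 : c 2 = z := by
    simp only [hcdef]
    rw [if_neg (by norm_num), ← h21]
    norm_num
  rw [e0, e2, ← intervalIntegral.integral_add_adjacent_intervals
    (hu.intervalIntegrable_speed hg 0 1) (hu.intervalIntegrable_speed hg 1 2)] at h1
  have hne : ∀ᵐ t : ℝ, t ≠ 1 := by simp [ae_iff]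
  have i1 : ∫ t in (0 : ℝ)..1, speed u c t = length u c₁ := by
    rw [length_eq_integral_speed]
    refine intervalIntegral.integral_congr_ae ?_
    filter_upwards [hne] with t ht1 ht
    rw [uIoc_of_le zero_le_one] at ht
    refine speed_congr u ?_
    filter_upwards [Iio_mem_nhds (lt_of_le_of_ne ht.2 ht1)] with s hs
    simp only [hcdef, if_pos (le_of_lt (Set.mem_Iio.1 hs))]
  have i2 : ∫ t in (1 : ℝ)..2, speed u c t = length u c₂ := by
    have : length u c₂ = ∫ t in (1 : ℝ)..2, speed u c₂ (t - 1) := by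
      rw [intervalIntegral.integral_comp_sub_right, length_eq_integral_speed]
      norm_num
    rw [this]
    refine intervalIntegral.integral_congr_ae ?_
    filter_upwards [hne] with t ht1 ht
    rw [uIoc_of_le one_le_two] at ht
    have e := speed_affine u c₂ (-1) 1 t
    simp only [one_mul, abs_one] at e
    rw [neg_add_eq_sub] at e
    rw [← e]
    refine speed_congr u ?_
    filter_upwards [Ioi_mem_nhds ht.1] with s hs
    simp only [hcdef, if_neg (not_le.2 (Set.mem_Ioi.1 hs)), neg_add_eq_sub]
  rw [i1, i2, abs_of_nonneg (add_nonneg (length_nonneg _ _) (length_nonneg _ _))] at h1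
  linarith

/-- The induced distance dominates a multiple of the hyperbolic distance. -/
theorem dist_le_mul_inducedDist (x y : ℍ) : dist x y ≤ (1 + T ^ 2) * inducedDist u x y := by
  have hp : 0 < 1 + T ^ 2 := by positivity
  rw [← div_le_iff₀' hp]
  refine le_of_forall_gt fun r hr => ?_
  obtain ⟨K, c, hc, rfl, rfl, hl⟩ := exists_curve_of_inducedDist_lt hr
  rw [div_lt_iff₀' hp]
  exact (hu.dist_le_mul_length hc ⟨zero_le_one, le_rfl⟩).trans_lt (by gcongr)

theorem inducedDist_eq_zero_iff (x y : ℍ) : inducedDist u x y = 0 ↔ x = y := by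
  refine ⟨fun h => ?_, fun h => h ▸ inducedDist_self u x⟩
  have := hu.dist_le_mul_inducedDist x y
  rw [h, mul_zero] at this
  exact dist_le_zero.1 this

/-- The induced distance is dominated, locally, by the Euclidean distance. -/
theorem inducedDist_le_dist_coe_div (x y : ℍ) :
    inducedDist u x y ≤ dist (x : ℂ) y / min x.im y.im := by
  obtain ⟨c, rfl, rfl, hc⟩ := exists_segment x y
  have h := (inducedDist_le_length u hc).trans (hu.length_le hc)
  rwa [Real.coe_toNNReal] at h
  have : 0 < min (c 0).im (c 1).im := lt_min (c 0).im_pos (c 1).im_pos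
  positivity

end Admissible

/-- Length is preserved by the hyperbolic isometries which preserve `u`. -/
theorem length_comp_isometry (u : ℍ → ℝ) (σ : ℍ ≃ᵢ ℍ) (hσ : ∀ z, u (σ z) = u z)
    (hc : LipschitzWith K c) : length u (fun t => σ (c t)) = length u c := by
  have hc' := lipschitzWith_isometry_comp σ hc
  rw [length_eq_integral_speed, length_eq_integral_speed]
  refine intervalIntegral.integral_congr_ae ?_
  filter_upwards [ae_differentiableAt_coe_curve hc, ae_differentiableAt_coe_curve hc'] with t h1 h2 _
  have e : hypSpeed (fun t => σ (c t)) t = hypSpeed c t := by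
    have l1 := tendsto_dist_div_hypSpeed h1
    have l2 := tendsto_dist_div_hypSpeed h2
    simp only [σ.isometry.dist_eq] at l2
    exact tendsto_nhds_unique l2 l1
  simp only [speed, e, hσ]

theorem inducedDist_isometry (u : ℍ → ℝ) (σ : ℍ ≃ᵢ ℍ) (hσ : ∀ z, u (σ z) = u z) (x y : ℍ) :
    inducedDist u (σ x) (σ y) = inducedDist u x y := by
  have key : ∀ (σ : ℍ ≃ᵢ ℍ), (∀ z, u (σ z) = u z) → ∀ x y,
      inducedDist u (σ x) (σ y) ≤ inducedDist u x y := by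
    intro σ hσ x y
    refine le_of_forall_gt fun r hr => ?_
    obtain ⟨K, c, hc, rfl, rfl, hl⟩ := exists_curve_of_inducedDist_lt hr
    have hc' := lipschitzWith_isometry_comp σ hc
    refine (inducedDist_le_length u hc').trans_lt ?_
    rwa [length_comp_isometry u σ hσ hc]
  refine le_antisymm (key σ hσ x y) ?_
  have := key σ.symm (fun z => by rw [← hσ (σ.symm z), σ.apply_symm_apply]) (σ x) (σ y)
  simpa using this

end Length

/-! ### Discrete groups of isometries and their quotients -/

section Quotients

open Set

variable {Γ : Subgroup (ℍ ≃ᵢ ℍ)} {u : ℍ → ℝ} {T : ℝ}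

theorem tendsto_isometryEquiv_iff {ι : Type*} {l : Filter ι} {f : ι → ℍ ≃ᵢ ℍ} {g : ℍ ≃ᵢ ℍ} :
    Tendsto f l (𝓝 g) ↔ ∀ z, Tendsto (fun i => f i z) l (𝓝 (g z)) := by
  have h : IsInducing fun (σ : ℍ ≃ᵢ ℍ) (z : ℍ) => σ z := ⟨rfl⟩
  rw [h.tendsto_nhds_iff, tendsto_pi_nhds]
  rfl

/-- An ultrafilter on which a map into the hyperbolic plane is bounded has a limit. -/
theorem exists_ultrafilter_lim {ι : Type*} (𝒰 : Ultrafilter ι) (f : ι → ℍ) (x : ℍ) (R : ℝ)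
    (h : ∀ᶠ i in 𝒰, dist x (f i) ≤ R) : ∃ y, Tendsto f 𝒰 (𝓝 y) := by
  obtain ⟨y, -, hy⟩ := (isCompact_closedBall x R).ultrafilter_le_nhds (𝒰.map f) (by
    rw [Ultrafilter.coe_map, le_principal_iff, mem_map]
    filter_upwards [h] with i hi
    rw [mem_preimage, Metric.mem_closedBall, dist_comm]
    exact hi)
  exact ⟨y, hy⟩

/-- Discrete groups of isometries act properly discontinuously. -/
theorem finite_setOf_dist_le [DiscreteTopology Γ] (x y : ℍ) (R : ℝ) :
    {σ : Γ | dist x ((σ : ℍ ≃ᵢ ℍ) y) ≤ R}.Finite := by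
  by_contra hinf
  have hne := Set.Infinite.cofinite_inf_principal_neBot hinf
  set S := {σ : Γ | dist x ((σ : ℍ ≃ᵢ ℍ) y) ≤ R}
  let 𝒰 := Ultrafilter.of (cofinite ⊓ 𝓟 S)
  have hle : (𝒰 : Filter Γ) ≤ cofinite ⊓ 𝓟 S := Ultrafilter.of_le _
  have hS : ∀ᶠ σ : Γ in (𝒰 : Filter Γ), dist x ((σ : ℍ ≃ᵢ ℍ) y) ≤ R :=
    le_principal_iff.1 (hle.trans inf_le_right)
  have hlim : ∀ z : ℍ, ∃ w, Tendsto (fun σ : Γ => (σ : ℍ ≃ᵢ ℍ) z) 𝒰 (𝓝 w) := by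
    intro z
    refine exists_ultrafilter_lim 𝒰 _ x (R + dist y z) ?_
    filter_upwards [hS] with σ hσ
    refine (dist_triangle _ ((σ : ℍ ≃ᵢ ℍ) y) _).trans ?_
    rw [(σ : ℍ ≃ᵢ ℍ).isometry.dist_eq]
    linarith
  choose h hh using hlim
  -- the quotients `τ⁻¹ σ` tend to the identity as `σ` and `τ` tend to the limit independently
  have h1 : Tendsto (fun p : Γ × Γ => p.2⁻¹ * p.1) (𝒰 ×ˢ (𝒰 : Filter Γ)) (𝓝 1) := by
    rw [IsInducing.subtypeVal.tendsto_nhds_iff, tendsto_isometryEquiv_iff]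
    intro z
    rw [tendsto_iff_dist_tendsto_zero]
    have h2 : Tendsto (fun p : Γ × Γ => dist ((p.1 : ℍ ≃ᵢ ℍ) z) ((p.2 : ℍ ≃ᵢ ℍ) z))
        (𝒰 ×ˢ (𝒰 : Filter Γ)) (𝓝 0) := by
      have e1 : Tendsto (fun p : Γ × Γ => (p.1 : ℍ ≃ᵢ ℍ) z) (𝒰 ×ˢ (𝒰 : Filter Γ)) (𝓝 (h z)) :=
        (hh z).comp tendsto_fst
      have e2 : Tendsto (fun p : Γ × Γ => (p.2 : ℍ ≃ᵢ ℍ) z) (𝒰 ×ˢ (𝒰 : Filter Γ)) (𝓝 (h z)) :=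
        (hh z).comp tendsto_snd
      simpa using e1.dist e2
    refine h2.congr fun p => ?_
    have := (p.2 : ℍ ≃ᵢ ℍ).isometry.dist_eq
      (((p.2⁻¹ * p.1 : Γ) : ℍ ≃ᵢ ℍ) z) z
    refine Eq.trans ?_ this
    congr 1
    change _ = ((p.2 * (p.2⁻¹ * p.1) : Γ) : ℍ ≃ᵢ ℍ) z
    rw [mul_inv_cancel_left]
  have h2 := h1.eventually (p := fun σ => σ = 1) (by
    have : ({1} : Set Γ) ∈ 𝓝 (1 : Γ) := mem_nhds_discrete.2 rfl
    exact this)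
  obtain ⟨τ, hτ⟩ := h2.curry.exists
  have h3 : ∀ᶠ σ in (𝒰 : Filter Γ), σ ≠ τ := by
    have : ∀ᶠ σ in cofinite, σ ≠ τ := by simp
    exact (hle.trans inf_le_left) this
  obtain ⟨σ, h4, h5⟩ := (hτ.and h3).exists
  exact h5 (inv_mul_eq_one.1 h4)

theorem quo_mk_eq_iff {x y : ℍ} : (Quotient.mk (MulAction.orbitRel Γ ℍ) x = Quotient.mk _ y) ↔
    ∃ σ : Γ, (σ : ℍ ≃ᵢ ℍ) y = x := by
  rw [Quotient.eq]
  rfl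

theorem quo_mk_apply (σ : Γ) (x : ℍ) :
    Quotient.mk (MulAction.orbitRel Γ ℍ) ((σ : ℍ ≃ᵢ ℍ) x) = Quotient.mk _ x :=
  quo_mk_eq_iff.2 ⟨σ, rfl⟩

theorem isOpen_quo_iff {s : Set (Quo Γ)} :
    IsOpen s ↔ IsOpen {z | Quotient.mk (MulAction.orbitRel Γ ℍ) z ∈ s} := Iff.rfl

/-- Cocompactness: the translates of a large ball cover the hyperbolic plane. -/
theorem exists_forall_dist_le [CompactSpace (Quo Γ)] (x : ℍ) :
    ∃ R > 0, ∀ z : ℍ, ∃ σ : Γ, dist x ((σ : ℍ ≃ᵢ ℍ) z) < R := by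
  let O : ℕ → Set (Quo Γ) := fun n => {p | ∃ z, Quotient.mk _ z = p ∧ dist x z < n}
  have hO : ∀ n, IsOpen (O n) := by
    intro n
    rw [isOpen_quo_iff]
    have : {z | Quotient.mk _ z ∈ O n} =
        ⋃ σ : Γ, {z | dist x ((σ : ℍ ≃ᵢ ℍ) z) < n} := by
      ext z
      simp only [mem_iUnion, mem_ofPred_eq, O]
      constructor
      · rintro ⟨w, hw, hd⟩
        obtain ⟨σ, hσ⟩ := quo_mk_eq_iff.1 hw
        exact ⟨σ, hσ ▸ hd⟩
      · rintro ⟨σ, hσ⟩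
        exact ⟨_, quo_mk_apply σ z, hσ⟩
    rw [this]
    exact isOpen_iUnion fun σ =>
      isOpen_lt (continuous_const.dist (σ : ℍ ≃ᵢ ℍ).continuous) continuous_const
  have hmono : Monotone O := by
    rintro m n hmn p ⟨z, hz, hd⟩
    exact ⟨z, hz, hd.trans_le (by exact_mod_cast hmn)⟩
  obtain ⟨n, hn⟩ := isCompact_univ.elim_directed_cover O hO (by
    intro p _
    induction p using Quotient.inductionOn with
    | h z =>
      obtain ⟨n, hn⟩ := exists_nat_gt (dist x z)
      exact mem_iUnion.2 ⟨n, z, rfl, hn⟩) hmono.directed_le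
  refine ⟨n + 1, by positivity, fun z => ?_⟩
  obtain ⟨w, hw, hd⟩ := hn (mem_univ (Quotient.mk _ z))
  obtain ⟨σ, hσ⟩ := quo_mk_eq_iff.1 hw
  exact ⟨σ, by rw [hσ]; linarith⟩

theorem quoDist_mk_le (u : ℍ → ℝ) (x y : ℍ) :
    quoDist u Γ (Quotient.mk _ x) (Quotient.mk _ y) ≤ inducedDist u x y := by
  refine csInf_le ⟨0, ?_⟩ ⟨x, y, rfl, rfl, rfl⟩
  rintro _ ⟨x, y, -, -, rfl⟩
  exact inducedDist_nonneg u x y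

theorem quoDist_nonneg (u : ℍ → ℝ) (p q : Quo Γ) : 0 ≤ quoDist u Γ p q := by
  refine Real.sInf_nonneg ?_
  rintro _ ⟨x, y, -, -, rfl⟩
  exact inducedDist_nonneg u x y

theorem exists_of_quoDist_mk_lt (hinv : ∀ σ ∈ Γ, ∀ z, u (σ z) = u z) {x y : ℍ} {r : ℝ}
    (h : quoDist u Γ (Quotient.mk _ x) (Quotient.mk _ y) < r) :
    ∃ σ : Γ, inducedDist u x ((σ : ℍ ≃ᵢ ℍ) y) < r := by
  have hne : {r | ∃ x' y' : ℍ, Quotient.mk (MulAction.orbitRel Γ ℍ) x' = Quotient.mk _ x ∧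
      Quotient.mk (MulAction.orbitRel Γ ℍ) y' = Quotient.mk _ y ∧
      r = inducedDist u x' y'}.Nonempty := ⟨_, x, y, rfl, rfl, rfl⟩
  obtain ⟨_, ⟨x', y', hx, hy, rfl⟩, hlt⟩ := exists_lt_of_csInf_lt hne h
  obtain ⟨σ, rfl⟩ := quo_mk_eq_iff.1 hx
  obtain ⟨τ, rfl⟩ := quo_mk_eq_iff.1 hy
  refine ⟨σ⁻¹ * τ, ?_⟩
  rw [← inducedDist_isometry u σ (hinv σ σ.2)]
  have e : (σ : ℍ ≃ᵢ ℍ) (((σ⁻¹ * τ : Γ) : ℍ ≃ᵢ ℍ) y) = (τ : ℍ ≃ᵢ ℍ) y := by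
    change ((σ * (σ⁻¹ * τ) : Γ) : ℍ ≃ᵢ ℍ) y = _
    rw [mul_inv_cancel_left]
  rwa [e]

/-- The upper bound of `Admissible.inducedDist_le_dist_coe_div` is continuous. -/
theorem continuous_dist_coe_div : Continuous fun p : ℍ × ℍ =>
    dist (p.1 : ℂ) p.2 / min p.1.im p.2.im := by
  refine Continuous.div (by fun_prop) ?_ fun p => (lt_min p.1.im_pos p.2.im_pos).ne'
  exact (UpperHalfPlane.continuous_im.comp continuous_fst).min
    (UpperHalfPlane.continuous_im.comp continuous_snd)

/-- The quotient distance separates points because orbits are discrete and the induced distance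
dominates a multiple of the hyperbolic distance. -/
theorem Admissible.isMetricOn_quoDist (hu : Admissible T u)
    (hinv : ∀ σ ∈ Γ, ∀ z, u (σ z) = u z) [DiscreteTopology Γ] : IsMetricOn (quoDist u Γ) where
  eq_zero_iff p q := by
    induction p using Quotient.inductionOn with | h x => ?_
    induction q using Quotient.inductionOn with | h y => ?_
    constructor
    · intro h0
      by_contra hne
      have hp : 0 < 1 + T ^ 2 := by positivity
      have hfin := (finite_setOf_dist_le (Γ := Γ) x y 1).image
        fun σ : Γ => dist x ((σ : ℍ ≃ᵢ ℍ) y)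
      have h0mem : (0 : ℝ) ∉ (fun σ : Γ => dist x ((σ : ℍ ≃ᵢ ℍ) y)) ''
          {σ : Γ | dist x ((σ : ℍ ≃ᵢ ℍ) y) ≤ 1} := by
        rintro ⟨σ, -, hσ⟩
        exact hne (quo_mk_eq_iff.2 ⟨σ, (dist_eq_zero.1 hσ).symm⟩)
      obtain ⟨δ, hδ, hball⟩ := Metric.isOpen_iff.1 hfin.isClosed.isOpen_compl 0 h0mem
      obtain ⟨σ, hσ⟩ := exists_of_quoDist_mk_lt hinv
        (h0 ▸ (by positivity : 0 < min 1 δ / (1 + T ^ 2)))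
      have h1 := hu.dist_le_mul_inducedDist x ((σ : ℍ ≃ᵢ ℍ) y)
      rw [lt_div_iff₀' hp] at hσ
      have h2 := h1.trans_lt hσ
      refine hball (a := dist x ((σ : ℍ ≃ᵢ ℍ) y)) ?_ ⟨σ, ?_, rfl⟩
      · rw [Metric.mem_ball, Real.dist_eq, sub_zero, abs_of_nonneg dist_nonneg]
        exact h2.trans_le (min_le_right _ _)
      · exact (h2.trans_le (min_le_left _ _)).le
    · intro h
      rw [h]
      refine le_antisymm ?_ (quoDist_nonneg u _ _)
      have := quoDist_mk_le (Γ := Γ) u y y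
      rwa [inducedDist_self] at this
  symm p q := by
    simp only [quoDist]
    congr 1
    ext r
    constructor
    · rintro ⟨x, y, hx, hy, rfl⟩
      exact ⟨y, x, hy, hx, inducedDist_comm u x y⟩
    · rintro ⟨x, y, hx, hy, rfl⟩
      exact ⟨y, x, hy, hx, inducedDist_comm u x y⟩
  triangle p q r := by
    induction p using Quotient.inductionOn with | h x => ?_
    induction q using Quotient.inductionOn with | h y => ?_
    induction r using Quotient.inductionOn with | h z => ?_
    refine le_of_forall_pos_lt_add fun ε hε => ?_
    obtain ⟨σ, hσ⟩ := exists_of_quoDist_mk_lt hinv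
      (lt_add_of_pos_right (quoDist u Γ (Quotient.mk _ x) (Quotient.mk _ y)) (half_pos hε))
    obtain ⟨τ, hτ⟩ := exists_of_quoDist_mk_lt hinv
      (lt_add_of_pos_right (quoDist u Γ (Quotient.mk _ y) (Quotient.mk _ z)) (half_pos hε))
    rw [← inducedDist_isometry u σ (hinv σ σ.2)] at hτ
    have h1 := hu.inducedDist_triangle x ((σ : ℍ ≃ᵢ ℍ) y) ((σ : ℍ ≃ᵢ ℍ) ((τ : ℍ ≃ᵢ ℍ) z))
    have h2 := quoDist_mk_le (Γ := Γ) u x ((σ : ℍ ≃ᵢ ℍ) ((τ : ℍ ≃ᵢ ℍ) z))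
    rw [quo_mk_apply, quo_mk_apply] at h2
    linarith
  isOpen_iff s := by
    rw [isOpen_quo_iff, Metric.isOpen_iff]
    have hp : 0 < 1 + T ^ 2 := by positivity
    constructor
    · intro h p hps
      induction p using Quotient.inductionOn with | h x => ?_
      obtain ⟨δ, hδ, hball⟩ := h x hps
      refine ⟨δ / (1 + T ^ 2), by positivity, fun q hq => ?_⟩
      induction q using Quotient.inductionOn with | h y => ?_
      obtain ⟨σ, hσ⟩ := exists_of_quoDist_mk_lt hinv hq
      rw [lt_div_iff₀' hp] at hσ
      have h1 := (hu.dist_le_mul_inducedDist x ((σ : ℍ ≃ᵢ ℍ) y)).trans_lt hσ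
      have h2 : (σ : ℍ ≃ᵢ ℍ) y ∈ {z | Quotient.mk (MulAction.orbitRel Γ ℍ) z ∈ s} := hball (by
        rwa [Metric.mem_ball, dist_comm])
      have h3 : Quotient.mk (MulAction.orbitRel Γ ℍ) ((σ : ℍ ≃ᵢ ℍ) y) ∈ s := h2
      rwa [quo_mk_apply] at h3
    · intro h x hx
      obtain ⟨ε, hε, hs⟩ := h (Quotient.mk _ x) hx
      have hcont := (continuous_dist_coe_div.comp
        (Continuous.prodMk continuous_const continuous_id : Continuous fun y : ℍ => (x, y))).tendsto x
      simp only [Function.comp_apply, dist_self, zero_div] at hcont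
      obtain ⟨δ, hδ, hb⟩ := Metric.mem_nhds_iff.1 (hcont (Iio_mem_nhds hε))
      refine ⟨δ, hδ, fun y hy => hs _ ?_⟩
      exact (quoDist_mk_le u x y).trans_lt
        ((hu.inducedDist_le_dist_coe_div x y).trans_lt (hb hy))

end Quotients

/-! ### The tangent planes of the graph -/

section TangentForm

variable {T : ℝ} {u : ℍ → ℝ}

/-- The anti-de Sitter metric on the plane tangent to the graph of `linForm k`, pulled back to the
tangent plane of the half-plane at `z`; `m` stands for `cos² u`. -/
def tangentForm (m : ℝ) (z : ℍ) (k : ℝ × ℝ × ℝ) (v w : ℂ) : ℝ :=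
  inner ℝ v w / z.im ^ 2 * m - linFormDeriv k z v * linFormDeriv k z w * m ^ 2

theorem linFormDeriv_add_smul (k : ℝ × ℝ × ℝ) (z : ℍ) (v w : ℂ) (t : ℝ) :
    linFormDeriv k z (v + t • w) = linFormDeriv k z v + t * linFormDeriv k z w := by
  simp only [linFormDeriv, Complex.add_re, Complex.add_im, Complex.smul_re, Complex.smul_im,
    smul_eq_mul]
  ring

theorem tangentForm_add_smul (m : ℝ) (z : ℍ) (k : ℝ × ℝ × ℝ) (v w : ℂ) (t : ℝ) :
    tangentForm m z k (v + t • w) (v + t • w) =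
      tangentForm m z k w w * (t * t) + 2 * tangentForm m z k v w * t + tangentForm m z k v v := by
  simp only [tangentForm, linFormDeriv_add_smul, inner_add_left, inner_add_right,
    real_inner_smul_left, real_inner_smul_right, real_inner_comm v w]
  ring

theorem le_tangentForm_self {k : ℝ × ℝ × ℝ} (hk : IsCausal k) (z : ℍ) (v : ℂ) :
    ‖v‖ ^ 2 / z.im ^ 2 * (1 / (1 + linForm k z ^ 2)) ^ 2 ≤
      tangentForm (1 / (1 + linForm k z ^ 2)) z k v v := by
  have h := linFormDeriv_sq_le hk z v
  have hp : 0 < 1 + linForm k z ^ 2 := by positivity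
  rw [tangentForm, real_inner_self_eq_norm_sq]
  set a := ‖v‖ ^ 2 / z.im ^ 2
  set l := linForm k z
  set p := linFormDeriv k z v
  have e : a * (1 / (1 + l ^ 2)) - p * p * (1 / (1 + l ^ 2)) ^ 2 =
      (a * (1 + l ^ 2) - p ^ 2) * (1 / (1 + l ^ 2)) ^ 2 := by
    field_simp
  rw [e]
  gcongr
  nlinarith

theorem tangentForm_self_nonneg {k : ℝ × ℝ × ℝ} (hk : IsCausal k) (z : ℍ) (v : ℂ) :
    0 ≤ tangentForm (1 / (1 + linForm k z ^ 2)) z k v v :=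
  le_trans (by positivity) (le_tangentForm_self hk z v)

/-- Cauchy–Schwarz inequality: the planes tangent to the graph are spacelike. -/
theorem tangentForm_le_sqrt_mul_sqrt {k : ℝ × ℝ × ℝ} (hk : IsCausal k) (z : ℍ) (v w : ℂ) :
    tangentForm (1 / (1 + linForm k z ^ 2)) z k v w ≤
      √(tangentForm (1 / (1 + linForm k z ^ 2)) z k w w) *
        √(tangentForm (1 / (1 + linForm k z ^ 2)) z k v v) := by
  have h := discrim_le_zero fun t => (tangentForm_self_nonneg hk z (v + t • w)).trans_eq
    (tangentForm_add_smul _ z k v w t)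
  rw [discrim] at h
  rw [← Real.sqrt_mul (tangentForm_self_nonneg hk z w)]
  refine Real.le_sqrt_of_sq_le ?_
  linarith

theorem Admissible.speed_eq_sqrt_tangentForm (hu : Admissible T u) {c : ℝ → ℍ} {t : ℝ}
    {k : ℝ × ℝ × ℝ} (hk : IsSupport (fun z => Real.tan (u z)) (c t) k)
    (hc : DifferentiableAt ℝ (fun s => (c s : ℂ)) t)
    (h : DifferentiableAt ℝ (fun s => Real.tan (u (c s))) t) :
    speed u c t = √(tangentForm (1 / (1 + linForm k (c t) ^ 2)) (c t) k
      (deriv (fun s => (c s : ℂ)) t) (deriv (fun s => (c s : ℂ)) t)) := by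
  rw [hu.speed_eq h, hk.deriv_eq hc h, tangentForm, real_inner_self_eq_norm_sq, ← hk.eq, hypSpeed]
  congr 1
  ring

theorem continuous_linForm : Continuous fun p : (ℝ × ℝ × ℝ) × ℍ => linForm p.1 p.2 := by
  have h1 : Continuous fun p : (ℝ × ℝ × ℝ) × ℍ => p.2.re :=
    UpperHalfPlane.continuous_re.comp continuous_snd
  have h2 : Continuous fun p : (ℝ × ℝ × ℝ) × ℍ => p.2.im :=
    UpperHalfPlane.continuous_im.comp continuous_snd
  unfold linForm
  exact Continuous.div (by fun_prop) h2 fun p => p.2.im_pos.ne'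

theorem continuous_linFormDeriv :
    Continuous fun p : (ℝ × ℝ × ℝ) × ℍ × ℂ => linFormDeriv p.1 p.2.1 p.2.2 := by
  have h1 : Continuous fun p : (ℝ × ℝ × ℝ) × ℍ × ℂ => p.2.1.re :=
    UpperHalfPlane.continuous_re.comp (continuous_fst.comp continuous_snd)
  have h2 : Continuous fun p : (ℝ × ℝ × ℝ) × ℍ × ℂ => p.2.1.im :=
    UpperHalfPlane.continuous_im.comp (continuous_fst.comp continuous_snd)
  have h3 : Continuous fun p : (ℝ × ℝ × ℝ) × ℍ × ℂ => p.2.2.re :=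
    Complex.continuous_re.comp (continuous_snd.comp continuous_snd)
  have h4 : Continuous fun p : (ℝ × ℝ × ℝ) × ℍ × ℂ => p.2.2.im :=
    Complex.continuous_im.comp (continuous_snd.comp continuous_snd)
  unfold linFormDeriv
  refine Continuous.sub (Continuous.div (by fun_prop) h2 fun p => p.2.1.im_pos.ne')
    (Continuous.div (by fun_prop) (h2.pow 2) fun p => pow_ne_zero 2 p.2.1.im_pos.ne')

/-- The coefficients of a causal linear form are controlled by its value at one point. -/
theorem IsCausal.norm_le {k : ℝ × ℝ × ℝ} (hk : IsCausal k) (z : ℍ) :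
    ‖k‖ ≤ linForm k z * ((z.re ^ 2 + z.im ^ 2 + 1) / z.im) := by
  obtain ⟨A, B, C⟩ := k
  obtain ⟨hA, hC, hd⟩ := hk
  simp only at hA hC hd
  have hy := z.im_pos
  simp only [linForm]
  set x := z.re
  set y := z.im
  set s := x ^ 2 + y ^ 2 with hs
  have hs0 : 0 < s := by positivity
  -- a quadratic form with nonpositive discriminant is nonnegative
  have quad : ∀ p q : ℝ, 0 ≤ A * p ^ 2 + B * p * q + C * q ^ 2 := by
    intro p q
    rcases hA.eq_or_lt with rfl | hA
    · have : B = 0 := by nlinarith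
      subst this
      nlinarith [mul_nonneg hC (sq_nonneg q)]
    · have : 0 ≤ 4 * A * (A * p ^ 2 + B * p * q + C * q ^ 2) := by
        nlinarith [sq_nonneg (2 * A * p + B * q), mul_nonneg (sub_nonneg.2 hd) (sq_nonneg q)]
      exact nonneg_of_mul_nonneg_right this (by positivity)
  have h1 : C * y ^ 2 ≤ A + B * x + C * s := by nlinarith [quad 1 x]
  have h2 : A * y ^ 2 ≤ (A + B * x + C * s) * s := by nlinarith [quad x s]
  have h3 : A + C ≤ (A + B * x + C * s) / y * ((s + 1) / y) := by
    rw [div_mul_div_comm, le_div_iff₀ (by positivity)]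
    nlinarith
  have hB : |B| ≤ A + C := abs_le_of_sq_le_sq (by nlinarith [sq_nonneg (A - C)]) (by linarith)
  refine le_trans ?_ h3
  simp only [Prod.norm_def, Real.norm_eq_abs, abs_of_nonneg hA, abs_of_nonneg hC]
  exact max_le (by linarith) (max_le hB (by linarith))

/-- By homogeneity, a violation of an inequality between a linear form on tangent vectors and the
norm of the tangent planes is achieved on a unit vector. -/
theorem exists_unit_of_not_calibrated {U : ℍ → ℝ} {z : ℍ} {w : ℂ} {y m q C : ℝ}
    (h : ¬ ∀ k, IsSupport U z k → ∀ v, inner ℝ v w / y * m - linFormDeriv k z v * q * m ^ 2 ≤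
      C * √(tangentForm (1 / (1 + linForm k z ^ 2)) z k v v)) :
    ∃ k v, IsSupport U z k ∧ ‖v‖ = 1 ∧ C * √(tangentForm (1 / (1 + linForm k z ^ 2)) z k v v) ≤
      inner ℝ v w / y * m - linFormDeriv k z v * q * m ^ 2 := by
  push Not at h
  obtain ⟨k, hk, v, hv⟩ := h
  have e0 : linFormDeriv k z 0 = 0 := by simp [linFormDeriv]
  have hv0 : v ≠ 0 := by
    rintro rfl
    simp [e0, tangentForm] at hv
  have hn : 0 < ‖v‖ := norm_pos_iff.2 hv0
  have e1 : linFormDeriv k z (‖v‖⁻¹ • v) = ‖v‖⁻¹ * linFormDeriv k z v := by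
    have := linFormDeriv_add_smul k z 0 v ‖v‖⁻¹
    rwa [e0, zero_add, zero_add] at this
  have e2 : tangentForm (1 / (1 + linForm k z ^ 2)) z k (‖v‖⁻¹ • v) (‖v‖⁻¹ • v) =
      ‖v‖⁻¹ ^ 2 * tangentForm (1 / (1 + linForm k z ^ 2)) z k v v := by
    rw [tangentForm, tangentForm, e1, real_inner_smul_left, real_inner_smul_right]
    ring
  refine ⟨k, ‖v‖⁻¹ • v, hk, ?_, ?_⟩
  · rw [norm_smul, norm_inv, norm_norm, inv_mul_cancel₀ hn.ne']
  · rw [e1, e2, real_inner_smul_left, Real.sqrt_mul (sq_nonneg _), Real.sqrt_sq (inv_nonneg.2 hn.le)]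
    have := mul_le_mul_of_nonneg_left hv.le (inv_nonneg.2 hn.le)
    calc _ = ‖v‖⁻¹ * (C * √(tangentForm (1 / (1 + linForm k z ^ 2)) z k v v)) := by ring
      _ ≤ _ := this
      _ = _ := by ring

end TangentForm

/-! ### Limits of C-convex functions -/

section Limits

open MeasureTheory Set

/-- Pointwise convergence of uniformly bounded admissible functions. -/
structure AdmissibleLimit (T : ℝ) (un : ℕ → ℍ → ℝ) (u : ℍ → ℝ) : Prop where
  seq : ∀ n, Admissible T (un n)
  lim : Admissible T u
  tendsto : ∀ z, Tendsto (fun n => un n z) atTop (𝓝 (u z))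

variable {T : ℝ} {un : ℕ → ℍ → ℝ} {u : ℍ → ℝ}

namespace AdmissibleLimit

variable (H : AdmissibleLimit T un u)
include H

theorem tendsto_tan (z : ℍ) : Tendsto (fun n => Real.tan (un n z)) atTop (𝓝 (Real.tan (u z))) :=
  (Real.continuousAt_tan.2 (H.lim.cos_pos z).ne').tendsto.comp (H.tendsto z)

theorem tendsto_tan_of_tendsto {ι : Type*} {l : Filter ι} {N : ι → ℕ} {z : ι → ℍ} {z₀ : ℍ}
    (hN : Tendsto N l atTop) (hz : Tendsto z l (𝓝 z₀)) :
    Tendsto (fun i => Real.tan (un (N i) (z i))) l (𝓝 (Real.tan (u z₀))) := by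
  have h1 := (H.tendsto_tan z₀).comp hN
  have h2 : Tendsto (fun i => 2 * T * dist (z i) z₀) l (𝓝 0) := by
    simpa using (tendsto_iff_dist_tendsto_zero.1 hz).const_mul (2 * T)
  have h3 : Tendsto (fun i => Real.tan (un (N i) (z i)) - Real.tan (un (N i) z₀)) l (𝓝 0) := by
    refine squeeze_zero_norm (fun i => ?_) h2
    have := (H.seq (N i)).lipschitzWith_tan.dist_le_mul (z i) z₀
    rwa [Real.coe_toNNReal _ (by linarith [H.lim.bound_nonneg]), Real.dist_eq] at this
  have := h1.add h3
  rw [add_zero] at this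
  exact this.congr fun i => by simp

/-- Limits of support functions are support functions. -/
theorem exists_tendsto_support {ι : Type*} {𝒱 : Ultrafilter ι} {N : ι → ℕ} {z : ι → ℍ} {z₀ : ℍ}
    {k : ι → ℝ × ℝ × ℝ} (hN : Tendsto N 𝒱 atTop) (hz : Tendsto z 𝒱 (𝓝 z₀))
    (hk : ∀ᶠ i in 𝒱, IsSupport (fun w => Real.tan (un (N i) w)) (z i) (k i)) :
    ∃ k₀, Tendsto k 𝒱 (𝓝 k₀) ∧ IsSupport (fun w => Real.tan (u w)) z₀ k₀ := by
  obtain ⟨M, hM⟩ : ∃ M : ℝ, ∀ᶠ i in 𝒱, ‖k i‖ ≤ M := by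
    have hg : Tendsto (fun i => ((z i).re ^ 2 + (z i).im ^ 2 + 1) / (z i).im) 𝒱
        (𝓝 ((z₀.re ^ 2 + z₀.im ^ 2 + 1) / z₀.im)) := by
      have h1 := (UpperHalfPlane.continuous_re.tendsto z₀).comp hz
      have h2 := (UpperHalfPlane.continuous_im.tendsto z₀).comp hz
      exact (((h1.pow 2).add (h2.pow 2)).add_const 1).div h2 z₀.im_pos.ne'
    refine ⟨T * ((z₀.re ^ 2 + z₀.im ^ 2 + 1) / z₀.im + 1), ?_⟩
    filter_upwards [hk, hg.eventually (Iio_mem_nhds (lt_add_one _))] with i hi h2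
    refine (hi.causal.norm_le (z i)).trans ?_
    rw [← hi.eq]
    have := (z i).im_pos
    exact mul_le_mul ((H.seq _).tan_le _) (le_of_lt h2) (by positivity) H.lim.bound_nonneg
  obtain ⟨k₀, -, hk₀⟩ := (isCompact_closedBall (0 : ℝ × ℝ × ℝ) M).ultrafilter_le_nhds (𝒱.map k) (by
    rw [Ultrafilter.coe_map, le_principal_iff, mem_map]
    filter_upwards [hM] with i hi
    simpa using hi)
  have hk₀ : Tendsto k 𝒱 (𝓝 k₀) := hk₀
  refine ⟨k₀, hk₀, ⟨?_, ?_, ?_⟩, ?_, ?_⟩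
  · exact ge_of_tendsto (continuous_fst.tendsto k₀ |>.comp hk₀) (hk.mono fun i hi => hi.causal.fst)
  · exact ge_of_tendsto ((continuous_snd.comp continuous_snd).tendsto k₀ |>.comp hk₀)
      (hk.mono fun i hi => hi.causal.trd)
  · have h1 := (continuous_fst.comp continuous_snd).tendsto k₀ |>.comp hk₀
    have h2 := continuous_fst.tendsto k₀ |>.comp hk₀
    have h3 := (continuous_snd.comp continuous_snd).tendsto k₀ |>.comp hk₀
    exact le_of_tendsto_of_tendsto (h1.pow 2) ((h2.const_mul 4).mul h3)
      (hk.mono fun i hi => hi.causal.disc)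
  · refine tendsto_nhds_unique_of_eventuallyEq (H.tendsto_tan_of_tendsto hN hz)
      ((continuous_linForm.tendsto (k₀, z₀)).comp (hk₀.prodMk_nhds hz)) (hk.mono fun i hi => hi.eq)
  · intro w
    exact le_of_tendsto_of_tendsto ((H.tendsto_tan w).comp hN)
      ((continuous_linForm.tendsto (k₀, w)).comp (hk₀.prodMk_nhds tendsto_const_nhds))
      (hk.mono fun i hi => hi.le w)

/-- Derivatives along a fixed curve converge. -/
theorem tendsto_deriv {c : ℝ → ℍ} {t : ℝ} (hc : DifferentiableAt ℝ (fun s => (c s : ℂ)) t)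
    (hn : ∀ n, DifferentiableAt ℝ (fun s => Real.tan (un n (c s))) t)
    (h : DifferentiableAt ℝ (fun s => Real.tan (u (c s))) t) :
    Tendsto (fun n => deriv (fun s => Real.tan (un n (c s))) t) atTop
      (𝓝 (deriv (fun s => Real.tan (u (c s))) t)) := by
  choose k hk using fun n => (H.seq n).support (c t)
  rw [tendsto_iff_ultrafilter]
  intro 𝒰 h𝒰
  obtain ⟨k₀, hk₀, hs⟩ := H.exists_tendsto_support (N := fun n => n) (z := fun _ => c t) (𝒱 := 𝒰)
    h𝒰 tendsto_const_nhds (Eventually.of_forall hk)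
  rw [hs.deriv_eq hc h]
  have h1 := (continuous_linFormDeriv.tendsto (k₀, c t, deriv (fun s => (c s : ℂ)) t)).comp
    (hk₀.prodMk_nhds tendsto_const_nhds)
  exact h1.congr fun n => ((hk n).deriv_eq hc (hn n)).symm

/-- The length of a fixed curve is continuous in `u`, by dominated convergence. -/
theorem tendsto_length {c : ℝ → ℍ} {K : NNReal} (hc : LipschitzWith K c) :
    Tendsto (fun n => length (un n) c) atTop (𝓝 (length u c)) := by
  simp only [length_eq_integral_speed]
  refine intervalIntegral.tendsto_integral_filter_of_dominated_convergence (fun _ => (K : ℝ))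
    (Eventually.of_forall fun n => ((H.seq n).measurable_speed hc).aestronglyMeasurable)
    (Eventually.of_forall fun n => (ae_speed_le (un n) hc).mono fun t ht _ => ht)
    intervalIntegrable_const ?_
  filter_upwards [ae_differentiableAt_coe_curve hc, H.lim.ae_differentiableAt hc,
    ae_all_iff.2 fun n => (H.seq n).ae_differentiableAt hc] with t h1 h2 h3 _
  have h4 := H.tendsto_deriv h1 h3 h2
  have h5 := H.tendsto_tan (c t)
  rw [H.lim.speed_eq h2]
  have h6 : Tendsto (fun n => 1 + Real.tan (un n (c t)) ^ 2) atTop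
      (𝓝 (1 + Real.tan (u (c t)) ^ 2)) := (h5.pow 2).const_add 1
  have hne : 1 + Real.tan (u (c t)) ^ 2 ≠ 0 := by positivity
  have h7 := ((tendsto_const_nhds (x := hypSpeed c t ^ 2)).div h6 hne).sub ((h4.div h6 hne).pow 2)
  exact (h7.sqrt).congr fun n => ((H.seq n).speed_eq (h3 n)).symm

theorem eventually_inducedDist_lt {x y : ℍ} {D : ℝ} (hD : inducedDist u x y < D) :
    ∀ᶠ n in atTop, inducedDist (un n) x y < D := by
  obtain ⟨K, c, hc, rfl, rfl, hl⟩ := exists_curve_of_inducedDist_lt hD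
  filter_upwards [(H.tendsto_length hc).eventually (Iio_mem_nhds hl)] with n hn
  exact (inducedDist_le_length _ hc).trans_lt hn

/-- Calibration: if all the planes tangent to the limit graph above `z₀` contain the vector
`(w, q)`, then the product with `(w, q)` is almost bounded by the norm on all nearby tangent
planes of the graphs which converge to it. -/
theorem eventually_calibration {z₀ : ℍ} {w : ℂ} {q : ℝ}
    (hq : ∀ k, IsSupport (fun z => Real.tan (u z)) z₀ k → linFormDeriv k z₀ w = q)
    {m₀ : ℝ} (hm₀ : m₀ = 1 / (1 + Real.tan (u z₀) ^ 2)) {ε : ℝ} (hε : 0 < ε) :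
    ∀ᶠ p : ℕ × ℍ in atTop ×ˢ 𝓝 z₀, ∀ k, IsSupport (fun z => Real.tan (un p.1 z)) p.2 k → ∀ v,
      inner ℝ v w / z₀.im ^ 2 * m₀ - linFormDeriv k p.2 v * q * m₀ ^ 2 ≤
        (√(‖w‖ ^ 2 / z₀.im ^ 2 * m₀ - q ^ 2 * m₀ ^ 2) + ε) *
          √(tangentForm (1 / (1 + linForm k p.2 ^ 2)) p.2 k v v) := by
  obtain ⟨Q₀, hQ₀⟩ : ∃ Q, Q = ‖w‖ ^ 2 / z₀.im ^ 2 * m₀ - q ^ 2 * m₀ ^ 2 := ⟨_, rfl⟩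
  obtain ⟨P, hP⟩ : ∃ P : ℕ × ℍ → Prop, ∀ p, P p ↔
    ∀ k, IsSupport (fun z => Real.tan (un p.1 z)) p.2 k → ∀ v,
      inner ℝ v w / z₀.im ^ 2 * m₀ - linFormDeriv k p.2 v * q * m₀ ^ 2 ≤
      (√Q₀ + ε) * √(tangentForm (1 / (1 + linForm k p.2 ^ 2)) p.2 k v v) := ⟨_, fun p => Iff.rfl⟩
  rw [← hQ₀]
  simp only [← hP]
  by_contra hcon
  have hex : ∀ p : ℕ × ℍ, ∃ (k : ℝ × ℝ × ℝ) (v : ℂ), ¬ P p →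
      IsSupport (fun z => Real.tan (un p.1 z)) p.2 k ∧ ‖v‖ = 1 ∧
      (√Q₀ + ε) * √(tangentForm (1 / (1 + linForm k p.2 ^ 2)) p.2 k v v) ≤
      inner ℝ v w / z₀.im ^ 2 * m₀ - linFormDeriv k p.2 v * q * m₀ ^ 2 := by
    intro p
    by_cases hp : P p
    · exact ⟨0, 0, fun h => absurd hp h⟩
    · obtain ⟨k, v, hkv⟩ := exists_unit_of_not_calibrated (mt (hP p).2 hp)
      exact ⟨k, v, fun _ => hkv⟩
  choose k v hkv using hex
  have hne : (atTop ×ˢ 𝓝 z₀ ⊓ 𝓟 {p | ¬ P p}).NeBot :=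
    frequently_iff_neBot.1 (not_eventually.1 hcon)
  obtain ⟨𝒱, hle⟩ := Ultrafilter.exists_le (atTop ×ˢ 𝓝 z₀ ⊓ 𝓟 {p | ¬ P p})
  have hF : (𝒱 : Filter (ℕ × ℍ)) ≤ atTop ×ˢ 𝓝 z₀ := hle.trans inf_le_left
  have hbad := le_principal_iff.1 (hle.trans inf_le_right)
  have hN : Tendsto (fun p : ℕ × ℍ => p.1) 𝒱 atTop := tendsto_fst.mono_left hF
  have hz : Tendsto (fun p : ℕ × ℍ => p.2) 𝒱 (𝓝 z₀) := tendsto_snd.mono_left hF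
  have hall : ∀ᶠ p in (𝒱 : Filter (ℕ × ℍ)),
      IsSupport (fun z => Real.tan (un p.1 z)) p.2 (k p) ∧ ‖v p‖ = 1 ∧
      (√Q₀ + ε) * √(tangentForm (1 / (1 + linForm (k p) p.2 ^ 2)) p.2 (k p) (v p) (v p)) ≤
      inner ℝ (v p) w / z₀.im ^ 2 * m₀ - linFormDeriv (k p) p.2 (v p) * q * m₀ ^ 2 :=
    mem_of_superset hbad fun p hp => hkv p hp
  obtain ⟨k₀, hk₀, hs⟩ := H.exists_tendsto_support hN hz (hall.mono fun p hp => hp.1)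
  have hunit : ∀ᶠ p in (𝒱 : Filter (ℕ × ℍ)), ‖v p‖ = 1 := hall.mono fun p hp => hp.2.1
  obtain ⟨v₀, hv₀mem, hv₀⟩ := (isCompact_sphere (0 : ℂ) 1).ultrafilter_le_nhds (𝒱.map v) (by
    rw [Ultrafilter.coe_map, le_principal_iff, mem_map]
    filter_upwards [hunit] with i hi
    simpa using hi)
  have hv₀ : Tendsto v 𝒱 (𝓝 v₀) := hv₀
  have hd : Tendsto (fun p : ℕ × ℍ => linFormDeriv (k p) p.2 (v p)) 𝒱
      (𝓝 (linFormDeriv k₀ z₀ v₀)) := by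
    have h1 : Tendsto (fun p : ℕ × ℍ => (p.2, v p)) 𝒱 (𝓝 (z₀, v₀)) := hz.prodMk_nhds hv₀
    have h2 : Tendsto (fun p : ℕ × ℍ => (k p, p.2, v p)) 𝒱 (𝓝 (k₀, z₀, v₀)) :=
      hk₀.prodMk_nhds h1
    have h3 := (continuous_linFormDeriv.tendsto (k₀, z₀, v₀)).comp h2
    exact h3
  have hl : Tendsto (fun p : ℕ × ℍ => linForm (k p) p.2) 𝒱 (𝓝 (linForm k₀ z₀)) := by
    have h1 := (continuous_linForm.tendsto (k₀, z₀)).comp (hk₀.prodMk_nhds hz)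
    exact h1
  have hne1 : 1 + linForm k₀ z₀ ^ 2 ≠ 0 := by positivity
  have hm : Tendsto (fun p : ℕ × ℍ => 1 / (1 + linForm (k p) p.2 ^ 2)) 𝒱
      (𝓝 (1 / (1 + linForm k₀ z₀ ^ 2))) :=
    Tendsto.div tendsto_const_nhds ((hl.pow 2).const_add 1) hne1
  have him : Tendsto (fun p : ℕ × ℍ => p.2.im ^ 2) 𝒱 (𝓝 (z₀.im ^ 2)) :=
    ((UpperHalfPlane.continuous_im.tendsto z₀).comp hz).pow 2
  have him0 : z₀.im ^ 2 ≠ 0 := pow_ne_zero 2 z₀.im_pos.ne'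
  have hQ : Tendsto (fun p : ℕ × ℍ => tangentForm (1 / (1 + linForm (k p) p.2 ^ 2)) p.2 (k p)
      (v p) (v p)) 𝒱 (𝓝 (tangentForm (1 / (1 + linForm k₀ z₀ ^ 2)) z₀ k₀ v₀ v₀)) := by
    unfold tangentForm
    exact (((hv₀.inner hv₀).div him him0).mul hm).sub ((hd.mul hd).mul (hm.pow 2))
  have hL : Tendsto (fun p : ℕ × ℍ => (√Q₀ + ε) *
      √(tangentForm (1 / (1 + linForm (k p) p.2 ^ 2)) p.2 (k p) (v p) (v p))) 𝒱
      (𝓝 ((√Q₀ + ε) * √(tangentForm (1 / (1 + linForm k₀ z₀ ^ 2)) z₀ k₀ v₀ v₀))) :=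
    hQ.sqrt.const_mul _
  have hR : Tendsto (fun p : ℕ × ℍ => inner ℝ (v p) w / z₀.im ^ 2 * m₀ -
      linFormDeriv (k p) p.2 (v p) * q * m₀ ^ 2) 𝒱
      (𝓝 (inner ℝ v₀ w / z₀.im ^ 2 * m₀ - linFormDeriv k₀ z₀ v₀ * q * m₀ ^ 2)) :=
    (((hv₀.inner tendsto_const_nhds).div_const _).mul_const _).sub
      ((hd.mul_const _).mul_const _)
  have hlimit := le_of_tendsto_of_tendsto hL hR (hall.mono fun p hp => hp.2.2)
  have hqk := hq k₀ hs
  have hmk : m₀ = 1 / (1 + linForm k₀ z₀ ^ 2) := by rw [hm₀, ← hs.eq]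
  have hcs := tangentForm_le_sqrt_mul_sqrt hs.causal z₀ v₀ w
  have hpos : 0 < tangentForm (1 / (1 + linForm k₀ z₀ ^ 2)) z₀ k₀ v₀ v₀ := by
    have h1 := le_tangentForm_self hs.causal z₀ v₀
    have h2 : ‖v₀‖ = 1 := by simpa using hv₀mem
    have h3 := z₀.im_pos
    rw [h2] at h1
    have h4 : 0 < 1 ^ 2 / z₀.im ^ 2 * (1 / (1 + linForm k₀ z₀ ^ 2)) ^ 2 := by positivity
    exact h4.trans_le h1
  rw [← hmk] at hcs hlimit hpos
  have e1 : tangentForm m₀ z₀ k₀ v₀ w =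
      inner ℝ v₀ w / z₀.im ^ 2 * m₀ - linFormDeriv k₀ z₀ v₀ * q * m₀ ^ 2 := by
    rw [tangentForm, hqk]
  have e2 : tangentForm m₀ z₀ k₀ w w = Q₀ := by
    rw [hQ₀, tangentForm, hqk, real_inner_self_eq_norm_sq]; ring
  rw [e1, e2] at hcs
  have := mul_pos hε (Real.sqrt_pos.2 hpos)
  linarith

/-- The calibration inequality, integrated along short curves. -/
theorem exists_integrated_calibration {z₀ : ℍ} {w : ℂ} {q : ℝ}
    (hq : ∀ k, IsSupport (fun z => Real.tan (u z)) z₀ k → linFormDeriv k z₀ w = q)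
    {m₀ : ℝ} (hm₀ : m₀ = 1 / (1 + Real.tan (u z₀) ^ 2)) {ε : ℝ} (hε : 0 < ε) :
    ∃ r > 0, ∀ᶠ n in atTop, ∀ a b : ℍ, dist a z₀ < r → inducedDist (un n) a b < r →
      inner ℝ ((b : ℂ) - a) w / z₀.im ^ 2 * m₀ -
        (Real.tan (un n b) - Real.tan (un n a)) * q * m₀ ^ 2 ≤
      (√(‖w‖ ^ 2 / z₀.im ^ 2 * m₀ - q ^ 2 * m₀ ^ 2) + ε) * inducedDist (un n) a b := by
  obtain ⟨S, hS, V, hV, hSV⟩ := mem_prod_iff.1 (H.eventually_calibration hq hm₀ hε)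
  obtain ⟨ρ, hρ, hball⟩ := Metric.mem_nhds_iff.1 hV
  have hp : 0 < 2 + T ^ 2 := by positivity
  refine ⟨ρ / (2 + T ^ 2), by positivity, ?_⟩
  filter_upwards [hS] with n hn a b ha hab
  set C := √(‖w‖ ^ 2 / z₀.im ^ 2 * m₀ - q ^ 2 * m₀ ^ 2) + ε with hC
  have hC0 : 0 < C := by positivity
  by_contra hcon
  push Not at hcon
  rw [← lt_div_iff₀' hC0] at hcon
  obtain ⟨K, c, hc, rfl, rfl, hl⟩ := exists_curve_of_inducedDist_lt (lt_min hcon hab)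
  have hl1 := hl.trans_le (min_le_left _ _)
  have hl2 := hl.trans_le (min_le_right _ _)
  rw [lt_div_iff₀' hC0] at hl1
  refine hl1.not_ge ?_
  have hmem : ∀ t ∈ Icc (0 : ℝ) 1, c t ∈ Metric.ball z₀ ρ := by
    intro t ht
    have h1 := (H.seq n).dist_le_mul_length hc ht
    rw [Metric.mem_ball]
    calc dist (c t) z₀ ≤ dist (c 0) (c t) + dist (c 0) z₀ := dist_triangle_left _ _ _
      _ < (1 + T ^ 2) * (ρ / (2 + T ^ 2)) + ρ / (2 + T ^ 2) := by
          refine add_lt_add_of_le_of_lt (h1.trans ?_) ha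
          gcongr
      _ = ρ := by field_simp; ring
  obtain ⟨i1, i2⟩ := integral_inner_deriv hc 0 1 w
  have hUl := (H.seq n).lipschitzWith_tan.comp hc
  have i3 := integral_deriv_of_lipschitz hUl 0 1
  have i4 : IntervalIntegrable (deriv ((fun z => Real.tan (un n z)) ∘ c)) volume 0 1 :=
    (hUl.lipschitzOnWith (s := uIcc 0 1)).absolutelyContinuousOnInterval.intervalIntegrable_deriv
  have hae : ∀ᵐ t : ℝ, t ∈ Icc (0 : ℝ) 1 →
      inner ℝ (deriv (fun s => (c s : ℂ)) t) w / z₀.im ^ 2 * m₀ -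
        deriv ((fun z => Real.tan (un n z)) ∘ c) t * q * m₀ ^ 2 ≤ C * speed (un n) c t := by
    filter_upwards [ae_differentiableAt_coe_curve hc, (H.seq n).ae_differentiableAt hc]
      with t h1 h2 ht
    obtain ⟨k, hk⟩ := (H.seq n).support (c t)
    rw [(H.seq n).speed_eq_sqrt_tangentForm hk h1 h2]
    have e := hk.deriv_eq h1 h2
    change deriv ((fun z => Real.tan (un n z)) ∘ c) t = _ at e
    rw [e]
    exact hSV (mk_mem_prod hn (hball (hmem t ht))) k hk _
  have hmono := intervalIntegral.integral_mono_ae_restrict (μ := volume) zero_le_one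
    (((i1.div_const (z₀.im ^ 2)).mul_const m₀).sub ((i4.mul_const q).mul_const (m₀ ^ 2)))
    (((H.seq n).intervalIntegrable_speed hc 0 1).const_mul C)
    ((ae_restrict_iff' measurableSet_Icc).2 hae)
  rw [intervalIntegral.integral_sub ((i1.div_const (z₀.im ^ 2)).mul_const m₀)
    ((i4.mul_const q).mul_const (m₀ ^ 2)), intervalIntegral.integral_mul_const,
    intervalIntegral.integral_div, i2, intervalIntegral.integral_mul_const,
    intervalIntegral.integral_mul_const, i3, intervalIntegral.integral_const_mul,
    ← length_eq_integral_speed] at hmono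
  exact hmono

end AdmissibleLimit

end Limits

/-! ### Convergence of the induced distances -/

section Convergence

open MeasureTheory Set

variable {T : ℝ} {un : ℕ → ℍ → ℝ} {u : ℍ → ℝ}

/-- Two points at induced distance less than `D` are joined by a path which is `D`-Lipschitz for
the induced distance: a curve of length less than `D`, parametrized proportionally to its length. -/
theorem Admissible.exists_path (hu : Admissible T u) {x y : ℍ} {D : ℝ}
    (h : inducedDist u x y < D) : ∃ p : ℝ → ℍ, p 0 = x ∧ p 1 = y ∧
      ∀ s ∈ Icc (0 : ℝ) 1, ∀ t ∈ Icc (0 : ℝ) 1, inducedDist u (p s) (p t) ≤ D * |s - t| := by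
  obtain ⟨K, c, hc, rfl, rfl, hl⟩ := exists_curve_of_inducedDist_lt h
  set S : ℝ → ℝ := fun t => ∫ τ in (0 : ℝ)..t, speed u c τ with hS
  have hScont : Continuous S :=
    intervalIntegral.continuous_primitive (fun a b => hu.intervalIntegrable_speed hc a b) 0
  have hS0 : S 0 = 0 := by simp [hS]
  have hS1 : S 1 = length u c := rfl
  have hd : ∀ a b, inducedDist u (c a) (c b) ≤ |S a - S b| := by
    intro a b
    refine (inducedDist_le_abs_integral u hc a b).trans_eq ?_
    rw [← intervalIntegral.integral_interval_sub_left (hu.intervalIntegrable_speed hc 0 b)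
      (hu.intervalIntegrable_speed hc 0 a), abs_sub_comm]
  have hivt : ∀ s ∈ Icc (0 : ℝ) 1, ∃ t, S t = s * length u c := by
    intro s hs
    have := intermediate_value_Icc zero_le_one hScont.continuousOn (a := (0 : ℝ)) (b := 1)
    rw [hS0, hS1] at this
    obtain ⟨t, -, ht⟩ := this ⟨mul_nonneg hs.1 (length_nonneg u c),
      mul_le_of_le_one_left (length_nonneg u c) hs.2⟩
    exact ⟨t, ht⟩
  choose! τ hτ using hivt
  have hend : ∀ a, ∀ s ∈ Icc (0 : ℝ) 1, S a = s * length u c → c (τ s) = c a := by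
    intro a s hs ha
    have := hd (τ s) a
    rw [hτ s hs, ha, sub_self, abs_zero] at this
    exact (hu.inducedDist_eq_zero_iff _ _).1 (le_antisymm this (inducedDist_nonneg u _ _))
  refine ⟨fun s => c (τ s), hend 0 0 ⟨le_rfl, zero_le_one⟩ (by rw [hS0, zero_mul]),
    hend 1 1 ⟨zero_le_one, le_rfl⟩ (by rw [hS1, one_mul]), fun s hs t ht => ?_⟩
  refine (hd _ _).trans ?_
  rw [hτ s hs, hτ t ht, ← sub_mul, abs_mul, abs_of_nonneg (length_nonneg u c), mul_comm]
  gcongr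

namespace AdmissibleLimit

variable (H : AdmissibleLimit T un u)
include H

/-- The speed of a limit of paths is at most their common speed. -/
theorem speed_le_of_limit {𝒰 : Ultrafilter ℕ} (h𝒰 : (𝒰 : Filter ℕ) ≤ atTop) {D : ℝ} (hD : 0 ≤ D)
    {p : ℕ → ℝ → ℍ} {γ : ℝ → ℍ}
    (hp : ∀ᶠ n in (𝒰 : Filter ℕ), ∀ s ∈ Icc (0 : ℝ) 1, ∀ t ∈ Icc (0 : ℝ) 1,
      inducedDist (un n) (p n s) (p n t) ≤ D * |s - t|)
    (hγ : ∀ s ∈ Icc (0 : ℝ) 1, Tendsto (fun n => p n s) 𝒰 (𝓝 (γ s))) {t : ℝ}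
    (ht : t ∈ Ioo (0 : ℝ) 1) (h1 : DifferentiableAt ℝ (fun s => (γ s : ℂ)) t)
    (h2 : DifferentiableAt ℝ (fun s => Real.tan (u (γ s))) t) : speed u γ t ≤ D := by
  obtain ⟨w, hw⟩ : ∃ w, w = deriv (fun s => (γ s : ℂ)) t := ⟨_, rfl⟩
  obtain ⟨q, hq⟩ : ∃ q, q = deriv (fun s => Real.tan (u (γ s))) t := ⟨_, rfl⟩
  obtain ⟨m, hm⟩ : ∃ m, m = 1 / (1 + Real.tan (u (γ t)) ^ 2) := ⟨_, rfl⟩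
  obtain ⟨Q, hQ⟩ : ∃ Q, Q = ‖w‖ ^ 2 / (γ t).im ^ 2 * m - q ^ 2 * m ^ 2 := ⟨_, rfl⟩
  have hspeed : speed u γ t = √Q := by
    rw [H.lim.speed_eq h2, ← hq, hypSpeed, ← hw, hQ, hm]
    congr 1
    ring
  have hQ0 : 0 ≤ Q := by
    obtain ⟨k, hk⟩ := H.lim.support (γ t)
    have h := tangentForm_self_nonneg hk.causal (γ t) w
    rw [tangentForm, ← hk.eq, ← hm, hw, ← hk.deriv_eq h1 h2, ← hq, ← hw,
      real_inner_self_eq_norm_sq] at h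
    rw [hQ]
    linarith
  have key : ∀ ε > 0, Q ≤ (√Q + ε) * D := by
    intro ε hε
    obtain ⟨r, hr, hcal⟩ := H.exists_integrated_calibration (z₀ := γ t) (w := w) (q := q)
      (fun k hk => by rw [hq, hw, hk.deriv_eq h1 h2]) hm hε
    rw [← hQ] at hcal
    have hsmall : ∀ᶠ s in 𝓝[>] t, inner ℝ ((γ s : ℂ) - γ t) w / (γ t).im ^ 2 * m -
        (Real.tan (u (γ s)) - Real.tan (u (γ t))) * q * m ^ 2 ≤ (√Q + ε) * (D * (s - t)) := by
      have e1 : ∀ᶠ s in 𝓝[>] t, s < 1 := nhdsWithin_le_nhds (Iio_mem_nhds ht.2)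
      have e2 : ∀ᶠ s in 𝓝[>] t, D * (s - t) < r := by
        have : Tendsto (fun s => D * (s - t)) (𝓝[>] t) (𝓝 (D * (t - t))) :=
          (Continuous.tendsto (by fun_prop) t).mono_left nhdsWithin_le_nhds
        rw [sub_self, mul_zero] at this
        exact this.eventually (Iio_mem_nhds hr)
      filter_upwards [e1, e2, self_mem_nhdsWithin] with s hs1 hs2 hs3
      have hs3 : t < s := hs3
      have htI : t ∈ Icc (0 : ℝ) 1 := ⟨ht.1.le, ht.2.le⟩
      have hsI : s ∈ Icc (0 : ℝ) 1 := ⟨ht.1.le.trans hs3.le, hs1.le⟩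
      have hlim1 := H.tendsto_tan_of_tendsto (l := (𝒰 : Filter ℕ)) (N := fun n => n) h𝒰 (hγ s hsI)
      have hlim2 := H.tendsto_tan_of_tendsto (l := (𝒰 : Filter ℕ)) (N := fun n => n) h𝒰 (hγ t htI)
      have hc1 := (continuous_coe.tendsto _).comp (hγ s hsI)
      have hc2 := (continuous_coe.tendsto _).comp (hγ t htI)
      have hlhs : Tendsto (fun n => inner ℝ ((p n s : ℂ) - p n t) w / (γ t).im ^ 2 * m -
          (Real.tan (un n (p n s)) - Real.tan (un n (p n t))) * q * m ^ 2) 𝒰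
          (𝓝 (inner ℝ ((γ s : ℂ) - γ t) w / (γ t).im ^ 2 * m -
            (Real.tan (u (γ s)) - Real.tan (u (γ t))) * q * m ^ 2)) :=
        ((((hc1.sub hc2).inner tendsto_const_nhds).div_const _).mul_const _).sub
          (((hlim1.sub hlim2).mul_const _).mul_const _)
      refine le_of_tendsto hlhs ?_
      filter_upwards [h𝒰 hcal, hp, (hγ t htI).eventually (Metric.ball_mem_nhds _ hr)]
        with n hn1 hn2 hn3
      have hb := hn2 t htI s hsI
      rw [abs_sub_comm, abs_of_pos (sub_pos.2 hs3)] at hb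
      refine (hn1 _ _ hn3 (hb.trans_lt hs2)).trans ?_
      gcongr
    have hd1 : Tendsto (fun s => inner ℝ ((s - t)⁻¹ • ((γ s : ℂ) - γ t)) w / (γ t).im ^ 2 * m -
        ((s - t)⁻¹ • (Real.tan (u (γ s)) - Real.tan (u (γ t)))) * q * m ^ 2) (𝓝[>] t)
        (𝓝 (inner ℝ w w / (γ t).im ^ 2 * m - q * q * m ^ 2)) := by
      have l1 := (hasDerivAt_iff_tendsto_slope.1 h1.hasDerivAt).mono_left
        (nhdsWithin_mono t (fun s (hs : t < s) => ne_of_gt hs))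
      have l2 := (hasDerivAt_iff_tendsto_slope.1 h2.hasDerivAt).mono_left
        (nhdsWithin_mono t (fun s (hs : t < s) => ne_of_gt hs))
      rw [← hw] at l1
      rw [← hq] at l2
      exact (((l1.inner tendsto_const_nhds).div_const _).mul_const _).sub
          ((l2.mul_const _).mul_const _)
    rw [real_inner_self_eq_norm_sq, ← pow_two, ← hQ] at hd1
    refine le_of_tendsto hd1 ?_
    filter_upwards [hsmall, self_mem_nhdsWithin] with s hs1 hs2
    have hpos : 0 < s - t := sub_pos.2 hs2
    rw [real_inner_smul_left, smul_eq_mul]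
    have := mul_le_mul_of_nonneg_left hs1 (inv_nonneg.2 hpos.le)
    calc _ = (s - t)⁻¹ * (inner ℝ ((γ s : ℂ) - γ t) w / (γ t).im ^ 2 * m -
        (Real.tan (u (γ s)) - Real.tan (u (γ t))) * q * m ^ 2) := by ring
      _ ≤ _ := this
      _ = _ := by field_simp
  rw [hspeed]
  have hle : Q ≤ √Q * D := by
    refine le_of_forall_pos_le_add fun δ hδ => ?_
    have := key (δ / (D + 1)) (by positivity)
    have h3 : δ / (D + 1) * D ≤ δ := by
      rw [div_mul_eq_mul_div, div_le_iff₀ (by positivity)]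
      nlinarith
    nlinarith
  rcases (Real.sqrt_nonneg Q).eq_or_lt with h0 | h0
  · rwa [← h0]
  · have := Real.mul_self_sqrt hQ0
    exact le_of_mul_le_mul_left (by linarith) h0

/-- Lower semicontinuity: almost minimizing curves, parametrized proportionally to their length,
accumulate at a Lipschitz curve which is not longer. -/
theorem eventually_le_inducedDist {x y : ℍ} {D : ℝ} (hD : D < inducedDist u x y) :
    ∀ᶠ n in atTop, D ≤ inducedDist (un n) x y := by
  by_contra hcon
  have hne : (atTop ⊓ 𝓟 {n | ¬ D ≤ inducedDist (un n) x y}).NeBot :=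
    frequently_iff_neBot.1 (not_eventually.1 hcon)
  obtain ⟨𝒰, hle⟩ := Ultrafilter.exists_le (atTop ⊓ 𝓟 {n | ¬ D ≤ inducedDist (un n) x y})
  have h𝒰 : (𝒰 : Filter ℕ) ≤ atTop := hle.trans inf_le_left
  have hbad : ∀ᶠ n in (𝒰 : Filter ℕ), ¬ D ≤ inducedDist (un n) x y :=
    le_principal_iff.1 (hle.trans inf_le_right)
  have hD0 : 0 ≤ D := by
    obtain ⟨n, hn⟩ := hbad.exists
    exact (inducedDist_nonneg _ _ _).trans (not_le.1 hn).le
  have hex : ∀ n, ∃ p : ℝ → ℍ, ¬ D ≤ inducedDist (un n) x y → p 0 = x ∧ p 1 = y ∧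
      ∀ s ∈ Icc (0 : ℝ) 1, ∀ t ∈ Icc (0 : ℝ) 1,
        inducedDist (un n) (p s) (p t) ≤ D * |s - t| := by
    intro n
    by_cases h : D ≤ inducedDist (un n) x y
    · exact ⟨fun _ => x, fun h' => absurd h h'⟩
    · obtain ⟨p, hp⟩ := (H.seq n).exists_path (not_le.1 h)
      exact ⟨p, fun _ => hp⟩
  choose p hp using hex
  have hlip : ∀ᶠ n in (𝒰 : Filter ℕ), ∀ s ∈ Icc (0 : ℝ) 1, ∀ t ∈ Icc (0 : ℝ) 1,
      dist (p n s) (p n t) ≤ (1 + T ^ 2) * (D * |s - t|) := by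
    filter_upwards [hbad] with n hn s hs t ht
    refine ((H.seq n).dist_le_mul_inducedDist _ _).trans ?_
    gcongr
    exact (hp n hn).2.2 s hs t ht
  have h0I : (0 : ℝ) ∈ Icc (0 : ℝ) 1 := ⟨le_rfl, zero_le_one⟩
  have h1I : (1 : ℝ) ∈ Icc (0 : ℝ) 1 := ⟨zero_le_one, le_rfl⟩
  have hlim : ∀ s : ℝ, ∃ z, s ∈ Icc (0 : ℝ) 1 → Tendsto (fun n => p n s) 𝒰 (𝓝 z) := by
    intro s
    by_cases hs : s ∈ Icc (0 : ℝ) 1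
    · obtain ⟨z, hz⟩ := exists_ultrafilter_lim 𝒰 (fun n => p n s) x ((1 + T ^ 2) * (D * 1)) (by
        filter_upwards [hlip, hbad] with n hn hn2
        have := hn 0 h0I s hs
        rw [(hp n hn2).1] at this
        refine this.trans ?_
        gcongr
        rw [zero_sub, abs_neg, abs_of_nonneg hs.1]
        exact hs.2)
      exact ⟨z, fun _ => hz⟩
    · exact ⟨x, fun h => absurd h hs⟩
  choose γ₀ hγ₀ using hlim
  set γ : ℝ → ℍ := fun s => γ₀ (projIcc 0 1 zero_le_one s) with hγdef
  have hγ : ∀ s ∈ Icc (0 : ℝ) 1, Tendsto (fun n => p n s) 𝒰 (𝓝 (γ s)) := by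
    intro s hs
    simp only [hγdef, projIcc_of_mem zero_le_one hs]
    exact hγ₀ s hs
  have hx : γ 0 = x := by
    refine tendsto_nhds_unique (hγ 0 h0I) (tendsto_const_nhds.congr' ?_)
    filter_upwards [hbad] with n hn using ((hp n hn).1).symm
  have hy : γ 1 = y := by
    refine tendsto_nhds_unique (hγ 1 h1I) (tendsto_const_nhds.congr' ?_)
    filter_upwards [hbad] with n hn using ((hp n hn).2.1).symm
  have hKnn : 0 ≤ (1 + T ^ 2) * D := by positivity
  have hγL : LipschitzWith ((1 + T ^ 2) * D).toNNReal γ := by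
    have h : LipschitzWith ((1 + T ^ 2) * D).toNNReal ((Icc (0 : ℝ) 1).domRestrict γ₀) := by
      refine LipschitzWith.of_dist_le_mul fun s t => ?_
      rw [Real.coe_toNNReal _ hKnn, Subtype.dist_eq, Real.dist_eq]
      refine le_of_tendsto ((hγ₀ s s.2).dist (hγ₀ t t.2)) ?_
      filter_upwards [hlip] with n hn
      exact (hn s s.2 t t.2).trans_eq (by ring)
    have := h.comp (LipschitzWith.projIcc (zero_le_one (α := ℝ)))
    rwa [mul_one] at this
  have hlen : length u γ ≤ D := by
    have hne1 : ∀ᵐ t : ℝ, t ≠ 1 := by simp [ae_iff]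
    have hne0 : ∀ᵐ t : ℝ, t ≠ 0 := by simp [ae_iff]
    have := intervalIntegral.integral_mono_ae_restrict (μ := volume) zero_le_one
      (H.lim.intervalIntegrable_speed hγL 0 1) (intervalIntegrable_const (c := D)) (by
        rw [Filter.EventuallyLE, ae_restrict_iff' measurableSet_Icc]
        filter_upwards [hne0, hne1, ae_differentiableAt_coe_curve hγL,
          H.lim.ae_differentiableAt hγL] with t ht0 ht1 hd1 hd2 ht
        exact H.speed_le_of_limit h𝒰 hD0 (hbad.mono fun n hn => (hp n hn).2.2) hγ
          ⟨lt_of_le_of_ne ht.1 ht0.symm, lt_of_le_of_ne ht.2 ht1⟩ hd1 hd2)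
    simpa [length_eq_integral_speed] using this
  have := inducedDist_le_length u hγL
  rw [hx, hy] at this
  linarith

theorem tendsto_inducedDist (x y : ℍ) :
    Tendsto (fun n => inducedDist (un n) x y) atTop (𝓝 (inducedDist u x y)) := by
  refine tendsto_order.2 ⟨fun a ha => ?_, fun a ha => H.eventually_inducedDist_lt ha⟩
  obtain ⟨b, hab, hb⟩ := exists_between ha
  filter_upwards [H.eventually_le_inducedDist hb] with n hn
  exact hab.trans_le hn

/-- The induced distances converge locally uniformly. -/
theorem tendsto_inducedDist_of_tendsto {ι : Type*} {l : Filter ι} {N : ι → ℕ} {x y : ι → ℍ}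
    {x₀ y₀ : ℍ} (hN : Tendsto N l atTop) (hx : Tendsto x l (𝓝 x₀)) (hy : Tendsto y l (𝓝 y₀)) :
    Tendsto (fun i => inducedDist (un (N i)) (x i) (y i)) l (𝓝 (inducedDist u x₀ y₀)) := by
  have h0 := (H.tendsto_inducedDist x₀ y₀).comp hN
  have key : ∀ {z : ι → ℍ} {z₀ : ℍ}, Tendsto z l (𝓝 z₀) →
      Tendsto (fun i => inducedDist (un (N i)) (z i) z₀) l (𝓝 0) := by
    intro z z₀ hz
    have h1 := (continuous_dist_coe_div.tendsto (z₀, z₀)).comp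
      (hz.prodMk_nhds (tendsto_const_nhds (x := z₀)))
    rw [dist_self, zero_div] at h1
    exact squeeze_zero (fun i => inducedDist_nonneg _ _ _)
      (fun i => (H.seq (N i)).inducedDist_le_dist_coe_div _ _) h1
  have h1 : Tendsto (fun i => inducedDist (un (N i)) (x i) (y i) -
      inducedDist (un (N i)) x₀ y₀) l (𝓝 0) := by
    have h2 := (key hx).add (key hy)
    rw [add_zero] at h2
    refine squeeze_zero_norm (fun i => ?_) h2
    have hu := H.seq (N i)
    have t1 := hu.inducedDist_triangle (x i) x₀ (y i)
    have t2 := hu.inducedDist_triangle x₀ y₀ (y i)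
    have t3 := hu.inducedDist_triangle x₀ (x i) y₀
    have t4 := hu.inducedDist_triangle (x i) (y i) y₀
    rw [inducedDist_comm _ x₀ (x i)] at t3
    rw [inducedDist_comm _ y₀ (y i)] at t2
    rw [Real.norm_eq_abs, abs_le]
    constructor <;> linarith
  have := h0.add h1
  rw [add_zero] at this
  exact this.congr fun i => by simp

end AdmissibleLimit

theorem Admissible.continuous_inducedDist (hu : Admissible T u) :
    Continuous fun p : ℍ × ℍ => inducedDist u p.1 p.2 := by
  have H : AdmissibleLimit T (fun _ => u) u := ⟨fun _ => hu, hu, fun _ => tendsto_const_nhds⟩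
  refine continuous_iff_continuousAt.2 fun p => ?_
  have h := H.tendsto_inducedDist_of_tendsto (l := atTop ×ˢ 𝓝 p)
    (N := fun i : ℕ × ℍ × ℍ => i.1) (x := fun i => i.2.1) (y := fun i => i.2.2) tendsto_fst
    ((continuous_fst.tendsto p).comp tendsto_snd) ((continuous_snd.tendsto p).comp tendsto_snd)
  rw [ContinuousAt, tendsto_def]
  intro s hs
  obtain ⟨A, hA, B, hB, hAB⟩ := mem_prod_iff.1 (h hs)
  obtain ⟨n, hn⟩ := (show (A : Set ℕ).Nonempty from nonempty_of_mem hA)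
  filter_upwards [hB] with q hq
  exact hAB (mk_mem_prod hn hq)

end Convergence

/-! ### Points of the hyperbolic plane as binary quadratic forms -/

/-- The positive definite binary quadratic form `(p, q, r)`, `p r - q² = 1`, which represents a
point `z` of the upper half-plane. Möbius transformations act linearly on these forms. -/
def formVec (z : ℍ) : ℝ × ℝ × ℝ := (1 / z.im, z.re / z.im, (z.re ^ 2 + z.im ^ 2) / z.im)

/-- The convex cone of positive definite binary quadratic forms. -/
def posCone : Set (ℝ × ℝ × ℝ) := {v | 0 < v.1 ∧ v.2.1 ^ 2 < v.1 * v.2.2}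

/-- The point of the upper half-plane represented by the ray of a positive definite form. -/
def coneProj (v : ℝ × ℝ × ℝ) : ℂ := ⟨v.2.1 / v.1, √(v.1 * v.2.2 - v.2.1 ^ 2) / v.1⟩

theorem formVec_mem_posCone (z : ℍ) : formVec z ∈ posCone := by
  have h := z.im_pos
  refine ⟨by simp only [formVec]; positivity, ?_⟩
  simp only [formVec]
  rw [div_pow, div_mul_div_comm, one_mul, ← sq, div_lt_div_iff_of_pos_right (by positivity)]
  nlinarith

theorem add_mem_posCone {v w : ℝ × ℝ × ℝ} (hv : v ∈ posCone) (hw : w ∈ posCone) :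
    v + w ∈ posCone := by
  obtain ⟨p, q, r⟩ := v
  obtain ⟨p', q', r'⟩ := w
  obtain ⟨h1, h2⟩ := hv
  obtain ⟨h3, h4⟩ := hw
  simp only at h1 h2 h3 h4
  refine ⟨by simp only [Prod.mk_add_mk]; positivity, ?_⟩
  simp only [Prod.mk_add_mk]
  have h5 : 0 < p * p' * (p * r' + p' * r - 2 * q * q') := by
    nlinarith [sq_nonneg (p * q' - p' * q), mul_lt_mul_of_pos_left h4 (pow_pos h1 2),
      mul_lt_mul_of_pos_left h2 (pow_pos h3 2)]
  have h6 := (mul_pos_iff_of_pos_left (mul_pos h1 h3)).1 h5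
  nlinarith

theorem smul_mem_posCone {v : ℝ × ℝ × ℝ} (hv : v ∈ posCone) {c : ℝ} (hc : 0 < c) :
    c • v ∈ posCone := by
  obtain ⟨p, q, r⟩ := v
  obtain ⟨h1, h2⟩ := hv
  simp only at h1 h2
  refine ⟨by simp only [Prod.smul_mk, smul_eq_mul]; positivity, ?_⟩
  simp only [Prod.smul_mk, smul_eq_mul]
  have := mul_lt_mul_of_pos_left h2 (pow_pos hc 2)
  nlinarith

theorem coneProj_im_pos {v : ℝ × ℝ × ℝ} (hv : v ∈ posCone) : 0 < (coneProj v).im :=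
  div_pos (Real.sqrt_pos.2 (by linarith [hv.2])) hv.1

theorem coneProj_smul_formVec {c : ℝ} (hc : 0 < c) (z : ℍ) : coneProj (c • formVec z) = z := by
  have h := z.im_pos
  have e : c * (1 / z.im) * (c * ((z.re ^ 2 + z.im ^ 2) / z.im)) - (c * (z.re / z.im)) ^ 2
      = c ^ 2 := by
    field_simp
    ring
  apply Complex.ext
  · simp only [coneProj, formVec, Prod.smul_mk, smul_eq_mul, UpperHalfPlane.coe_re]
    field_simp
  · simp only [coneProj, formVec, Prod.smul_mk, smul_eq_mul, UpperHalfPlane.coe_im]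
    rw [e, Real.sqrt_sq hc.le]
    field_simp

theorem exists_eq_smul_formVec {v : ℝ × ℝ × ℝ} (hv : v ∈ posCone) :
    ∃ c : ℝ, 0 < c ∧ v = c • formVec (ofComplex (coneProj v)) := by
  have him := coneProj_im_pos hv
  obtain ⟨p, q, r⟩ := v
  obtain ⟨h1, h2⟩ := hv
  simp only at h1 h2
  have hs : 0 < √(p * r - q ^ 2) := Real.sqrt_pos.2 (by linarith)
  have hs2 : √(p * r - q ^ 2) ^ 2 = p * r - q ^ 2 := Real.sq_sqrt (by linarith)
  refine ⟨_, hs, ?_⟩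
  rw [ofComplex_apply_of_im_pos him]
  have e1 : (UpperHalfPlane.mk (coneProj (p, q, r)) him).re = q / p := rfl
  have e2 : (UpperHalfPlane.mk (coneProj (p, q, r)) him).im = √(p * r - q ^ 2) / p := rfl
  simp only [formVec, e1, e2, Prod.smul_mk, smul_eq_mul]
  generalize √(p * r - q ^ 2) = s at hs hs2
  refine Prod.ext ?_ (Prod.ext ?_ ?_)
  · simp only; field_simp
  · simp only; field_simp
  · simp only
    rw [div_pow, div_pow, hs2]
    field_simp
    ring

/-- The points `i`, `2i`, `1 + i`; the quadratic forms which represent them are a basis. -/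
def basePoint : Fin 3 → ℍ := ![⟨⟨0, 1⟩, one_pos⟩, ⟨⟨0, 2⟩, two_pos⟩, ⟨⟨1, 1⟩, one_pos⟩]

/-- The linear map on quadratic forms with the values `a j` on the basis
`formVec (basePoint j)`. -/
def formComb (a : Fin 3 → ℝ × ℝ × ℝ) : ℝ × ℝ × ℝ →ₗ[ℝ] ℝ × ℝ × ℝ where
  toFun v := ((4 * v.1 - v.2.2 - 2 * v.2.1) / 3) • a 0 +
    (2 / 3 * (v.2.2 - v.1 - v.2.1)) • a 1 + v.2.1 • a 2
  map_add' v w := by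
    simp only [Prod.fst_add, Prod.snd_add]
    module
  map_smul' c v := by
    simp only [Prod.smul_fst, Prod.smul_snd, smul_eq_mul, RingHom.id_apply]
    module

/-- The linear map on quadratic forms induced by a Möbius transformation `h`
(see `formMap_formVec`). -/
def formMap (h : ℍ → ℍ) : ℝ × ℝ × ℝ →ₗ[ℝ] ℝ × ℝ × ℝ :=
  formComb fun j => formVec (h (basePoint j))

theorem formVec_specialLinearGroup (g : Matrix.SpecialLinearGroup (Fin 2) ℝ) (z : ℍ) :
    formVec (g • z) =
      (g 1 1 ^ 2 * (formVec z).1 + 2 * (g 1 0 * g 1 1) * (formVec z).2.1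
          + g 1 0 ^ 2 * (formVec z).2.2,
        g 0 1 * g 1 1 * (formVec z).1 + (g 0 0 * g 1 1 + g 0 1 * g 1 0) * (formVec z).2.1
          + g 0 0 * g 1 0 * (formVec z).2.2,
        g 0 1 ^ 2 * (formVec z).1 + 2 * (g 0 0 * g 0 1) * (formVec z).2.1
          + g 0 0 ^ 2 * (formVec z).2.2) := by
  have hdet : g 0 0 * g 1 1 - g 0 1 * g 1 0 = 1 := by
    have := g.det_coe
    rwa [Matrix.det_fin_two] at this
  have hy := z.im_pos
  set a := g 0 0
  set b := g 0 1
  set c := g 1 0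
  set d := g 1 1
  have hN : 0 < (c * z.re + d) ^ 2 + (c * z.im) ^ 2 := by
    by_contra hcon
    have h1 : (c * z.im) = 0 := by nlinarith [sq_nonneg (c * z.re + d), sq_nonneg (c * z.im)]
    have h2 : (c * z.re + d) = 0 := by nlinarith [sq_nonneg (c * z.re + d), sq_nonneg (c * z.im)]
    have h3 : c = 0 := by simpa [hy.ne'] using h1
    rw [h3] at h2 hdet
    simp only [zero_mul, zero_add] at h2
    rw [h2] at hdet
    simp at hdet
  obtain ⟨N, hNe⟩ : ∃ N, N = (c * z.re + d) ^ 2 + (c * z.im) ^ 2 := ⟨_, rfl⟩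
  rw [← hNe] at hN
  have hdiv : ((g • z : ℍ) : ℂ) =
      ⟨((a * z.re + b) * (c * z.re + d) + a * z.im * (c * z.im)) / N, z.im / N⟩ := by
    have hcoe : ((g • z : ℍ) : ℂ) = (a * z + b) / (c * z + d) := by
      rw [UpperHalfPlane.coe_specialLinearGroup_apply]
      rfl
    rw [hcoe, div_eq_iff]
    · apply Complex.ext
      · simp
        field_simp
        linear_combination (a * z.re + b) * hNe - c * z.im ^ 2 * hdet
      · simp
        field_simp
        linear_combination a * hNe + (c * z.re + d) * hdet
    · intro h0
      have h1 := congrArg Complex.re h0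
      have h2 := congrArg Complex.im h0
      simp at h1 h2
      rcases h2 with h2 | h2
      · simp only [h2, zero_mul, zero_add] at h1 hNe
        simp [h1, hNe] at hN
      · exact hy.ne' h2
  have hre : (g • z).re =
      ((a * z.re + b) * (c * z.re + d) + a * z.im * (c * z.im)) / N := by
    rw [← UpperHalfPlane.coe_re, hdiv]
  have him : (g • z).im = z.im / N := by
    rw [← UpperHalfPlane.coe_im, hdiv]
  simp only [formVec]
  rw [hre, him]
  refine Prod.ext ?_ (Prod.ext ?_ ?_)
  · simp only
    field_simp
    rw [hNe]
    ring
  · simp only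
    field_simp
    ring
  · simp only
    field_simp
    rw [hNe]
    linear_combination (-z.im ^ 2 * (a * d - b * c + 1)) * hdet

theorem formMap_formVec {h : ℍ → ℍ} {g : Matrix.SpecialLinearGroup (Fin 2) ℝ}
    (hg : ∀ z, h z = g • z) (z : ℍ) : formMap h (formVec z) = formVec (h z) := by
  have e1 : formVec ⟨⟨0, 1⟩, one_pos⟩ = (1, 0, 1) := by simp [formVec, UpperHalfPlane.im, UpperHalfPlane.re]
  have e2 : formVec ⟨⟨0, 2⟩, two_pos⟩ = (1 / 2, 0, 2) := by
    simp [formVec, UpperHalfPlane.im, UpperHalfPlane.re]; norm_num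
  have e3 : formVec ⟨⟨1, 1⟩, one_pos⟩ = (1, 1, 2) := by
    simp [formVec, UpperHalfPlane.im, UpperHalfPlane.re]; norm_num
  change _ • formVec (h ⟨⟨0, 1⟩, one_pos⟩) + _ • formVec (h ⟨⟨0, 2⟩, two_pos⟩) +
    _ • formVec (h ⟨⟨1, 1⟩, one_pos⟩) = _
  rw [hg, hg, hg, hg, formVec_specialLinearGroup, formVec_specialLinearGroup,
    formVec_specialLinearGroup, formVec_specialLinearGroup, e1, e2, e3]
  generalize formVec z = v
  obtain ⟨p, q, r⟩ := v
  refine Prod.ext ?_ (Prod.ext ?_ ?_)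
  · simp; ring
  · simp; ring
  · simp; ring

theorem coneProj_formMap {h : ℍ → ℍ} {g : Matrix.SpecialLinearGroup (Fin 2) ℝ}
    (hg : ∀ z, h z = g • z) {v : ℝ × ℝ × ℝ} (hv : v ∈ posCone) :
    ofComplex (coneProj (formMap h v)) = h (ofComplex (coneProj v)) := by
  obtain ⟨c, hc, he⟩ := exists_eq_smul_formVec hv
  obtain ⟨w, hw⟩ : ∃ w, w = ofComplex (coneProj v) := ⟨_, rfl⟩
  rw [← hw] at he ⊢
  rw [he, map_smul, formMap_formVec hg, coneProj_smul_formVec hc, ofComplex_apply]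

/-! ### Equivariant maps close to the identity -/

section EquivariantMap

open Set

variable {Γ : Subgroup (ℍ ≃ᵢ ℍ)} {R : ℝ}

/-- A smooth bump around `x`, written in the coordinate `w` of the upper half-plane: in terms of
the hyperbolic distance, it is a function of `R - cosh d`, see `bump_coe`. -/
def bump (R : ℝ) (x : ℍ) (w : ℂ) : ℝ :=
  Real.smoothTransition (R - (1 + ((w.re - x.re) ^ 2 + (w.im - x.im) ^ 2) / (2 * w.im * x.im)))

theorem bump_coe (x z : ℍ) :
    bump R x z = Real.smoothTransition (R - Real.cosh (dist z x)) := by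
  rw [UpperHalfPlane.cosh_dist, Complex.dist_eq, ← Complex.normSq_eq_norm_sq,
    Complex.normSq_apply, bump]
  simp [sq]

theorem bump_nonneg (x : ℍ) (w : ℂ) : 0 ≤ bump R x w := Real.smoothTransition.nonneg _

theorem bump_pos {x z : ℍ} (h : Real.cosh (dist z x) < R) : 0 < bump R x z := by
  rw [bump_coe]
  exact Real.smoothTransition.pos_of_pos (by linarith)

theorem dist_lt_of_bump_ne_zero {x z : ℍ} (h : bump R x z ≠ 0) : dist z x < R := by
  by_contra hcon
  rw [bump_coe] at h
  refine h (Real.smoothTransition.zero_of_nonpos ?_)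
  have h1 : dist z x ≤ Real.sinh (dist z x) := Real.self_le_sinh_iff.2 dist_nonneg
  have h2 := Real.sinh_lt_cosh (dist z x)
  push Not at hcon
  linarith

/-- The weighted sum of the quadratic forms of the points `τ σ (σ⁻¹ z)`; only finitely many of the
weights do not vanish. -/
def meanForm (R : ℝ) (τ : Γ →* (ℍ ≃ᵢ ℍ)) (z : ℍ) : ℝ × ℝ × ℝ :=
  ∑ᶠ σ : Γ, bump R ((σ : ℍ ≃ᵢ ℍ) I) z • formVec (τ σ (((σ⁻¹ : Γ) : ℍ ≃ᵢ ℍ) z))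

/-- The weighted mean, in the hyperbolic plane, of the points `τ σ (σ⁻¹ z)`, `σ ∈ Γ`, where the
weight of `σ` is the bump around `σ i`. It is equivariant with respect to `τ`. -/
def meanMap (R : ℝ) (τ : Γ →* (ℍ ≃ᵢ ℍ)) (z : ℍ) : ℍ := ofComplex (coneProj (meanForm R τ z))

theorem finite_support_meanForm [DiscreteTopology Γ] (τ : Γ →* (ℍ ≃ᵢ ℍ)) (z : ℍ) :
    (Function.support fun σ : Γ =>
      bump R ((σ : ℍ ≃ᵢ ℍ) I) z • formVec (τ σ (((σ⁻¹ : Γ) : ℍ ≃ᵢ ℍ) z))).Finite := by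
  refine (finite_setOf_dist_le (Γ := Γ) z I R).subset fun σ hσ => ?_
  exact (dist_lt_of_bump_ne_zero (left_ne_zero_of_smul hσ)).le

theorem meanForm_mem_posCone [DiscreteTopology Γ]
    (hR : ∀ z : ℍ, ∃ σ : Γ, Real.cosh (dist z ((σ : ℍ ≃ᵢ ℍ) I)) < R)
    (τ : Γ →* (ℍ ≃ᵢ ℍ)) (z : ℍ) : meanForm R τ z ∈ posCone := by
  classical
  obtain ⟨σ₀, h₀⟩ := hR z
  rw [meanForm, finsum_eq_sum _ (finite_support_meanForm τ z)]
  have hmem : σ₀ ∈ (finite_support_meanForm (R := R) τ z).toFinset := by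
    rw [Set.Finite.mem_toFinset, Function.mem_support]
    refine smul_ne_zero (bump_pos h₀).ne' fun h => ?_
    have := (formVec_mem_posCone (τ σ₀ (((σ₀⁻¹ : Γ) : ℍ ≃ᵢ ℍ) z))).1
    rw [h] at this
    exact lt_irrefl _ this
  rw [← Finset.add_sum_erase _ _ hmem]
  have key : ∀ s : Finset Γ, ∀ v ∈ posCone, v + ∑ σ ∈ s, bump R ((σ : ℍ ≃ᵢ ℍ) I) z •
      formVec (τ σ (((σ⁻¹ : Γ) : ℍ ≃ᵢ ℍ) z)) ∈ posCone := by
    intro s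
    induction s using Finset.induction_on with
    | empty => intro v hv; simpa using hv
    | insert σ s hσ ih =>
      intro v hv
      rw [Finset.sum_insert hσ, ← add_assoc]
      refine ih _ ?_
      rcases (bump_nonneg (R := R) ((σ : ℍ ≃ᵢ ℍ) I) z).eq_or_lt with h | h
      · rw [← h, zero_smul, add_zero]
        exact hv
      · exact add_mem_posCone hv (smul_mem_posCone (formVec_mem_posCone _) h)
  exact key _ _ (smul_mem_posCone (formVec_mem_posCone _) (bump_pos h₀))

/-- Equivariance: the translation of the index `σ` by `ρ` turns the sum at `ρ z` into the image of
the sum at `z` under the linear action of `τ ρ`. -/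
theorem meanMap_apply [DiscreteTopology Γ]
    (hR : ∀ z : ℍ, ∃ σ : Γ, Real.cosh (dist z ((σ : ℍ ≃ᵢ ℍ) I)) < R)
    {τ : Γ →* (ℍ ≃ᵢ ℍ)}
    (hτ : ∀ σ, ∃ g : Matrix.SpecialLinearGroup (Fin 2) ℝ, ∀ z, τ σ z = g • z) (ρ : Γ) (z : ℍ) :
    meanMap R τ ((ρ : ℍ ≃ᵢ ℍ) z) = τ ρ (meanMap R τ z) := by
  obtain ⟨g, hg⟩ := hτ ρ
  have hform : meanForm R τ ((ρ : ℍ ≃ᵢ ℍ) z) = formMap (τ ρ) (meanForm R τ z) := by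
    have h1 := (formMap (τ ρ)).toAddMonoidHom.map_finsum (finite_support_meanForm (R := R) τ z)
    rw [meanForm, meanForm]
    refine Eq.trans ?_ h1.symm
    rw [← finsum_comp_equiv (Equiv.mulLeft ρ)]
    refine finsum_congr fun σ => ?_
    have e1 : bump R (((Equiv.mulLeft ρ σ : Γ) : ℍ ≃ᵢ ℍ) I) ((ρ : ℍ ≃ᵢ ℍ) z) =
        bump R ((σ : ℍ ≃ᵢ ℍ) I) z := by
      rw [bump_coe, bump_coe]
      congr 3
      exact (ρ : ℍ ≃ᵢ ℍ).isometry.dist_eq _ _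
    have e2 : ((((Equiv.mulLeft ρ σ)⁻¹ : Γ) : ℍ ≃ᵢ ℍ) ((ρ : ℍ ≃ᵢ ℍ) z)) =
        ((σ⁻¹ : Γ) : ℍ ≃ᵢ ℍ) z := by
      change (((ρ * σ)⁻¹ * ρ : Γ) : ℍ ≃ᵢ ℍ) z = _
      rw [mul_inv_rev, inv_mul_cancel_right]
    have e3 : ∀ w, τ (Equiv.mulLeft ρ σ) w = τ ρ (τ σ w) := by
      intro w
      rw [Equiv.coe_mulLeft, map_mul]
      rfl
    rw [e1, e2, e3]
    change _ = formMap (τ ρ) (_ • _)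
    rw [map_smul, formMap_formVec hg]
  rw [meanMap, meanMap, hform, coneProj_formMap hg (meanForm_mem_posCone hR τ z)]

/-- The mean of finitely many points, as a function of the images of the base points under the
transformations `τ σ σ⁻¹` and of the coordinate in the upper half-plane. -/
def localForm (R : ℝ) (E : Finset Γ) (p : (E → Fin 3 → ℝ × ℝ × ℝ) × ℂ) : ℝ × ℝ × ℝ :=
  ∑ σ : E, bump R (((σ : Γ) : ℍ ≃ᵢ ℍ) I) p.2 •
    formComb (p.1 σ) (1 / p.2.im, p.2.re / p.2.im, (p.2.re ^ 2 + p.2.im ^ 2) / p.2.im)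

theorem contDiffAt_coneProj {v : ℝ × ℝ × ℝ} (hv : v ∈ posCone) : ContDiffAt ℝ 1 coneProj v := by
  have e : coneProj = fun v : ℝ × ℝ × ℝ => ((v.2.1 / v.1 : ℝ) : ℂ) +
      ((√(v.1 * v.2.2 - v.2.1 ^ 2) / v.1 : ℝ) : ℂ) * Complex.I := by
    funext v
    rw [coneProj, Complex.mk_eq_add_mul_I]
  have h1 : v.1 ≠ 0 := hv.1.ne'
  have h2 : v.1 * v.2.2 - v.2.1 ^ 2 ≠ 0 := by linarith [hv.2]
  rw [e]
  have c1 : ContDiffAt ℝ 1 (fun v : ℝ × ℝ × ℝ => v.2.1 / v.1) v := by fun_prop (disch := assumption)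
  have c2 : ContDiffAt ℝ 1 (fun v : ℝ × ℝ × ℝ => √(v.1 * v.2.2 - v.2.1 ^ 2) / v.1) v := by
    fun_prop (disch := assumption)
  exact (Complex.ofRealCLM.contDiff.contDiffAt.comp v c1).add
    ((Complex.ofRealCLM.contDiff.contDiffAt.comp v c2).mul contDiffAt_const)

theorem contDiffAt_bump (x : ℍ) {w : ℂ} (hw : 0 < w.im) : ContDiffAt ℝ 1 (bump R x) w := by
  have hx := x.im_pos.ne'
  have h1 : 2 * w.im * x.im ≠ 0 := by positivity
  have hre : ContDiff ℝ 1 (fun w : ℂ => w.re) := Complex.reCLM.contDiff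
  have him : ContDiff ℝ 1 (fun w : ℂ => w.im) := Complex.imCLM.contDiff
  refine (Real.smoothTransition.contDiff (n := 1)).contDiffAt.comp w ?_
  refine contDiffAt_const.sub (contDiffAt_const.add (ContDiffAt.div ?_ ?_ h1))
  · exact (((hre.sub contDiff_const).pow 2).add ((him.sub contDiff_const).pow 2)).contDiffAt
  · exact ((contDiff_const.mul him).mul contDiff_const).contDiffAt

end EquivariantMap

section EquivariantMapSequence

open Set

variable {Γ : Subgroup (ℍ ≃ᵢ ℍ)} {R : ℝ}

theorem localForm_eq_meanForm {E : Finset Γ} {z : ℍ}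
    (hE : ∀ σ : Γ, dist z ((σ : ℍ ≃ᵢ ℍ) I) < R → σ ∈ E) {τ : Γ →* (ℍ ≃ᵢ ℍ)}
    (hτ : ∀ σ : Γ, ∃ g : Matrix.SpecialLinearGroup (Fin 2) ℝ, ∀ z,
      τ σ (((σ⁻¹ : Γ) : ℍ ≃ᵢ ℍ) z) = g • z) :
    localForm R E ((fun σ j => formVec (τ σ (((σ⁻¹ : Γ) : ℍ ≃ᵢ ℍ) (basePoint j)))), z) =
      meanForm R τ z := by
  rw [meanForm, finsum_eq_sum_of_support_subset (s := E), ← Finset.sum_coe_sort]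
  · refine Finset.sum_congr rfl fun σ _ => ?_
    obtain ⟨g, hg⟩ := hτ σ
    have := formMap_formVec hg z
    rw [← this]
    rfl
  · intro σ hσ
    exact hE σ (dist_lt_of_bump_ne_zero (left_ne_zero_of_smul hσ))

theorem contDiffAt_localForm (E : Finset Γ) (a : E → Fin 3 → ℝ × ℝ × ℝ) {w : ℂ} (hw : 0 < w.im) :
    ContDiffAt ℝ 1 (localForm R E) (a, w) := by
  have hsnd : ContDiffAt ℝ 1 (fun p : (E → Fin 3 → ℝ × ℝ × ℝ) × ℂ => p.2) (a, w) :=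
    contDiffAt_snd
  have hre : ContDiffAt ℝ 1 (fun p : (E → Fin 3 → ℝ × ℝ × ℝ) × ℂ => p.2.re) (a, w) :=
    (Complex.reCLM.contDiff.contDiffAt (x := w)).comp (a, w) hsnd
  have him : ContDiffAt ℝ 1 (fun p : (E → Fin 3 → ℝ × ℝ × ℝ) × ℂ => p.2.im) (a, w) :=
    (Complex.imCLM.contDiff.contDiffAt (x := w)).comp (a, w) hsnd
  have h0 : ((a, w) : (E → Fin 3 → ℝ × ℝ × ℝ) × ℂ).2.im ≠ 0 := hw.ne'
  refine ContDiffAt.sum fun σ _ => ?_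
  have hbump : ContDiffAt ℝ 1 (fun p : (E → Fin 3 → ℝ × ℝ × ℝ) × ℂ =>
      bump R (((σ : Γ) : ℍ ≃ᵢ ℍ) I) p.2) (a, w) :=
    ContDiffAt.comp (g := bump R (((σ : Γ) : ℍ ≃ᵢ ℍ) I)) (a, w) (contDiffAt_bump _ hw) hsnd
  have hcomb : ContDiffAt ℝ 1 (fun p : (E → Fin 3 → ℝ × ℝ × ℝ) × ℂ => formComb (p.1 σ)
      (1 / p.2.im, p.2.re / p.2.im, (p.2.re ^ 2 + p.2.im ^ 2) / p.2.im)) (a, w) := by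
    have hcoord : ∀ j, ContDiffAt ℝ 1 (fun p : (E → Fin 3 → ℝ × ℝ × ℝ) × ℂ => p.1 σ j) (a, w) :=
      fun j => by fun_prop
    have h1 := (contDiffAt_const (c := (1 : ℝ))).div him h0
    have h2 := hre.div him h0
    have h3 := ((hre.pow 2).add (him.pow 2)).div him h0
    have c0 := ((((contDiffAt_const (c := (4 : ℝ))).mul h1).sub h3).sub
      ((contDiffAt_const (c := (2 : ℝ))).mul h2)).div_const 3
    have c1 := (contDiffAt_const (c := (2 / 3 : ℝ))).mul ((h3.sub h1).sub h2)
    exact ((c0.smul (hcoord 0)).add (c1.smul (hcoord 1))).add (h2.smul (hcoord 2))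
  exact hbump.smul hcomb

theorem meanMap_subtype [DiscreteTopology Γ]
    (hR : ∀ z : ℍ, ∃ σ : Γ, Real.cosh (dist z ((σ : ℍ ≃ᵢ ℍ) I)) < R) (z : ℍ) :
    meanMap R Γ.subtype z = z := by
  have hmem := meanForm_mem_posCone hR Γ.subtype z
  obtain ⟨c, hc⟩ : ∃ c : ℝ, meanForm R Γ.subtype z = c • formVec z := by
    have e : ∀ σ : Γ, Γ.subtype σ (((σ⁻¹ : Γ) : ℍ ≃ᵢ ℍ) z) = z := fun σ =>
      (σ : ℍ ≃ᵢ ℍ).apply_symm_apply z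
    rw [meanForm]
    simp only [e]
    exact ⟨_, (finsum_smul _ _).symm⟩
  have hpos : 0 < c := by
    rw [hc] at hmem
    have h1 : 0 < c * (formVec z).1 := hmem.1
    exact (mul_pos_iff_of_pos_right (formVec_mem_posCone z).1).1 h1
  rw [meanMap, hc, coneProj_smul_formVec hpos, ofComplex_apply]

/-- If the representations `τₙ` tend to the inclusion of `Γ`, then the means of `τₙ` are locally
given by one smooth function, with parameters which converge as `n → ∞`; for the limit of the
parameters the function is the identity. -/
theorem exists_local_parametrization [DiscreteTopology Γ]
    (hR : ∀ z : ℍ, ∃ σ : Γ, Real.cosh (dist z ((σ : ℍ ≃ᵢ ℍ) I)) < R)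
    {τ : ℕ → Γ →* (ℍ ≃ᵢ ℍ)}
    (hτ : ∀ n, ∀ σ : Γ, ∃ g : Matrix.SpecialLinearGroup (Fin 2) ℝ, ∀ z,
      τ n σ (((σ⁻¹ : Γ) : ℍ ≃ᵢ ℍ) z) = g • z)
    (hlim : ∀ σ : Γ, Tendsto (fun n => τ n σ) atTop (𝓝 (σ : ℍ ≃ᵢ ℍ))) (z₀ : ℍ) :
    ∃ (E : Finset Γ) (H : (E → Fin 3 → ℝ × ℝ × ℝ) × ℂ → ℂ) (a : ℕ → E → Fin 3 → ℝ × ℝ × ℝ)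
      (a₀ : E → Fin 3 → ℝ × ℝ × ℝ), Tendsto a atTop (𝓝 a₀) ∧ ContDiffAt ℝ 1 H (a₀, (z₀ : ℂ)) ∧
        (∀ᶠ w in 𝓝 (z₀ : ℂ), H (a₀, w) = w) ∧
        ∀ᶠ w in 𝓝 (z₀ : ℂ), ∀ n, (meanMap R (τ n) (ofComplex w) : ℂ) = H (a n, w) := by
  have hfin := finite_setOf_dist_le (Γ := Γ) z₀ I (R + 1)
  have hmem : ∀ z : ℍ, dist z₀ z < 1 → ∀ σ : Γ, dist z ((σ : ℍ ≃ᵢ ℍ) I) < R →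
      σ ∈ hfin.toFinset := by
    intro z hz σ hσ
    rw [Set.Finite.mem_toFinset]
    change dist _ _ ≤ _
    linarith [dist_triangle z₀ z ((σ : ℍ ≃ᵢ ℍ) I)]
  generalize hfin.toFinset = E at hmem
  have hnhds : ∀ᶠ w in 𝓝 (z₀ : ℂ), 0 < w.im ∧ dist z₀ (ofComplex w) < 1 := by
    have h1 : ∀ᶠ w : ℂ in 𝓝 (z₀ : ℂ), 0 < w.im :=
      (Complex.continuous_im.tendsto _).eventually (lt_mem_nhds z₀.im_pos)
    have h2 : Tendsto (fun w => dist z₀ (ofComplex w)) (𝓝 (z₀ : ℂ)) (𝓝 0) := by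
      have h3 : Tendsto (fun w : ℂ => ofComplex w) (𝓝 (z₀ : ℂ)) (𝓝 z₀) := by
        have : ContinuousAt (fun w : ℂ => ofComplex w) (z₀ : ℂ) :=
          (contMDiffAt_ofComplex (n := 1) z₀.im_pos).continuousAt
        have h4 := this.tendsto
        rwa [ofComplex_apply] at h4
      have h5 := (tendsto_const_nhds (x := z₀)).dist h3
      rwa [dist_self] at h5
    filter_upwards [h1, h2.eventually (gt_mem_nhds one_pos)] with w h3 h4
    exact ⟨h3, h4⟩
  have hsub : ∀ (z : ℍ) (σ : Γ), Γ.subtype σ (((σ⁻¹ : Γ) : ℍ ≃ᵢ ℍ) z) = z := fun z σ =>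
    (σ : ℍ ≃ᵢ ℍ).apply_symm_apply z
  have hone : ∀ σ : Γ, ∃ g : Matrix.SpecialLinearGroup (Fin 2) ℝ, ∀ z,
      Γ.subtype σ (((σ⁻¹ : Γ) : ℍ ≃ᵢ ℍ) z) = g • z := fun σ =>
    ⟨1, fun z => by rw [hsub, one_smul]⟩
  have hval : ∀ z, dist z₀ z < 1 → localForm R E ((fun _ j => formVec (basePoint j)), (z : ℂ)) =
      meanForm R Γ.subtype z := by
    intro z hz
    rw [← localForm_eq_meanForm (hmem z hz) hone]
    simp only [hsub]
  have hcoe : ∀ (σ : Γ →* (ℍ ≃ᵢ ℍ)) (z : ℍ), (meanMap R σ z : ℂ) = coneProj (meanForm R σ z) :=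
    fun σ z => by
      rw [meanMap, ofComplex_apply_of_im_pos (coneProj_im_pos (meanForm_mem_posCone hR σ z))]
  refine ⟨E, fun p => coneProj (localForm R E p), fun n σ j =>
    formVec (τ n σ (((σ⁻¹ : Γ) : ℍ ≃ᵢ ℍ) (basePoint j))), fun _ j => formVec (basePoint j),
    ?_, ?_, ?_, ?_⟩
  · rw [tendsto_pi_nhds]
    intro σ
    rw [tendsto_pi_nhds]
    intro j
    have hcont : Continuous formVec := by
      have h1 : ∀ z : ℍ, z.im ≠ 0 := fun z => z.im_pos.ne'
      have h2 := UpperHalfPlane.continuous_re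
      have h3 := UpperHalfPlane.continuous_im
      exact (continuous_const.div h3 h1).prodMk
        ((h2.div h3 h1).prodMk (((h2.pow 2).add (h3.pow 2)).div h3 h1))
    have h1 := (tendsto_isometryEquiv_iff.1 (hlim σ)) (((σ⁻¹ : Γ) : ℍ ≃ᵢ ℍ) (basePoint j))
    have h2 := (hcont.tendsto _).comp h1
    have h3 : (σ : Γ).1 ((((σ : Γ)⁻¹ : Γ) : ℍ ≃ᵢ ℍ) (basePoint j)) = basePoint j := hsub _ _
    rw [h3] at h2
    exact h2
  · refine ContDiffAt.comp (g := coneProj) _ (contDiffAt_coneProj ?_)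
      (contDiffAt_localForm E _ z₀.im_pos)
    rw [hval z₀ (by simp)]
    exact meanForm_mem_posCone hR _ _
  · filter_upwards [hnhds] with w hw
    have e : w = (ofComplex w : ℂ) := by rw [ofComplex_apply_of_im_pos hw.1]
    generalize ofComplex w = z at hw e
    subst e
    change coneProj _ = _
    rw [hval z hw.2, ← hcoe, meanMap_subtype hR]
  · filter_upwards [hnhds] with w hw n
    have e : w = (ofComplex w : ℂ) := by rw [ofComplex_apply_of_im_pos hw.1]
    generalize ofComplex w = z at hw e
    subst e
    rw [hcoe, localForm_eq_meanForm (hmem z hw.2) (hτ n)]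

/-- Close to a point, and for large `n`, the means of `τₙ` are `C¹`-close to the identity. -/
theorem eventually_norm_meanMap_sub_le [DiscreteTopology Γ]
    (hR : ∀ z : ℍ, ∃ σ : Γ, Real.cosh (dist z ((σ : ℍ ≃ᵢ ℍ) I)) < R)
    {τ : ℕ → Γ →* (ℍ ≃ᵢ ℍ)}
    (hτ : ∀ n, ∀ σ : Γ, ∃ g : Matrix.SpecialLinearGroup (Fin 2) ℝ, ∀ z,
      τ n σ (((σ⁻¹ : Γ) : ℍ ≃ᵢ ℍ) z) = g • z)
    (hlim : ∀ σ : Γ, Tendsto (fun n => τ n σ) atTop (𝓝 (σ : ℍ ≃ᵢ ℍ))) (z₀ : ℍ) :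
    ∀ᶠ p : ℕ × (ℂ × ℂ) in atTop ×ˢ 𝓝 ((z₀ : ℂ), (z₀ : ℂ)),
      ‖((meanMap R (τ p.1) (ofComplex p.2.1) : ℂ) - meanMap R (τ p.1) (ofComplex p.2.2)) -
        (p.2.1 - p.2.2)‖ ≤ 1 / 2 * ‖p.2.1 - p.2.2‖ := by
  obtain ⟨E, H, a, a₀, ha, hH, hid, hloc⟩ := exists_local_parametrization hR hτ hlim z₀
  have hstrict := hH.hasStrictFDerivAt one_ne_zero
  obtain ⟨L, hL⟩ : ∃ L, L = fderiv ℝ H (a₀, (z₀ : ℂ)) := ⟨_, rfl⟩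
  rw [← hL] at hstrict
  -- the partial derivative with respect to the point is the identity
  have hLid : ∀ w : ℂ, L (0, w) = w := by
    have h1 : HasFDerivAt (fun w : ℂ => H (a₀, w))
        (L.comp (ContinuousLinearMap.inr ℝ (E → Fin 3 → ℝ × ℝ × ℝ) ℂ)) (z₀ : ℂ) :=
      hstrict.hasFDerivAt.comp (z₀ : ℂ) (hasFDerivAt_prodMk_right a₀ (z₀ : ℂ))
    have h2 : HasFDerivAt (fun w : ℂ => H (a₀, w)) (ContinuousLinearMap.id ℝ ℂ) (z₀ : ℂ) :=
      (hasFDerivAt_id (z₀ : ℂ)).congr_of_eventuallyEq hid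
    intro w
    exact congrArg (fun M : ℂ →L[ℝ] ℂ => M w) (h1.unique h2)
  have hsmall := hstrict.isLittleO.def (c := 1 / 2) (by norm_num)
  have htend : Tendsto (fun p : ℕ × (ℂ × ℂ) => ((a p.1, p.2.1), (a p.1, p.2.2)))
      (atTop ×ˢ 𝓝 ((z₀ : ℂ), (z₀ : ℂ))) (𝓝 ((a₀, (z₀ : ℂ)), (a₀, (z₀ : ℂ)))) := by
    have e1 : Tendsto (fun p : ℕ × (ℂ × ℂ) => a p.1) (atTop ×ˢ 𝓝 ((z₀ : ℂ), (z₀ : ℂ))) (𝓝 a₀) :=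
      ha.comp tendsto_fst
    have e2 : Tendsto (fun p : ℕ × (ℂ × ℂ) => p.2.1) (atTop ×ˢ 𝓝 ((z₀ : ℂ), (z₀ : ℂ)))
        (𝓝 (z₀ : ℂ)) := (continuous_fst.tendsto ((z₀ : ℂ), (z₀ : ℂ))).comp tendsto_snd
    have e3 : Tendsto (fun p : ℕ × (ℂ × ℂ) => p.2.2) (atTop ×ˢ 𝓝 ((z₀ : ℂ), (z₀ : ℂ)))
        (𝓝 (z₀ : ℂ)) := (continuous_snd.tendsto ((z₀ : ℂ), (z₀ : ℂ))).comp tendsto_snd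
    exact (e1.prodMk_nhds e2).prodMk_nhds (e1.prodMk_nhds e3)
  have hloc2 : ∀ᶠ p : ℕ × (ℂ × ℂ) in atTop ×ˢ 𝓝 ((z₀ : ℂ), (z₀ : ℂ)),
      (∀ n, (meanMap R (τ n) (ofComplex p.2.1) : ℂ) = H (a n, p.2.1)) ∧
      (∀ n, (meanMap R (τ n) (ofComplex p.2.2) : ℂ) = H (a n, p.2.2)) := by
    rw [nhds_prod_eq]
    exact (tendsto_fst.comp tendsto_snd).eventually hloc |>.and
      ((tendsto_snd.comp tendsto_snd).eventually hloc)
  filter_upwards [htend.eventually hsmall, hloc2] with p hp hp2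
  rw [hp2.1, hp2.2]
  have e : ((a p.1, p.2.1) : (E → Fin 3 → ℝ × ℝ × ℝ) × ℂ) - (a p.1, p.2.2) =
      (0, p.2.1 - p.2.2) := by
    rw [Prod.mk_sub_mk, sub_self]
  simp only [e, hLid] at hp
  have e2 : ‖((0, p.2.1 - p.2.2) : (E → Fin 3 → ℝ × ℝ × ℝ) × ℂ)‖ = ‖p.2.1 - p.2.2‖ := by
    rw [Prod.norm_mk, norm_zero, max_eq_right (norm_nonneg _)]
  rw [e2] at hp
  exact hp

theorem tendsto_meanMap [DiscreteTopology Γ]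
    (hR : ∀ z : ℍ, ∃ σ : Γ, Real.cosh (dist z ((σ : ℍ ≃ᵢ ℍ) I)) < R)
    {τ : ℕ → Γ →* (ℍ ≃ᵢ ℍ)}
    (hτ : ∀ n, ∀ σ : Γ, ∃ g : Matrix.SpecialLinearGroup (Fin 2) ℝ, ∀ z,
      τ n σ (((σ⁻¹ : Γ) : ℍ ≃ᵢ ℍ) z) = g • z)
    (hlim : ∀ σ : Γ, Tendsto (fun n => τ n σ) atTop (𝓝 (σ : ℍ ≃ᵢ ℍ))) (z₀ : ℍ) :
    Tendsto (fun p : ℕ × ℍ => meanMap R (τ p.1) p.2) (atTop ×ˢ 𝓝 z₀) (𝓝 z₀) := by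
  obtain ⟨E, H, a, a₀, ha, hH, hid, hloc⟩ := exists_local_parametrization hR hτ hlim z₀
  have hcoe : Tendsto (fun p : ℕ × ℍ => (p.2 : ℂ)) (atTop ×ˢ 𝓝 z₀) (𝓝 (z₀ : ℂ)) :=
    (continuous_coe.tendsto z₀).comp tendsto_snd
  have e1 : Tendsto (fun p : ℕ × ℍ => a p.1) (atTop ×ˢ 𝓝 z₀) (𝓝 a₀) := ha.comp tendsto_fst
  have h1 := hH.continuousAt.tendsto.comp (e1.prodMk_nhds hcoe)
  rw [hid.self_of_nhds] at h1
  rw [isEmbedding_coe.tendsto_nhds_iff]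
  refine h1.congr' ?_
  filter_upwards [hcoe.eventually hloc] with p hp
  have := hp p.1
  rw [ofComplex_apply] at this
  exact this.symm

end EquivariantMapSequence

/-! ### Coarse geometry of the hyperbolic plane -/

/-- The geodesic which is the half circle of radius `ρ` centred at `c`, parametrized by arc
length. -/
def circleGeodesic (c ρ : ℝ) (hρ : 0 < ρ) (t : ℝ) : ℍ :=
  ⟨⟨c + ρ * Real.sinh t / Real.cosh t, ρ / Real.cosh t⟩, div_pos hρ (Real.cosh_pos t)⟩

theorem isometry_circleGeodesic (c ρ : ℝ) (hρ : 0 < ρ) : Isometry (circleGeodesic c ρ hρ) := by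
  refine Isometry.of_dist_eq fun s t => ?_
  have key : Real.cosh (dist (circleGeodesic c ρ hρ s) (circleGeodesic c ρ hρ t)) =
      Real.cosh (dist s t) := by
    rw [UpperHalfPlane.cosh_dist, Complex.dist_eq, ← Complex.normSq_eq_norm_sq,
      Complex.normSq_apply, Real.dist_eq, Real.cosh_abs, Real.cosh_sub]
    simp only [Complex.sub_re, Complex.sub_im, circleGeodesic, UpperHalfPlane.im]
    have h1 := Real.cosh_pos s
    have h2 := Real.cosh_pos t
    have h3 := Real.cosh_sq s
    have h4 := Real.cosh_sq t
    generalize Real.cosh s = a at *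
    generalize Real.cosh t = b at *
    generalize Real.sinh s = a' at *
    generalize Real.sinh t = b' at *
    field_simp
    linear_combination (-ρ ^ 2 * b ^ 2) * h3 - ρ ^ 2 * a ^ 2 * h4
  exact Real.cosh_strictMonoOn.injOn dist_nonneg dist_nonneg key

/-- The hyperbolic plane is geodesic. -/
theorem exists_geodesic (z w : ℍ) :
    ∃ γ : ℝ → ℍ, Isometry γ ∧ γ 0 = z ∧ γ (dist z w) = w := by
  suffices h : ∃ (γ : ℝ → ℍ) (s t : ℝ), Isometry γ ∧ γ s = z ∧ γ t = w by
    obtain ⟨γ, s, t, hγ, rfl, rfl⟩ := h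
    rw [hγ.dist_eq, Real.dist_eq]
    rcases le_total s t with hst | hst
    · refine ⟨fun x => γ (s + x), hγ.comp (Isometry.of_dist_eq fun x y => by simp), by simp, ?_⟩
      simp only [abs_of_nonpos (sub_nonpos.2 hst)]
      congr 1
      ring
    · refine ⟨fun x => γ (s - x), hγ.comp (Isometry.of_dist_eq fun x y => by
        rw [dist_sub_left]), by simp, ?_⟩
      simp only [abs_of_nonneg (sub_nonneg.2 hst)]
      congr 1
      ring
  have hz := z.im_pos
  have hw := w.im_pos
  rcases eq_or_ne z.re w.re with hre | hre
  · refine ⟨_, Real.log z.im, Real.log w.im, isometry_vertical_line z.re, ?_, ?_⟩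
    · ext
      apply Complex.ext
      · rfl
      · exact Real.exp_log hz
    · ext
      apply Complex.ext
      · exact hre
      · exact Real.exp_log hw
  · obtain ⟨c, hc⟩ : ∃ c, c = (w.re ^ 2 + w.im ^ 2 - z.re ^ 2 - z.im ^ 2) /
        (2 * (w.re - z.re)) := ⟨_, rfl⟩
    have hne : w.re - z.re ≠ 0 := sub_ne_zero.2 hre.symm
    obtain ⟨ρ, hρ⟩ : ∃ ρ, ρ = √((z.re - c) ^ 2 + z.im ^ 2) := ⟨_, rfl⟩
    have hρ0 : 0 < ρ := hρ ▸ Real.sqrt_pos.2 (by positivity)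
    have hρz : ρ ^ 2 = (z.re - c) ^ 2 + z.im ^ 2 := by rw [hρ, Real.sq_sqrt (by positivity)]
    have hρw : ρ ^ 2 = (w.re - c) ^ 2 + w.im ^ 2 := by
      have : c * (2 * (w.re - z.re)) = w.re ^ 2 + w.im ^ 2 - z.re ^ 2 - z.im ^ 2 := by
        rw [hc]; field_simp
      rw [hρz]
      linear_combination this
    have key : ∀ v : ℍ, ρ ^ 2 = (v.re - c) ^ 2 + v.im ^ 2 →
        circleGeodesic c ρ hρ0 (Real.arsinh ((v.re - c) / v.im)) = v := by
      intro v hv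
      have hv0 := v.im_pos
      have h1 : Real.cosh (Real.arsinh ((v.re - c) / v.im)) = ρ / v.im := by
        rw [Real.cosh_arsinh, Real.sqrt_eq_iff_mul_self_eq (by positivity) (by positivity)]
        field_simp
        linear_combination -hv
      ext
      apply Complex.ext
      · change c + ρ * Real.sinh _ / Real.cosh _ = v.re
        rw [h1, Real.sinh_arsinh]
        field_simp
        ring
      · change ρ / Real.cosh _ = v.im
        rw [h1]
        field_simp
    exact ⟨_, _, _, isometry_circleGeodesic c ρ hρ0, key z hρz, key w hρw⟩

/-- The Ptolemy inequality for the chords `sinh (d / 2)` of the hyperbolic plane. -/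
theorem sinh_half_dist_mul_le (a b c d : ℍ) :
    Real.sinh (dist a b / 2) * Real.sinh (dist c d / 2) ≤
      Real.sinh (dist a c / 2) * Real.sinh (dist b d / 2) +
        Real.sinh (dist a d / 2) * Real.sinh (dist b c / 2) := by
  have hP := EuclideanGeometry.mul_dist_le_mul_dist_add_mul_dist (a : ℂ) (c : ℂ) (b : ℂ) (d : ℂ)
  simp only [UpperHalfPlane.sinh_half_dist]
  have ha := Real.sqrt_pos.2 a.im_pos
  have hb := Real.sqrt_pos.2 b.im_pos
  have hc := Real.sqrt_pos.2 c.im_pos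
  have hd := Real.sqrt_pos.2 d.im_pos
  rw [Real.sqrt_mul a.im_pos.le, Real.sqrt_mul a.im_pos.le, Real.sqrt_mul a.im_pos.le,
    Real.sqrt_mul b.im_pos.le, Real.sqrt_mul b.im_pos.le, Real.sqrt_mul c.im_pos.le]
  generalize √a.im = a' at *
  generalize √b.im = b' at *
  generalize √c.im = c' at *
  generalize √d.im = d' at *
  rw [dist_comm (c : ℂ) (b : ℂ)] at hP
  have e : ∀ x y : ℝ, x / (2 * (a' * b')) * (y / (2 * (c' * d'))) =
    (x * y) / (4 * (a' * b' * c' * d')) := fun x y => by field_simp; ring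
  have e2 : ∀ x y : ℝ, x / (2 * (a' * c')) * (y / (2 * (b' * d'))) =
    (x * y) / (4 * (a' * b' * c' * d')) := fun x y => by field_simp; ring
  have e3 : ∀ x y : ℝ, x / (2 * (a' * d')) * (y / (2 * (b' * c'))) =
    (x * y) / (4 * (a' * b' * c' * d')) := fun x y => by field_simp; ring
  rw [e, e2, e3, ← add_div]
  refine div_le_div_of_nonneg_right ?_ (by positivity)
  linarith

/-- The four point condition: the hyperbolic plane is Gromov hyperbolic. -/
theorem dist_add_dist_le_max_add (a b c d : ℍ) (hab : 2 ≤ dist a b) (hcd : 2 ≤ dist c d) :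
    dist a b + dist c d ≤ max (dist a c + dist b d) (dist a d + dist b c) + 6 := by
  -- at distances `x ≥ 2`, the chord `sinh (x / 2)` is `exp (x / 2)` up to a factor in `[1/4, 1/2]`
  have hlow : ∀ x : ℝ, 2 ≤ x → Real.exp (x / 2) / 4 ≤ Real.sinh (x / 2) := by
    intro x hx
    have h1 : Real.exp (-(x / 2)) ≤ 1 := Real.exp_le_one_iff.2 (by linarith)
    have h2 : x / 2 + 1 ≤ Real.exp (x / 2) := Real.add_one_le_exp _
    rw [Real.sinh_eq]
    linarith
  have hup : ∀ x : ℝ, 0 ≤ x → Real.sinh (x / 2) ≤ Real.exp (x / 2) / 2 := by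
    intro x hx
    have := Real.exp_pos (-(x / 2))
    rw [Real.sinh_eq]
    linarith
  have hnn : ∀ x : ℝ, 0 ≤ x → 0 ≤ Real.sinh (x / 2) := fun x hx =>
    Real.sinh_nonneg_iff.2 (by linarith)
  obtain ⟨M, hM⟩ : ∃ M, M = max (dist a c + dist b d) (dist a d + dist b c) := ⟨_, rfl⟩
  have h1 := sinh_half_dist_mul_le a b c d
  have h2 := mul_le_mul (hlow _ hab) (hlow _ hcd) (by positivity) (hnn _ dist_nonneg)
  have h3 := mul_le_mul (hup _ (dist_nonneg (x := a) (y := c)))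
    (hup _ (dist_nonneg (x := b) (y := d))) (hnn _ dist_nonneg) (by positivity)
  have h4 := mul_le_mul (hup _ (dist_nonneg (x := a) (y := d)))
    (hup _ (dist_nonneg (x := b) (y := c))) (hnn _ dist_nonneg) (by positivity)
  have hexp : ∀ x y k : ℝ, Real.exp (x / 2) / k * (Real.exp (y / 2) / k) =
      Real.exp ((x + y) / 2) / k ^ 2 := by
    intro x y k
    rw [add_div, Real.exp_add]
    ring
  rw [hexp] at h2 h3 h4
  have hM1 : dist a c + dist b d ≤ M := hM ▸ le_max_left _ _
  have hM2 : dist a d + dist b c ≤ M := hM ▸ le_max_right _ _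
  have h5 : Real.exp ((dist a c + dist b d) / 2) ≤ Real.exp (M / 2) :=
    Real.exp_le_exp.2 (by linarith)
  have h6 : Real.exp ((dist a d + dist b c) / 2) ≤ Real.exp (M / 2) :=
    Real.exp_le_exp.2 (by linarith)
  have h7 : (8 : ℝ) ≤ Real.exp 3 := by
    have h8 : (1 : ℝ) + 1 ≤ Real.exp 1 := Real.add_one_le_exp 1
    have h9 : Real.exp 3 = Real.exp 1 ^ 3 := by rw [← Real.exp_nat_mul]; norm_num
    rw [h9]
    calc (8 : ℝ) = (1 + 1) ^ 3 := by norm_num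
      _ ≤ _ := pow_le_pow_left₀ (by norm_num) h8 3
  have h10 : Real.exp ((dist a b + dist c d) / 2) ≤ Real.exp ((M + 6) / 2) := by
    have e : Real.exp ((M + 6) / 2) = Real.exp 3 * Real.exp (M / 2) := by
      rw [← Real.exp_add]; congr 1; ring
    rw [e]
    have := mul_le_mul_of_nonneg_right h7 (Real.exp_pos (M / 2)).le
    linarith
  rw [← hM]
  have := Real.exp_le_exp.1 h10
  linarith

/-- A sequence of points which looks like a geodesic at a large scale makes definite progress:
local quasi-geodesics are global quasi-geodesics. -/
theorem mul_le_dist_of_local {L : ℝ} (hL : 16 ≤ L) {p : ℕ → ℍ} {m : ℕ}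
    (h1 : ∀ k < m, |dist (p k) (p (k + 1)) - L| ≤ 1)
    (h2 : ∀ k, k + 1 < m → 2 * L - 1 ≤ dist (p k) (p (k + 2))) :
    m * (L / 2) ≤ dist (p 0) (p m) := by
  have key : ∀ k < m, dist (p 0) (p k) + L / 2 ≤ dist (p 0) (p (k + 1)) := by
    intro k
    induction k with
    | zero =>
      intro hk
      have := (abs_le.1 (h1 0 hk)).1
      rw [dist_self]
      linarith
    | succ k ih =>
      intro hk
      have hi := ih (by omega)
      have e1 := (abs_le.1 (h1 k (by omega))).2
      have e2 := (abs_le.1 (h1 (k + 1) hk)).2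
      have e3 := h2 k hk
      have h0 : 0 ≤ dist (p 0) (p k) := dist_nonneg
      -- of the two sums of opposite distances, the one which contains `d(p₀, pₖ₊₂)` is the larger
      have h4 := dist_add_dist_le_max_add (p 0) (p (k + 1)) (p k) (p (k + 2)) (by linarith)
        (by linarith)
      rw [dist_comm (p (k + 1)) (p k)] at h4
      change dist (p (k + 1)) (p (k + 2)) - L ≤ 1 at e2
      change dist (p 0) (p (k + 1)) + L / 2 ≤ dist (p 0) (p (k + 2))
      rcases le_total (dist (p 0) (p k) + dist (p (k + 1)) (p (k + 2)))
        (dist (p 0) (p (k + 2)) + dist (p k) (p (k + 1))) with h5 | h5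
      · rw [max_eq_right h5] at h4
        linarith
      · rw [max_eq_left h5] at h4
        linarith
  have : ∀ k ≤ m, k * (L / 2) ≤ dist (p 0) (p k) := by
    intro k
    induction k with
    | zero => intro _; simp
    | succ k ih =>
      intro hk
      have h3 := ih (by omega)
      have h4 := key k (by omega)
      push_cast
      linarith
  exact this m le_rfl

/-- A map which almost preserves distances up to a large scale is a quasi-isometric embedding. -/
theorem half_dist_le_of_almost_isometry {f : ℍ → ℍ}
    (hf : ∀ z w, dist z w ≤ 64 → |dist (f z) (f w) - dist z w| ≤ 1) {z w : ℍ}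
    (hzw : 16 ≤ dist z w) : dist z w / 2 ≤ dist (f z) (f w) := by
  obtain ⟨γ, hγ, h0, h1⟩ := exists_geodesic z w
  obtain ⟨D, hD⟩ : ∃ D, D = dist z w := ⟨_, rfl⟩
  rw [← hD] at h1 hzw ⊢
  -- divide the geodesic into `m` steps of length `L`, where `16 ≤ L ≤ 32`
  obtain ⟨m, hm⟩ : ∃ m, m = ⌊D / 16⌋₊ := ⟨_, rfl⟩
  have hm1 : (m : ℝ) ≤ D / 16 := hm ▸ Nat.floor_le (by linarith)
  have hm2 : D / 16 < m + 1 := hm ▸ Nat.lt_floor_add_one _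
  have hm3 : 1 ≤ m := by
    rw [hm]
    exact Nat.le_floor (by push_cast; linarith)
  have hm4 : (1 : ℝ) ≤ m := by exact_mod_cast hm3
  obtain ⟨L, hL⟩ : ∃ L, L = D / m := ⟨_, rfl⟩
  have hmL : m * L = D := by rw [hL]; field_simp
  have hL1 : 16 ≤ L := by
    rw [hL, le_div_iff₀ (by linarith)]
    linarith
  have hL2 : L ≤ 32 := by
    rw [hL, div_le_iff₀ (by linarith)]
    linarith
  have hd1 : ∀ k : ℕ, dist (γ (k * L)) (γ ((k + 1 : ℕ) * L)) = L := by
    intro k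
    rw [hγ.dist_eq, Real.dist_eq]
    push_cast
    rw [show (k : ℝ) * L - (k + 1) * L = -L by ring, abs_neg, abs_of_nonneg (by linarith)]
  have hd2 : ∀ k : ℕ, dist (γ (k * L)) (γ ((k + 2 : ℕ) * L)) = 2 * L := by
    intro k
    rw [hγ.dist_eq, Real.dist_eq]
    push_cast
    rw [show (k : ℝ) * L - (k + 2) * L = -(2 * L) by ring, abs_neg, abs_of_nonneg (by linarith)]
  have h := mul_le_dist_of_local hL1 (p := fun k => f (γ (k * L))) (m := m)
    (fun k _ => by
      have := hf (γ (k * L)) (γ ((k + 1 : ℕ) * L)) (by rw [hd1]; linarith)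
      rwa [hd1] at this)
    (fun k _ => by
      have := hf (γ (k * L)) (γ ((k + 2 : ℕ) * L)) (by rw [hd2]; linarith)
      rw [hd2] at this
      linarith [(abs_le.1 this).1])
  simp only [Nat.cast_zero, zero_mul, h0, hmL, h1] at h
  linarith

/-! ### Equivariant maps close to the identity are homeomorphisms -/

section ApproxIdentity

open Set

/-- A sequence of maps `F n`, equivariant with respect to representations `τ n` of `Γ`, which tends
to the identity locally uniformly, together with the difference quotients. -/
structure IsApproxIdentity (Γ : Subgroup (ℍ ≃ᵢ ℍ)) (τ : ℕ → Γ →* (ℍ ≃ᵢ ℍ)) (F : ℕ → ℍ → ℍ) :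
    Prop where
  apply_smul : ∀ n (σ : Γ) z, F n ((σ : ℍ ≃ᵢ ℍ) z) = τ n σ (F n z)
  tendsto : ∀ z₀, Tendsto (fun p : ℕ × ℍ => F p.1 p.2) (atTop ×ˢ 𝓝 z₀) (𝓝 z₀)
  norm_sub_le : ∀ z₀ : ℍ, ∀ᶠ p : ℕ × (ℂ × ℂ) in atTop ×ˢ 𝓝 ((z₀ : ℂ), (z₀ : ℂ)),
    ‖((F p.1 (ofComplex p.2.1) : ℂ) - F p.1 (ofComplex p.2.2)) - (p.2.1 - p.2.2)‖ ≤
      1 / 2 * ‖p.2.1 - p.2.2‖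

namespace IsApproxIdentity

variable {Γ : Subgroup (ℍ ≃ᵢ ℍ)} {τ : ℕ → Γ →* (ℍ ≃ᵢ ℍ)} {F : ℕ → ℍ → ℍ}
  (hF : IsApproxIdentity Γ τ F)
include hF

theorem eventually_dist_le_of_isCompact {K : Set ℍ} (hK : IsCompact K) {ε : ℝ} (hε : 0 < ε) :
    ∀ᶠ n in atTop, ∀ z ∈ K, dist (F n z) z ≤ ε := by
  refine hK.induction_on (by simp) ?_ ?_ ?_
  · intro s t hst ht
    filter_upwards [ht] with n hn z hz using hn z (hst hz)
  · intro s t hs ht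
    filter_upwards [hs, ht] with n h1 h2 z hz
    exact hz.elim (h1 z) (h2 z)
  · intro z₀ _
    have h1 : Tendsto (fun p : ℕ × ℍ => dist (F p.1 p.2) p.2) (atTop ×ˢ 𝓝 z₀) (𝓝 0) := by
      have := (hF.tendsto z₀).dist (tendsto_snd (f := (atTop : Filter ℕ)) (g := 𝓝 z₀))
      rwa [dist_self] at this
    obtain ⟨p, hp, q, hq, hpq⟩ := eventually_prod_iff.1 (h1.eventually (gt_mem_nhds hε))
    refine ⟨{z | q z}, mem_nhdsWithin_of_mem_nhds hq, ?_⟩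
    filter_upwards [hp] with n hn z hz using (hpq hn hz).le

/-- The estimate on difference quotients holds at a uniform scale on compact sets. -/
theorem exists_radius {K : Set ℍ} (hK : IsCompact K) :
    ∃ r > 0, ∀ᶠ n in atTop, ∀ z ∈ K, ∀ w ∈ Metric.ball z r, ∀ w' ∈ Metric.ball z r,
      ‖((F n w : ℂ) - F n w') - ((w : ℂ) - w')‖ ≤ 1 / 2 * ‖(w : ℂ) - w'‖ := by
  refine hK.induction_on ⟨1, one_pos, by simp⟩ ?_ ?_ ?_
  · rintro s t hst ⟨r, hr, ht⟩
    refine ⟨r, hr, ?_⟩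
    filter_upwards [ht] with n hn z hz using hn z (hst hz)
  · rintro s t ⟨r, hr, hs⟩ ⟨r', hr', ht⟩
    refine ⟨min r r', lt_min hr hr', ?_⟩
    filter_upwards [hs, ht] with n h1 h2 z hz w hw w' hw'
    rcases hz with hz | hz
    · exact h1 z hz w (Metric.ball_subset_ball (min_le_left _ _) hw) w'
        (Metric.ball_subset_ball (min_le_left _ _) hw')
    · exact h2 z hz w (Metric.ball_subset_ball (min_le_right _ _) hw) w'
        (Metric.ball_subset_ball (min_le_right _ _) hw')
  · intro z₀ _
    have htend : Tendsto (fun p : ℕ × (ℍ × ℍ) => (p.1, ((p.2.1 : ℂ), (p.2.2 : ℂ))))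
        (atTop ×ˢ 𝓝 (z₀, z₀)) (atTop ×ˢ 𝓝 ((z₀ : ℂ), (z₀ : ℂ))) := by
      have h1 : Tendsto (fun p : ℍ × ℍ => ((p.1 : ℂ), (p.2 : ℂ))) (𝓝 (z₀, z₀))
          (𝓝 ((z₀ : ℂ), (z₀ : ℂ))) := (continuous_coe.prodMap continuous_coe).tendsto (z₀, z₀)
      exact tendsto_fst.prodMk (h1.comp tendsto_snd)
    obtain ⟨p, hp, q, hq, hpq⟩ := eventually_prod_iff.1
      (htend.eventually (hF.norm_sub_le z₀))
    obtain ⟨ρ, hρ, hball⟩ := Metric.eventually_nhds_iff_ball.1 hq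
    refine ⟨Metric.ball z₀ (ρ / 2), mem_nhdsWithin_of_mem_nhds
      (Metric.ball_mem_nhds _ (by positivity)), ρ / 2, by positivity, ?_⟩
    filter_upwards [hp] with n hn z hz w hw w' hw'
    have hz' := Metric.mem_ball.1 hz
    have hsub : ∀ v ∈ Metric.ball z (ρ / 2), dist v z₀ < ρ := fun v hv => by
      linarith [dist_triangle v z z₀, Metric.mem_ball.1 hv]
    have := hpq hn (hball (w, w') (by
      rw [Metric.mem_ball, Prod.dist_eq]
      exact max_lt (hsub w hw) (hsub w' hw')))
    simpa only [ofComplex_apply] using this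

variable [CompactSpace (Quo Γ)]

/-- For large `n`, the maps `F n` almost preserve distances up to any given scale, uniformly on the
whole hyperbolic plane. -/
theorem eventually_almost_isometry (L : ℝ) {ε : ℝ} (hε : 0 < ε) :
    ∀ᶠ n in atTop, ∀ z w, dist z w ≤ L → |dist (F n z) (F n w) - dist z w| ≤ ε := by
  obtain ⟨R, -, hR⟩ := exists_forall_dist_le (Γ := Γ) I
  filter_upwards [hF.eventually_dist_le_of_isCompact (isCompact_closedBall I (R + L))
    (half_pos hε)] with n hn z w hzw
  obtain ⟨σ, hσ⟩ := hR z
  have e1 : dist (F n z) (F n w) = dist (F n ((σ : ℍ ≃ᵢ ℍ) z)) (F n ((σ : ℍ ≃ᵢ ℍ) w)) := by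
    rw [hF.apply_smul, hF.apply_smul, (τ n σ).isometry.dist_eq]
  have e2 : dist z w = dist ((σ : ℍ ≃ᵢ ℍ) z) ((σ : ℍ ≃ᵢ ℍ) w) :=
    ((σ : ℍ ≃ᵢ ℍ).isometry.dist_eq _ _).symm
  rw [e1]
  rw [e2] at hzw ⊢
  generalize (σ : ℍ ≃ᵢ ℍ) z = z' at *
  generalize (σ : ℍ ≃ᵢ ℍ) w = w' at *
  have h1 := hn z' (by rw [Metric.mem_closedBall, dist_comm]; linarith [dist_nonneg.trans hzw])
  have h2 := hn w' (by
    rw [Metric.mem_closedBall, dist_comm]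
    linarith [dist_triangle I z' w'])
  have h3 := dist_dist_dist_le (F n z') (F n w') z' w'
  rw [Real.dist_eq] at h3
  linarith

/-- The maps `F n` are, eventually, uniformly proper. -/
theorem eventually_half_dist_le :
    ∀ᶠ n in atTop, ∀ z w, 16 ≤ dist z w → dist z w / 2 ≤ dist (F n z) (F n w) := by
  filter_upwards [hF.eventually_almost_isometry 64 one_pos] with n hn z w hzw
  exact half_dist_le_of_almost_isometry hn hzw

/-- Points with the same image are close, by the estimates at large and at bounded distances, and
then they agree, by the estimate on difference quotients. -/
theorem eventually_injective : ∀ᶠ n in atTop, Function.Injective (F n) := by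
  obtain ⟨R, -, hR⟩ := exists_forall_dist_le (Γ := Γ) I
  obtain ⟨r, hr, hloc⟩ := hF.exists_radius (isCompact_closedBall I R)
  filter_upwards [hF.eventually_half_dist_le, hF.eventually_almost_isometry 16 (half_pos hr), hloc]
    with n h1 h2 h3 z w hzw
  have hd : dist z w < r := by
    rcases le_total 16 (dist z w) with h | h
    · have := h1 z w h
      rw [hzw, dist_self] at this
      linarith
    · have := h2 z w h
      rw [hzw, dist_self, zero_sub, abs_neg, abs_of_nonneg dist_nonneg] at this
      linarith
  obtain ⟨σ, hσ⟩ := hR z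
  have h4 := h3 ((σ : ℍ ≃ᵢ ℍ) z) (by rw [Metric.mem_closedBall, dist_comm]; exact hσ.le)
    ((σ : ℍ ≃ᵢ ℍ) z) (Metric.mem_ball_self hr) ((σ : ℍ ≃ᵢ ℍ) w) (by
      rw [Metric.mem_ball, (σ : ℍ ≃ᵢ ℍ).isometry.dist_eq, dist_comm]
      exact hd)
  rw [hF.apply_smul, hF.apply_smul, hzw, sub_self, zero_sub, norm_neg] at h4
  have h5 : ((((σ : ℍ ≃ᵢ ℍ) z : ℍ) : ℂ)) - ((σ : ℍ ≃ᵢ ℍ) w : ℍ) = 0 := by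
    rw [← norm_eq_zero]
    linarith [norm_nonneg (((((σ : ℍ ≃ᵢ ℍ) z : ℍ) : ℂ)) - ((σ : ℍ ≃ᵢ ℍ) w : ℍ))]
  exact (σ : ℍ ≃ᵢ ℍ).injective (UpperHalfPlane.ext (sub_eq_zero.1 h5))

/-- The maps `F n` are, eventually, continuous and open. -/
theorem eventually_map_nhds : ∀ᶠ n in atTop, ∀ z, map (F n) (𝓝 z) = 𝓝 (F n z) := by
  obtain ⟨R, -, hR⟩ := exists_forall_dist_le (Γ := Γ) I
  obtain ⟨r, hr, hloc⟩ := hF.exists_radius (isCompact_closedBall I R)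
  filter_upwards [hloc] with n hn
  have hK : ∀ z ∈ Metric.closedBall I R, map (F n) (𝓝 z) = 𝓝 (F n z) := by
    intro z hz
    obtain ⟨f, hf⟩ : ∃ f : ℂ → ℂ, f = fun w => (F n (ofComplex w) : ℂ) := ⟨_, rfl⟩
    have hfc : ∀ w : ℍ, f w = F n w := fun w => by rw [hf]; simp only [ofComplex_apply]
    have happ : ApproximatesLinearOn f
        ((ContinuousLinearEquiv.refl ℝ ℂ : ℂ ≃L[ℝ] ℂ) : ℂ →L[ℝ] ℂ)
        ((fun w : ℍ => (w : ℂ)) '' Metric.ball z r) (1 / 2) := by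
      rw [ApproximatesLinearOn]
      rintro _ ⟨w, hw, rfl⟩ _ ⟨w', hw', rfl⟩
      have := hn z hz w hw w' hw'
      rw [hfc, hfc]
      simpa using this
    have hmem : ((fun w : ℍ => (w : ℂ)) '' Metric.ball z r) ∈ 𝓝 (z : ℂ) :=
      isOpenEmbedding_coe.image_mem_nhds.2 (Metric.ball_mem_nhds z hr)
    have hnorm : ‖((ContinuousLinearEquiv.refl ℝ ℂ).symm : ℂ →L[ℝ] ℂ)‖₊ = 1 := by
      ext
      exact ContinuousLinearMap.norm_id
    have h1 := happ.map_nhds_eq (ContinuousLinearEquiv.refl ℝ ℂ).toNonlinearRightInverse hmem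
      (Or.inr (by
        change _ < (‖((ContinuousLinearEquiv.refl ℝ ℂ).symm : ℂ →L[ℝ] ℂ)‖₊)⁻¹
        rw [hnorm, inv_one]
        exact NNReal.half_lt_self one_ne_zero))
    rw [hfc, ← isOpenEmbedding_coe.map_nhds_eq, ← isOpenEmbedding_coe.map_nhds_eq, map_map] at h1
    refine map_injective isOpenEmbedding_coe.injective ?_
    rw [← h1, map_map]
    congr 1
    funext w
    exact (hfc w).symm
  intro z
  obtain ⟨σ, hσ⟩ := hR z
  have h1 := hK ((σ : ℍ ≃ᵢ ℍ) z) (by rw [Metric.mem_closedBall, dist_comm]; exact hσ.le)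
  have h2 : map (σ : ℍ ≃ᵢ ℍ) (𝓝 z) = 𝓝 ((σ : ℍ ≃ᵢ ℍ) z) :=
    (σ : ℍ ≃ᵢ ℍ).toHomeomorph.map_nhds_eq z
  have h3 : map (τ n σ) (𝓝 (F n z)) = 𝓝 (τ n σ (F n z)) :=
    (τ n σ).toHomeomorph.map_nhds_eq (F n z)
  rw [← h2, hF.apply_smul, ← h3, map_map] at h1
  refine map_injective (τ n σ).injective ?_
  rw [← h1, map_map]
  congr 1
  funext w
  exact (hF.apply_smul n σ w).symm

/-- Eventually `F n` is an open embedding with closed image, so it is onto by connectedness. -/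
theorem eventually_exists_homeomorph : ∀ᶠ n in atTop, ∃ e : ℍ ≃ₜ ℍ, ⇑e = F n := by
  filter_upwards [hF.eventually_injective, hF.eventually_map_nhds, hF.eventually_half_dist_le]
    with n hinj hmap hhalf
  have hcont : Continuous (F n) := continuous_iff_continuousAt.2 fun z => (hmap z).le
  have hopen : IsOpenMap (F n) := isOpenMap_iff_nhds_le.2 fun z => (hmap z).ge
  have hclosed : IsClosed (range (F n)) := by
    rw [isClosed_iff_ultrafilter]
    intro w 𝒰 hle hmem
    obtain ⟨g, hg⟩ : ∃ g : ℍ → ℍ, ∀ v ∈ range (F n), F n (g v) = v := by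
      refine ⟨fun v => Function.invFun (F n) v, fun v hv => Function.invFun_eq hv⟩
    have hid : Tendsto (fun v => F n (g v)) 𝒰 (𝓝 w) := by
      refine Tendsto.congr' (f₁ := id) ?_ hle
      filter_upwards [hmem] with v hv using (hg v hv).symm
    obtain ⟨z, hz⟩ := exists_ultrafilter_lim 𝒰 g I (16 + 2 * (dist (F n I) w + 1)) (by
      have h1 := (tendsto_iff_dist_tendsto_zero.1 hid).eventually (gt_mem_nhds one_pos)
      filter_upwards [h1] with v hv
      rcases le_total 16 (dist I (g v)) with h | h
      · have h2 := hhalf _ _ h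
        have h3 := dist_triangle (F n I) w (F n (g v))
        rw [dist_comm w] at h3
        linarith
      · linarith [dist_nonneg (x := F n I) (y := w)])
    exact ⟨z, tendsto_nhds_unique ((hcont.tendsto z).comp hz) hid⟩
  have hsurj : Function.Surjective (F n) := range_eq_univ.1
    (IsClopen.eq_univ ⟨hclosed, hopen.isOpen_range⟩ ⟨_, mem_range_self I⟩)
  exact ⟨(Equiv.ofBijective (F n) ⟨hinj, hsurj⟩).toHomeomorphOfContinuousOpen hcont hopen, rfl⟩

end IsApproxIdentity

end ApproxIdentity

/-! ### Uniform convergence of the quotient distances -/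

section Convergence

open Set

variable {Γ : Subgroup (ℍ ≃ᵢ ℍ)} {T : ℝ}

theorem Admissible.mono {T' : ℝ} {u : ℍ → ℝ} (hu : Admissible T u) (h : ∀ z, Real.tan (u z) ≤ T') :
    Admissible T' u :=
  ⟨hu.nonneg, hu.lt_pi_div_two, h, hu.support⟩

/-- An equivariant homeomorphism induces a homeomorphism of the quotients. -/
theorem exists_quo_homeomorph {Γ' : Subgroup (ℍ ≃ᵢ ℍ)} (τ : Γ ≃* Γ') (e : ℍ ≃ₜ ℍ)
    (he : ∀ (σ : Γ) z, e ((σ : ℍ ≃ᵢ ℍ) z) = (τ σ : ℍ ≃ᵢ ℍ) (e z)) :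
    ∃ f : Quo Γ ≃ₜ Quo Γ', ∀ z, f (Quotient.mk _ z) = Quotient.mk _ (e z) := by
  have hrel : ∀ z w : ℍ, (MulAction.orbitRel Γ ℍ) z w ↔ (MulAction.orbitRel Γ' ℍ) (e z) (e w) := by
    intro z w
    change (∃ σ : Γ, (σ : ℍ ≃ᵢ ℍ) w = z) ↔ ∃ σ : Γ', (σ : ℍ ≃ᵢ ℍ) (e w) = e z
    constructor
    · rintro ⟨σ, rfl⟩
      exact ⟨τ σ, (he σ w).symm⟩
    · rintro ⟨σ, hσ⟩
      refine ⟨τ.symm σ, e.injective ?_⟩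
      rw [he, MulEquiv.apply_symm_apply, hσ]
  refine ⟨{ toEquiv := Quotient.congr e.toEquiv hrel
            continuous_toFun := ?_
            continuous_invFun := ?_ }, fun z => rfl⟩
  · exact Continuous.quotient_map' e.continuous fun z w h => (hrel z w).1 h
  · refine Continuous.quotient_map' e.symm.continuous fun z w h => (hrel _ _).2 ?_
    rwa [e.apply_symm_apply, e.apply_symm_apply]

/-- Limits of invariant functions are invariant under the limit group. -/
theorem invariant_of_tendsto {Tn : ℕ → ℝ} {un : ℕ → ℍ → ℝ} {u : ℍ → ℝ}
    (hun : ∀ n, Admissible (Tn n) (un n)) (hu : Admissible T u)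
    (hlim : ∀ z, Tendsto (fun n => un n z) atTop (𝓝 (u z)))
    {τ : ℕ → Γ →* (ℍ ≃ᵢ ℍ)} (hinv : ∀ n (σ : Γ) z, un n (τ n σ z) = un n z)
    (hτ : ∀ σ : Γ, Tendsto (fun n => τ n σ) atTop (𝓝 (σ : ℍ ≃ᵢ ℍ))) (σ : Γ) (z : ℍ) :
    u ((σ : ℍ ≃ᵢ ℍ) z) = u z := by
  have htan : ∀ z, Tendsto (fun n => Real.tan (un n z)) atTop (𝓝 (Real.tan (u z))) := fun z =>
    (Real.continuousAt_tan.2 (hu.cos_pos z).ne').tendsto.comp (hlim z)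
  have key : ∀ (σ : Γ) z, Real.tan (u z) ≤ Real.tan (u ((σ : ℍ ≃ᵢ ℍ) z)) := by
    intro σ z
    have h1 : Tendsto (fun n => Real.exp (dist ((σ : ℍ ≃ᵢ ℍ) z) (τ n σ z)) *
        Real.tan (un n ((σ : ℍ ≃ᵢ ℍ) z))) atTop
        (𝓝 (Real.exp 0 * Real.tan (u ((σ : ℍ ≃ᵢ ℍ) z)))) := by
      refine Tendsto.mul ?_ (htan _)
      refine (Real.continuous_exp.tendsto 0).comp ?_
      have := tendsto_const_nhds (x := (σ : ℍ ≃ᵢ ℍ) z) |>.dist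
        (tendsto_isometryEquiv_iff.1 (hτ σ) z)
      rwa [dist_self] at this
    rw [Real.exp_zero, one_mul] at h1
    refine le_of_tendsto_of_tendsto' (htan z) h1 fun n => ?_
    have := (hun n).tan_le_exp_mul ((σ : ℍ ≃ᵢ ℍ) z) (τ n σ z)
    rwa [hinv] at this
  have h1 := key σ z
  have h2 := key σ⁻¹ ((σ : ℍ ≃ᵢ ℍ) z)
  have e : ((σ⁻¹ : Γ) : ℍ ≃ᵢ ℍ) ((σ : ℍ ≃ᵢ ℍ) z) = z := (σ : ℍ ≃ᵢ ℍ).symm_apply_apply z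
  rw [e] at h2
  rw [← hu.arctan_tan, ← hu.arctan_tan z, le_antisymm h2 h1]

namespace IsApproxIdentity

variable {τ : ℕ → Γ →* (ℍ ≃ᵢ ℍ)} {F : ℕ → ℍ → ℍ} (hF : IsApproxIdentity Γ τ F)
include hF

theorem comp_tendsto {φ : ℕ → ℕ} (hφ : Tendsto φ atTop atTop) :
    IsApproxIdentity Γ (fun k => τ (φ k)) (fun k => F (φ k)) where
  apply_smul k := hF.apply_smul (φ k)
  tendsto z₀ := (hF.tendsto z₀).comp (hφ.prodMap tendsto_id)
  norm_sub_le z₀ := (hφ.prodMap tendsto_id).eventually (hF.norm_sub_le z₀)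

/-- Invariant functions which converge at a point have uniformly bounded tangents: they are
controlled by their values on a compact set which meets all orbits. -/
theorem exists_eventually_tan_le [CompactSpace (Quo Γ)] {Tn : ℕ → ℝ} {un : ℕ → ℍ → ℝ} {u : ℍ → ℝ}
    (hun : ∀ n, Admissible (Tn n) (un n)) (hu : Admissible T u)
    (hlim : ∀ z, Tendsto (fun n => un n z) atTop (𝓝 (u z)))
    (hinv : ∀ n (σ : Γ) z, un n (τ n σ z) = un n z) :
    ∃ T', ∀ᶠ n in atTop, ∀ z, Real.tan (un n z) ≤ T' := by
  obtain ⟨R, hR0, hR⟩ := exists_forall_dist_le (Γ := Γ) I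
  have htan : Tendsto (fun n => Real.tan (un n I)) atTop (𝓝 (Real.tan (u I))) :=
    (Real.continuousAt_tan.2 (hu.cos_pos I).ne').tendsto.comp (hlim I)
  refine ⟨Real.exp (R + 1) * (Real.tan (u I) + 1), ?_⟩
  filter_upwards [hF.eventually_exists_homeomorph,
    hF.eventually_dist_le_of_isCompact (isCompact_closedBall I R) one_pos,
    htan.eventually (gt_mem_nhds (lt_add_one _))] with n ⟨e, he⟩ hd ht z
  obtain ⟨w, rfl⟩ := e.surjective z
  rw [he]
  obtain ⟨σ, hσ⟩ := hR w
  have h1 := hd ((σ : ℍ ≃ᵢ ℍ) w) (by rw [Metric.mem_closedBall, dist_comm]; exact hσ.le)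
  rw [← hinv n σ, ← hF.apply_smul]
  refine ((hun n).tan_le_exp_mul I _).trans (mul_le_mul ?_ ht.le ((hun n).tan_nonneg I)
    (Real.exp_pos _).le)
  refine Real.exp_le_exp.2 ?_
  have h2 := dist_triangle I ((σ : ℍ ≃ᵢ ℍ) w) (F n ((σ : ℍ ≃ᵢ ℍ) w))
  rw [dist_comm ((σ : ℍ ≃ᵢ ℍ) w)] at h2
  linarith

variable {un : ℕ → ℍ → ℝ} {u : ℍ → ℝ} (H : AdmissibleLimit T un u)
include H

/-- The distances induced by `un n`, pulled back by `F n`, converge uniformly on compact sets. -/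
theorem eventually_abs_inducedDist_sub_le {K : Set (ℍ × ℍ)} (hK : IsCompact K) {ε : ℝ}
    (hε : 0 < ε) : ∀ᶠ n in atTop, ∀ p ∈ K,
      |inducedDist (un n) (F n p.1) (F n p.2) - inducedDist u p.1 p.2| ≤ ε := by
  refine hK.induction_on (by simp) ?_ ?_ ?_
  · intro s t hst ht
    filter_upwards [ht] with n hn z hz using hn z (hst hz)
  · intro s t hs ht
    filter_upwards [hs, ht] with n h1 h2 z hz
    exact hz.elim (h1 z) (h2 z)
  · rintro ⟨z₀, w₀⟩ _
    have hfst : Tendsto (fun p : ℕ × (ℍ × ℍ) => (p.1, p.2.1)) (atTop ×ˢ 𝓝 (z₀, w₀))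
        (atTop ×ˢ 𝓝 z₀) :=
      tendsto_fst.prodMk ((continuous_fst.tendsto (z₀, w₀)).comp tendsto_snd)
    have hsnd : Tendsto (fun p : ℕ × (ℍ × ℍ) => (p.1, p.2.2)) (atTop ×ˢ 𝓝 (z₀, w₀))
        (atTop ×ˢ 𝓝 w₀) :=
      tendsto_fst.prodMk ((continuous_snd.tendsto (z₀, w₀)).comp tendsto_snd)
    have h1 := H.tendsto_inducedDist_of_tendsto (N := fun p : ℕ × (ℍ × ℍ) => p.1)
      (l := atTop ×ˢ 𝓝 (z₀, w₀)) tendsto_fst ((hF.tendsto z₀).comp hfst)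
      ((hF.tendsto w₀).comp hsnd)
    have h2 : Tendsto (fun p : ℕ × (ℍ × ℍ) => inducedDist u p.2.1 p.2.2) (atTop ×ˢ 𝓝 (z₀, w₀))
        (𝓝 (inducedDist u z₀ w₀)) :=
      (H.lim.continuous_inducedDist.tendsto (z₀, w₀)).comp tendsto_snd
    have h3 := (h1.sub h2).abs
    rw [sub_self, abs_zero] at h3
    obtain ⟨p, hp, q, hq, hpq⟩ := eventually_prod_iff.1 (h3.eventually (gt_mem_nhds hε))
    refine ⟨{z | q z}, mem_nhdsWithin_of_mem_nhds hq, ?_⟩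
    filter_upwards [hp] with n hn z hz using (hpq hn hz).le

/-- The quotient distances converge uniformly, when the quotients are identified by the maps
`F n`. Representatives which almost realize a quotient distance stay in a compact set. -/
theorem eventually_abs_quoDist_sub_le [CompactSpace (Quo Γ)]
    (hinv : ∀ σ ∈ Γ, ∀ z, u (σ z) = u z) {Γn : ℕ → Subgroup (ℍ ≃ᵢ ℍ)}
    (hinvn : ∀ n, ∀ σ ∈ Γn n, ∀ z, un n (σ z) = un n z) {τ' : ∀ n, Γ ≃* Γn n}
    (hτ : ∀ n σ, τ n σ = (τ' n σ : ℍ ≃ᵢ ℍ)) {f : ∀ n, Quo Γ → Quo (Γn n)}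
    (hf : ∀ n z, f n (Quotient.mk _ z) = Quotient.mk _ (F n z)) {ε : ℝ} (hε : 0 < ε) :
    ∀ᶠ n in atTop, ∀ x y,
      |quoDist (un n) (Γn n) (f n x) (f n y) - quoDist u Γ x y| ≤ ε := by
  obtain ⟨R, hR0, hR⟩ := exists_forall_dist_le (Γ := Γ) I
  have hKc := isCompact_closedBall I R
  obtain ⟨C, hC⟩ := ((hKc.prod hKc).bddAbove_image H.lim.continuous_inducedDist.continuousOn)
  have hC' : ∀ z ∈ Metric.closedBall I R, ∀ w ∈ Metric.closedBall I R, inducedDist u z w ≤ C :=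
    fun z hz w hw => hC ⟨(z, w), ⟨hz, hw⟩, rfl⟩
  -- representatives which almost realize a distance are at hyperbolic distance at most `M`
  obtain ⟨M, hM⟩ : ∃ M, M = 16 + 2 * ((1 + T ^ 2) * (C + ε)) := ⟨_, rfl⟩
  have hrep : ∀ x : Quo Γ, ∃ z ∈ Metric.closedBall I R, Quotient.mk _ z = x := by
    intro x
    induction x using Quotient.inductionOn with
    | h z =>
      obtain ⟨σ, hσ⟩ := hR z
      exact ⟨_, by rw [Metric.mem_closedBall, dist_comm]; exact hσ.le, quo_mk_apply σ z⟩
  have hQc := isCompact_closedBall I (R + M)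
  filter_upwards [hF.eventually_abs_inducedDist_sub_le H (hQc.prod hQc) (half_pos hε),
    hF.eventually_half_dist_le] with n hn hhalf x y
  obtain ⟨z, hz, rfl⟩ := hrep x
  obtain ⟨w, hw, rfl⟩ := hrep y
  have hCzw := hC' z hz w hw
  have hC0 : 0 ≤ C := (inducedDist_nonneg u z w).trans hCzw
  have hM0 : 0 ≤ M := by rw [hM]; positivity
  have hQ : ∀ σ : Γ, dist z ((σ : ℍ ≃ᵢ ℍ) w) ≤ M →
      |inducedDist (un n) (F n z) (F n ((σ : ℍ ≃ᵢ ℍ) w)) -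
        inducedDist u z ((σ : ℍ ≃ᵢ ℍ) w)| ≤ ε / 2 := by
    intro σ hσ
    rw [Metric.mem_closedBall] at hz
    refine hn (z, (σ : ℍ ≃ᵢ ℍ) w) ⟨?_, ?_⟩
    · rw [Metric.mem_closedBall]
      linarith
    · rw [Metric.mem_closedBall, dist_comm]
      rw [dist_comm] at hz
      linarith [dist_triangle I z ((σ : ℍ ≃ᵢ ℍ) w)]
  have hT : 0 ≤ 1 + T ^ 2 := by positivity
  have hfσ : ∀ σ : Γ, f n (Quotient.mk _ w) = Quotient.mk _ (F n ((σ : ℍ ≃ᵢ ℍ) w)) := by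
    intro σ
    rw [← hf, quo_mk_apply]
  have hle : quoDist (un n) (Γn n) (f n (Quotient.mk _ z)) (f n (Quotient.mk _ w)) ≤
      quoDist u Γ (Quotient.mk _ z) (Quotient.mk _ w) + ε := by
    obtain ⟨σ, hσ⟩ := exists_of_quoDist_mk_lt hinv (lt_add_of_pos_right
      (quoDist u Γ (Quotient.mk _ z) (Quotient.mk _ w)) (half_pos hε))
    have h1 := quoDist_mk_le (Γ := Γ) u z w
    have h2 := H.lim.dist_le_mul_inducedDist z ((σ : ℍ ≃ᵢ ℍ) w)
    have h3 : (1 + T ^ 2) * inducedDist u z ((σ : ℍ ≃ᵢ ℍ) w) ≤ (1 + T ^ 2) * (C + ε) :=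
      mul_le_mul_of_nonneg_left (by linarith) hT
    have h4 := (abs_le.1 (hQ σ (by
      have : 0 ≤ (1 + T ^ 2) * (C + ε) := by positivity
      linarith))).2
    have h5 := quoDist_mk_le (Γ := Γn n) (un n) (F n z) (F n ((σ : ℍ ≃ᵢ ℍ) w))
    rw [← hf, ← hfσ] at h5
    linarith
  have hge : quoDist u Γ (Quotient.mk _ z) (Quotient.mk _ w) ≤
      quoDist (un n) (Γn n) (f n (Quotient.mk _ z)) (f n (Quotient.mk _ w)) + ε := by
    have h0 := quoDist_mk_le (Γ := Γn n) (un n) (F n z) (F n w)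
    have h1 := (abs_le.1 (hn (z, w) ⟨Metric.closedBall_subset_closedBall (by linarith) hz,
      Metric.closedBall_subset_closedBall (by linarith) hw⟩)).2
    simp only at h1
    rw [hf, hf]
    obtain ⟨σ', hσ'⟩ := exists_of_quoDist_mk_lt (hinvn n) (lt_add_of_pos_right
      (quoDist (un n) (Γn n) (Quotient.mk _ (F n z)) (Quotient.mk _ (F n w))) (half_pos hε))
    obtain ⟨σ, rfl⟩ := (τ' n).surjective σ'
    rw [← hτ, ← hF.apply_smul] at hσ'
    have h2 := (H.seq n).dist_le_mul_inducedDist (F n z) (F n ((σ : ℍ ≃ᵢ ℍ) w))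
    have h3 : (1 + T ^ 2) * inducedDist (un n) (F n z) (F n ((σ : ℍ ≃ᵢ ℍ) w)) ≤
        (1 + T ^ 2) * (C + ε) := mul_le_mul_of_nonneg_left (by linarith) hT
    have h4 : dist z ((σ : ℍ ≃ᵢ ℍ) w) ≤ M := by
      have h5 : 0 ≤ (1 + T ^ 2) * (C + ε) := by positivity
      rcases le_total 16 (dist z ((σ : ℍ ≃ᵢ ℍ) w)) with h | h
      · have := hhalf _ _ h
        linarith
      · linarith
    have h5 := (abs_le.1 (hQ σ h4)).1
    have h6 := quoDist_mk_le (Γ := Γ) u z ((σ : ℍ ≃ᵢ ℍ) w)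
    rw [quo_mk_apply] at h6
    linarith
  rw [abs_le]
  constructor <;> linarith

end IsApproxIdentity

/-- Convergent sequences of Fuchsian groups are intertwined with their limit by maps close to the
identity. The bumps are so large that at every point one of them does not vanish. -/
theorem IsFuchsian.exists_isApproxIdentity {Γn : ℕ → Subgroup (ℍ ≃ᵢ ℍ)} (hΓ : IsFuchsian Γ)
    (hΓn : ∀ n, IsFuchsian (Γn n)) (τ : ∀ n, Γ ≃* Γn n)
    (hτ : ∀ σ : Γ, Tendsto (fun n => (τ n σ : ℍ ≃ᵢ ℍ)) atTop (𝓝 (σ : ℍ ≃ᵢ ℍ))) :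
    ∃ F, IsApproxIdentity Γ (fun n => (Γn n).subtype.comp (τ n).toMonoidHom) F := by
  have := hΓ.discrete
  have := hΓ.cocompact
  obtain ⟨R, hR0, hR⟩ := exists_forall_dist_le (Γ := Γ) I
  have hR' : ∀ z : ℍ, ∃ σ : Γ, Real.cosh (dist z ((σ : ℍ ≃ᵢ ℍ) I)) < Real.cosh R := by
    intro z
    obtain ⟨σ, hσ⟩ := hR z
    refine ⟨σ⁻¹, Real.cosh_lt_cosh.2 ?_⟩
    rw [abs_of_nonneg dist_nonneg, abs_of_pos hR0, ← (σ : ℍ ≃ᵢ ℍ).isometry.dist_eq]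
    have e : (σ : ℍ ≃ᵢ ℍ) (((σ⁻¹ : Γ) : ℍ ≃ᵢ ℍ) I) = I := (σ : ℍ ≃ᵢ ℍ).apply_symm_apply I
    rwa [e, dist_comm]
  have hmob : ∀ n, ∀ σ : Γ, ∃ g : Matrix.SpecialLinearGroup (Fin 2) ℝ, ∀ z,
      (Γn n).subtype.comp (τ n).toMonoidHom σ (((σ⁻¹ : Γ) : ℍ ≃ᵢ ℍ) z) = g • z := by
    intro n σ
    obtain ⟨g, hg⟩ := (hΓn n).orientation (τ n σ) (τ n σ).2
    obtain ⟨g', hg'⟩ := hΓ.orientation (σ⁻¹ : Γ) (σ⁻¹ : Γ).2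
    refine ⟨g * g', fun z => ?_⟩
    rw [mul_smul, ← hg', ← hg]
    rfl
  refine ⟨fun n => meanMap (Real.cosh R) ((Γn n).subtype.comp (τ n).toMonoidHom), ?_, ?_, ?_⟩
  · intro n σ z
    exact meanMap_apply hR' (fun σ => (hΓn n).orientation (τ n σ) (τ n σ).2) σ z
  · exact fun z₀ => tendsto_meanMap hR' hmob hτ z₀
  · exact fun z₀ => eventually_norm_meanMap_sub_le hR' hmob hτ z₀

end Convergence

end

end AdSFuchsian

theorem proposition3p9
    (un : ℕ → UpperHalfPlane → ℝ) (Γn : ℕ → Subgroup (UpperHalfPlane ≃ᵢ UpperHalfPlane))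
    (u : UpperHalfPlane → ℝ) (Γ : Subgroup (UpperHalfPlane ≃ᵢ UpperHalfPlane))
    (hn : ∀ n, AdSFuchsian.IsFuchsianCConvex (un n) (Γn n))
    (hconv : AdSFuchsian.PairsConverge un Γn u Γ) :
    ∃ φ : ℕ → ℕ, StrictMono φ ∧
      AdSFuchsian.MetricsConvergeUniformly
        (X := fun k => AdSFuchsian.Quo (Γn (φ k)))
        (fun k => AdSFuchsian.quoDist (un (φ k)) (Γn (φ k)))
        (AdSFuchsian.quoDist u Γ) := by
  obtain ⟨τ, hτ⟩ := hconv.groups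
  have hdisc := hconv.fuchsian.discrete
  have hcpt := hconv.fuchsian.cocompact
  choose Tn hTn using fun n => (hn n).cconvex.admissible
  obtain ⟨T₀, hT₀⟩ := hconv.cconvex.admissible
  obtain ⟨F, hF⟩ := hconv.fuchsian.exists_isApproxIdentity (fun n => (hn n).fuchsian) τ hτ
  have hinv' : ∀ n (σ : Γ) z, un n ((τ n σ : UpperHalfPlane ≃ᵢ UpperHalfPlane) z) = un n z :=
    fun n σ z => (hn n).invariant _ (τ n σ).2 z
  have hinv : ∀ σ ∈ Γ, ∀ z, u (σ z) = u z := fun σ hσ z =>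
    AdSFuchsian.invariant_of_tendsto hTn hT₀ hconv.functions
      (τ := fun n => (Γn n).subtype.comp (τ n).toMonoidHom) hinv' hτ ⟨σ, hσ⟩ z
  obtain ⟨T, hT⟩ := hF.exists_eventually_tan_le hTn hT₀ hconv.functions hinv'
  obtain ⟨N, hN⟩ := Filter.eventually_atTop.1 (hT.and hF.eventually_exists_homeomorph)
  have hφ : Filter.Tendsto (fun k => k + N) Filter.atTop Filter.atTop := Filter.tendsto_add_atTop_nat N
  have H : AdSFuchsian.AdmissibleLimit (max T T₀) (fun k => un (k + N)) u :=
    { seq := fun k => (hTn _).mono fun z => ((hN _ (Nat.le_add_left N k)).1 z).trans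
        (le_max_left _ _)
      lim := hT₀.mono fun z => (hT₀.tan_le z).trans (le_max_right _ _)
      tendsto := fun z => (hconv.functions z).comp hφ }
  choose e he using fun k => (hN (k + N) (Nat.le_add_left N k)).2
  choose f hf using fun k => AdSFuchsian.exists_quo_homeomorph (τ (k + N)) (e k) (fun σ z => by
    rw [he]
    exact hF.apply_smul (k + N) σ z)
  refine ⟨fun k => k + N, fun a b hab => Nat.add_lt_add_right hab N, fun k => ?_,
    hT₀.isMetricOn_quoDist hinv, f, fun ε hε => ?_⟩
  · have := (hn (k + N)).fuchsian.discrete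
    exact (hTn (k + N)).isMetricOn_quoDist (hn (k + N)).invariant
  · exact Filter.eventually_atTop.1 ((hF.comp_tendsto hφ).eventually_abs_quoDist_sub_le H hinv
      (fun k => (hn (k + N)).invariant) (τ' := fun k => τ (k + N)) (fun k σ => rfl)
      (f := fun k => f k) (fun k z => by rw [hf, he]) hε)
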